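/- **Setting.** Let $\mathcal M=(\mathcal S,\mathcal A,R,P,H)$ be a finite-horizon MDP with $S$ states, $A$ actions, horizon $H\ge 1$, transition kernel $P(s'\mid s,a)$ and random rewards $R(s,a)\in[0,1]$ with mean $r(s,a)$. For a deterministic policy $\pi:\mathcal S\times[H]\to\mathcal A$ let $V_1^\pi(s)=\mathbb E\big[\sum_{h=1}^H r(s_h,\pi(s_h,h))\mid s_1=s,\pi\big]$, $V_1^*(s)=\max_\pi V_1^\pi(s)$, and let $d_\pi\in\mathbb R^{SA}$, $d_\pi(s,a)=\sum_{h=1}^H\Pr\{s_h=s,a_h=a\mid s_1,P,\pi\}$, where $s_1$ is the initial state of the current episode. In episode $k=1,2,\dots$ an initial state $s_1^k$ is chosen arbitrarily (possibly depending on the past), the agent plays a policy $\pi_k$, the states evolve according to $P$, and rewards $R_h^k$ are drawn, independently along the trajectory, from the law of $R(s_h^k,a_h^k)$. The agent observes only $(s_h^k,a_h^k)_{h\le H}$ and the trajectory score $\hat V_k=\sum_{h=1}^H R_h^k$. Put $\hat d_k(s,a)=\sum_{h=1}^H\mathbf 1\{s_h^k=s,a_h^k=a\}$. The regret is $\mathrm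 R(K)=\sum_{k=1}^K\big(V_1^*(s_1^k)-V_1^{\pi_k}(s_1^k)\big)$. **Algorithm (Thompson sampling, known model).** Fix $\delta\in(0,1)$ and set $\lambda=H$, $v_k=\sqrt{9SAH\log\frac{kH^2}{\delta/10}}$, $A_k=\lambda I_{SA}+\sum_{l=1}^k\hat d_l\hat d_l^{\top}$, $Y_k=\sum_{l=1}^k\hat d_l\hat V_l$, $\hat r_k=A_k^{-1}Y_k$. In episode $k$, given everything that happened in the episodes before it and $s_1^k$, draw $\xi_k\sim\mathcal N(0,v_k^2A_{k-1}^{-1})$, set $\tilde r_k=\hat r_{k-1}+\xi_k$, and play some $\pi_k\in\arg\max_\pi d_\pi^{\top}\tilde r_k$. **Theorem.** There is an absolute constant $C>0$ such that for all such MDPs and all $\delta\in(0,1)$, with probability greater than $1-\delta$, for all integers $K>0$ simultaneously, $$\mathrm R(K)\le C\,(SA)^{3/2}H\sqrt{K\log K}\,\log\frac{KH}{\delta}+C\,SAH\sqrt{\log\frac{KH^2}{\delta}}.$$ -/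

import Mathlib

open MeasureTheory ProbabilityTheory
open scoped BigOperators Matrix

namespace TrajFeedback

/-- A finite-horizon MDP with time-independent dynamics: transition kernel `P(· ∣ s, a)` and the law
of the random reward `R(s, a) ∈ [0, 1]`. The horizon `H` is a separate parameter. -/
structure MDP (S A : Type*) where
  trans : S → A → PMF S
  rewardLaw : S → A → Measure ℝ
  isProbabilityMeasure_rewardLaw : ∀ s a, IsProbabilityMeasure (rewardLaw s a)
  reward_mem_Icc : ∀ s a, ∀ᵐ x ∂(rewardLaw s a), x ∈ Set.Icc (0 : ℝ) 1

/-- Deterministic time-dependent policies; the time-steps `1, …, H` are represented by `Fin H`. -/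
abbrev Policy (S A : Type*) (H : ℕ) : Type _ := Fin H → S → A

namespace MDP

variable {S A : Type*} {H : ℕ} (M : MDP S A)

/-- The expected reward `r(s, a) = 𝔼[R(s, a)]`. -/
noncomputable def meanReward (x : S × A) : ℝ := ∫ y, y ∂(M.rewardLaw x.1 x.2)

/-- The probability that the policy `π`, started at `s₁`, visits the states `σ 0, …, σ (H - 1)`. -/
noncomputable def pathProb [DecidableEq S] [NeZero H] (π : Policy S A H) (s₁ : S)
    (σ : Fin H → S) : ℝ :=
  (if σ 0 = s₁ then 1 else 0) *
    ∏ h : Fin H, if hh : (h : ℕ) + 1 < H then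
      (M.trans (σ h) (π h (σ h)) (σ ⟨(h : ℕ) + 1, hh⟩)).toReal else 1

/-- The value `V₁^π(s₁)`: the expected total mean reward of `π` started at `s₁`. -/
noncomputable def value [Fintype S] [DecidableEq S] [NeZero H] (π : Policy S A H) (s₁ : S) : ℝ :=
  ∑ σ : Fin H → S, M.pathProb π s₁ σ * ∑ h, M.meanReward (σ h, π h (σ h))

/-- The optimal value `V₁^*(s₁)`, a maximum over the finitely many policies. -/
noncomputable def optValue [Fintype S] [DecidableEq S] (H : ℕ) [NeZero H] (s₁ : S) : ℝ :=
  ⨆ π : Policy S A H, M.value π s₁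

/-- `q_h^π(s, a)`: the probability that `π`, started at `s₁`, is at `(s, a)` at time `h`. -/
noncomputable def occupancy [Fintype S] [DecidableEq S] [DecidableEq A] [NeZero H]
    (π : Policy S A H) (s₁ : S) (h : Fin H) (x : S × A) : ℝ :=
  ∑ σ : Fin H → S, M.pathProb π s₁ σ * (if (σ h, π h (σ h)) = x then 1 else 0)

/-- `d_π(s, a) = ∑_h q_h^π(s, a)`. -/
noncomputable def avgOccupancy [Fintype S] [DecidableEq S] [DecidableEq A] [NeZero H]
    (π : Policy S A H) (s₁ : S) (x : S × A) : ℝ :=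
  ∑ h : Fin H, M.occupancy π s₁ h x

end MDP

/-- The random quantities of an infinite sequence of episodes `k = 1, 2, …` (the index `0` is not
used): the states `s_h^k`, the rewards `R_h^k` collected at the time-steps, the noise `ξ_k`, and the
policy `π_k` that is played. -/
structure Run (S A : Type*) (H : ℕ) (Ω : Type*) where
  state : ℕ → Fin H → Ω → S
  reward : ℕ → Fin H → Ω → ℝ
  noise : ℕ → Ω → EuclideanSpace ℝ (S × A)
  policy : ℕ → Ω → Policy S A H

/-- The noise scale `v_k = √(9 S A H log (k H² / (δ / 10)))`. -/
noncomputable def noiseScale (S A : Type*) [Fintype S] [Fintype A] (H : ℕ) (δ : ℝ) (k : ℕ) : ℝ :=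
  Real.sqrt (9 * Fintype.card S * Fintype.card A * H * Real.log (k * (H : ℝ) ^ 2 / (δ / 10)))

namespace Run

variable {S A : Type*} {H : ℕ} {Ω : Type*} (X : Run S A H Ω)

/-- The action `a_h^k = π_k(s_h^k, h)`. -/
def action (k : ℕ) (h : Fin H) (ω : Ω) : A := X.policy k ω h (X.state k h ω)

/-- The trajectory feedback `V̂_k = ∑_h R_h^k`. -/
def score (k : ℕ) (ω : Ω) : ℝ := ∑ h, X.reward k h ω

/-- The empirical state-action frequency `d̂_k`. -/
def freq [DecidableEq S] [DecidableEq A] (k : ℕ) (ω : Ω) (x : S × A) : ℝ :=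
  ∑ h : Fin H, if (X.state k h ω, X.action k h ω) = x then 1 else 0

/-- `A_k = λ I + ∑_{l ≤ k} d̂_l d̂_lᵀ` with `λ = H`. -/
def gram [DecidableEq S] [DecidableEq A] (k : ℕ) (ω : Ω) : Matrix (S × A) (S × A) ℝ :=
  (H : ℝ) • (1 : Matrix (S × A) (S × A) ℝ) +
    ∑ l ∈ Finset.Icc 1 k, Matrix.vecMulVec (X.freq l ω) (X.freq l ω)

/-- `Y_k = ∑_{l ≤ k} V̂_l d̂_l`. -/
def response [DecidableEq S] [DecidableEq A] (k : ℕ) (ω : Ω) : S × A → ℝ :=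
  ∑ l ∈ Finset.Icc 1 k, X.score l ω • X.freq l ω

/-- The regularized least-squares estimator `r̂_k = A_k⁻¹ Y_k`. -/
noncomputable def lsEstimator [Fintype S] [Fintype A] [DecidableEq S] [DecidableEq A]
    (k : ℕ) (ω : Ω) : S × A → ℝ :=
  (X.gram k ω)⁻¹ *ᵥ X.response k ω

/-- The sampled reward `r̃_{k+1} = r̂_k + ξ_{k+1}` of episode `k + 1`. -/
noncomputable def sampledReward [Fintype S] [Fintype A] [DecidableEq S] [DecidableEq A]
    (k : ℕ) (ω : Ω) : S × A → ℝ :=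
  fun x => X.lsEstimator k ω x + X.noise (k + 1) ω x

/-- The regret `R(K) = ∑_{k=1}^K (V₁^*(s₁^k) - V₁^{π_k}(s₁^k))`. -/
noncomputable def regret [Fintype S] [DecidableEq S] [NeZero H] (M : MDP S A) (K : ℕ) (ω : Ω) : ℝ :=
  ∑ k ∈ Finset.Icc 1 K,
    (M.optValue H (X.state k 0 ω) - M.value (X.policy k ω) (X.state k 0 ω))

end Run

/-- `X` is a run in the MDP `M` of the Thompson sampling algorithm for trajectory feedback and known
model with parameter `δ` (and `λ = H`). The sigma-algebra `𝓕 k` is the information present when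
episode `k + 1` starts: everything that happened in the episodes `1, …, k`, and the initial state of
episode `k + 1`, whose choice is otherwise unrestricted. -/
structure IsThompsonRun {S A : Type*} {H : ℕ} {Ω : Type*} [Fintype S] [Fintype A]
    [DecidableEq S] [DecidableEq A] [NeZero H] {mΩ : MeasurableSpace Ω}
    (M : MDP S A) (δ : ℝ) (μ : Measure Ω) (𝓕 : Filtration ℕ mΩ) (X : Run S A H Ω) : Prop where
  measurable_init : ∀ k s, MeasurableSet[𝓕 k] {ω | X.state (k + 1) 0 ω = s}
  measurable_state : ∀ k h s, MeasurableSet[𝓕 (k + 1)] {ω | X.state (k + 1) h ω = s}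
  measurable_reward : ∀ k h, Measurable[𝓕 (k + 1)] (X.reward (k + 1) h)
  measurable_noise : ∀ k, Measurable[𝓕 (k + 1)] (X.noise (k + 1))
  /-- Given `𝓕 k`, the noise `ξ_{k+1}` has law `N(0, v_{k+1}² A_k⁻¹)`. -/
  noise_law : ∀ k, ∀ B : Set (EuclideanSpace ℝ (S × A)), MeasurableSet B →
    μ⟦X.noise (k + 1) ⁻¹' B | 𝓕 k⟧ =ᵐ[μ] fun ω =>
      (multivariateGaussian (0 : EuclideanSpace ℝ (S × A))
        ((noiseScale S A H δ (k + 1)) ^ 2 • (X.gram k ω)⁻¹)).real B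
  /-- The policy is computed from the past and from the noise just drawn. -/
  measurable_policy : ∀ k π,
    MeasurableSet[𝓕 k ⊔ MeasurableSpace.comap (X.noise (k + 1)) inferInstance]
      {ω | X.policy (k + 1) ω = π}
  /-- `π_{k+1}` maximizes `d_πᵀ r̃_{k+1}`. -/
  policy_argmax : ∀ k ω (π : Policy S A H),
    M.avgOccupancy π (X.state (k + 1) 0 ω) ⬝ᵥ X.sampledReward k ω ≤
      M.avgOccupancy (X.policy (k + 1) ω) (X.state (k + 1) 0 ω) ⬝ᵥ X.sampledReward k ω
  /-- Given the past, the noise and hence the policy, the states of episode `k + 1` follow the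
  transition kernel, and the rewards along a path are independent with the laws of the visited
  state-action pairs. -/
  episode_law : ∀ k (σ : Fin H → S) (B : Set (Fin H → ℝ)), MeasurableSet B →
    μ⟦{ω | (∀ h, X.state (k + 1) h ω = σ h) ∧ (fun h => X.reward (k + 1) h ω) ∈ B} |
        𝓕 k ⊔ MeasurableSpace.comap (X.noise (k + 1)) inferInstance⟧ =ᵐ[μ] fun ω =>
      M.pathProb (X.policy (k + 1) ω) (X.state (k + 1) 0 ω) σ *
        (Measure.pi fun h => M.rewardLaw (σ h) (X.policy (k + 1) ω h (σ h))).real B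

end TrajFeedback

/-!
Write `n = |S × A|` and let `‖d‖_k = √(dᵀ A_k⁻¹ d)` be the norm in which the least-squares estimator
is accurate. The argument is that of Thompson sampling for linear bandits, with the occupancies
`d_π` as arms, and with some care for the powers of `H` and of the logarithms.

*Concentration.* Every probabilistic estimate is an instance of Ville's inequality (`ville`,
`ville_exp`) for a product of factors with conditional mean at most one. The conditional means are
computed from the laws of the noise and of an episode by `lintegral_le_of_condLaw`.
- Given its path, the score of an episode is subgaussian with variance proxy at most `H`. Averaging
  the exponential martingale over a normal law gives the self-normalized bound
  `IsThompsonRun.measure_noiseSum_gt_le`; hence `dᵀ r̂_k` is within `2 v_{k+1} ‖d‖_k` of `dᵀ r`.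
- The noise `ξ_{k+1}` stays within `g_k v_{k+1} ‖d_π‖_k`, where `g_k` is of order `√(n log)`, for all
  policies (`IsThompsonRun.measure_exists_noise_gt_le`).
- With conditional probability at least `p = P(N(0, 1) ≥ 2)` the noise exceeds `2 v_{k+1} ‖d_{π*}‖_k` in
  the direction of an optimal policy, so that this policy looks at least as good as it is. For a
  predictable sequence in `[0, 1]`, the sum over the episodes in which this happens is at least `p / 2`
  times the whole sum, up to `log (1 / ε)` (`IsThompsonRun.measure_optimism_le`).
- In the same multiplicative way, `∑ ‖d_{π_k}‖` is at most twice `∑ ‖d̂_k‖`, up to a logarithm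
  (`IsThompsonRun.measure_sum_ellNorm_gt_le`).

*Regret.* The optimal value minus the largest lower confidence bound, clipped to `[0, H]`, is known
before the noise is drawn. It bounds the regret of the episode up to `(2 + g_k) v_{k+1} ‖d_{π_k}‖_k`, and
in the optimistic episodes it is itself at most `2 g_k v_{k+1} ‖d_{π_k}‖_k` (`IsThompsonRun.gap_le`).
So the regret is of order `g v ∑ ‖d_{π_k}‖ + H log (1 / ε)`, and the elliptical potential lemma
`Run.sum_ellNorm_sq_le` bounds the sum by a multiple of `√(H n K log K)`. All logarithms are comparable
to `log (K H / δ)` if `n² ≤ K`. If `K < n²` or `√K < log (K H / δ)`, the trivial bound `K H` suffices.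

*One episode.* For `K = 1` the factor `√(K log K)` vanishes, and only the second term of the bound is
left. It dominates the trivial bound `H` unless `H = 1` and `1 - δ` is smaller than `1 / (2 n²)`. In that
case the first policy only has to be optimal with probability slightly above `1 - δ`. This holds because
the first noise vector is isotropic: by symmetry it is largest at an optimal action with probability at
least `1 / |A|` (`inv_card_le_multivariateGaussian_argmax`).
-/

namespace TrajFeedback
open scoped ENNReal

/-! ### Conditional laws and Ville's inequality -/

/-- A conditional law given setwise, with an exceptional null set for each Borel set, agrees almost
surely with the regular conditional distribution. -/
theorem ae_condDistrib_eq_of_condExp_eq {Ω E : Type*} {m mΩ : MeasurableSpace Ω} (hm : m ≤ mΩ)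
    {μ : Measure Ω} [IsProbabilityMeasure μ] [MeasurableSpace E] [StandardBorelSpace E] [Nonempty E]
    {Y : Ω → E} (hY : Measurable Y) {ν : Ω → Measure E} [∀ ω, IsProbabilityMeasure (ν ω)]
    (h : ∀ B, MeasurableSet B → μ⟦Y ⁻¹' B | m⟧ =ᵐ[μ] fun ω => (ν ω).real B) :
    ∀ᵐ ω ∂μ, (@condDistrib Ω Ω E _ _ _ mΩ m Y id μ _) ω = ν ω := by
  have hid : @Measurable Ω Ω mΩ m id := measurable_id'' hm
  have h1 : ∀ B, MeasurableSet B →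
      ∀ᵐ ω ∂μ, ((@condDistrib Ω Ω E _ _ _ mΩ m Y id μ _) ω).real B = (ν ω).real B := by
    intro B hB
    have := condDistrib_ae_eq_condExp (mβ := m) (X := id) (μ := μ) hid hY hB
    rw [MeasurableSpace.comap_id] at this
    exact this.trans (h B hB)
  -- A countable algebra generating the sigma-algebra of `E` determines finite measures.
  have hgen : MeasurableSpace.generateFrom
      (generateSetAlgebra (MeasurableSpace.countableGeneratingSet E)) = ‹MeasurableSpace E› := by
    rw [generateFrom_generateSetAlgebra_eq, MeasurableSpace.generateFrom_countableGeneratingSet]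
  have h2 : ∀ᵐ ω ∂μ, ∀ B ∈ generateSetAlgebra (MeasurableSpace.countableGeneratingSet E),
      ((@condDistrib Ω Ω E _ _ _ mΩ m Y id μ _) ω).real B = (ν ω).real B := by
    rw [ae_ball_iff (countable_generateSetAlgebra MeasurableSpace.countable_countableGeneratingSet)]
    intro B hB
    refine h1 B ?_
    rw [← hgen]
    exact MeasurableSpace.measurableSet_generateFrom hB
  filter_upwards [h2] with ω hω
  refine ext_of_generate_finite _ hgen.symm
    isSetAlgebra_generateSetAlgebra.isSetRing.isSetSemiring.isPiSystem (fun B hB => ?_) (by simp)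
  · have := hω B hB
    rwa [measureReal_def, measureReal_def,
      ENNReal.toReal_eq_toReal_iff' (measure_ne_top _ _) (measure_ne_top _ _)] at this

/-- Disintegration as an inequality: if `ν` is the conditional law of `Y` given `m`, then a bound `g` for
the integral of `F` over `ν` bounds the integral of `F` at `Y`, with any `m`-measurable weight `w`.
The weight makes the lemma usable one factor at a time in products, with no integrability to check. -/
theorem lintegral_le_of_condLaw {Ω E T : Type*} {m mΩ : MeasurableSpace Ω} (hm : m ≤ mΩ)
    {μ : Measure Ω} [IsProbabilityMeasure μ] [mE : MeasurableSpace E] [StandardBorelSpace E]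
    [Nonempty E] [MeasurableSpace T]
    {Y : Ω → E} (hY : Measurable Y) {ν : Ω → Measure E} [∀ ω, IsProbabilityMeasure (ν ω)]
    (h : ∀ B, MeasurableSet B → μ⟦Y ⁻¹' B | m⟧ =ᵐ[μ] fun ω => (ν ω).real B)
    {Φ : Ω → T} (hΦ : Measurable[m] Φ) {F : T × E → ℝ≥0∞} (hF : Measurable F)
    {g : Ω → ℝ≥0∞} (hg : ∀ᵐ ω ∂μ, ∫⁻ y, F (Φ ω, y) ∂ν ω ≤ g ω)
    {w : Ω → ℝ≥0∞} (hw : Measurable[m] w) :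
    ∫⁻ ω, w ω * F (Φ ω, Y ω) ∂μ ≤ ∫⁻ ω, w ω * g ω ∂μ := by
  have hid : @Measurable Ω Ω mΩ m id := measurable_id'' hm
  let f : (Ω × E) → ℝ≥0∞ := fun p => w p.1 * F (Φ p.1, p.2)
  have hf : @Measurable _ _ (m.prod mE) _ f := by
    have h1 : @Measurable (Ω × E) Ω (m.prod mE) m Prod.fst := @measurable_fst Ω E m _
    have h2 : @Measurable (Ω × E) E (m.prod mE) _ Prod.snd := @measurable_snd Ω E m _
    exact Measurable.mul (hw.comp h1) (hF.comp ((hΦ.comp h1).prodMk h2))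
  have key : ∫⁻ ω, w ω * F (Φ ω, Y ω) ∂μ
      = ∫⁻ ω, ∫⁻ y, f (ω, y) ∂(@condDistrib Ω Ω E _ _ _ mΩ m Y id μ _) ω ∂μ := by
    have e := compProd_map_condDistrib (mβ := m) (X := id) (μ := μ) hY.aemeasurable
    have e1 := @lintegral_map _ _ mΩ (m.prod mE) μ f _ hf (hid.prodMk hY)
    have e2 := @Measure.lintegral_compProd Ω E m _ (@Measure.map _ _ mΩ m id μ)
      (@condDistrib Ω Ω E _ _ _ mΩ m Y id μ _) _ _ f hf
    have hG := @Measurable.lintegral_kernel_prod_right' Ω E m mE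
      (@condDistrib Ω Ω E _ _ _ mΩ m Y id μ _) _ f hf
    have e3 := @lintegral_map _ _ mΩ m μ _ id hG hid
    rw [e] at e2
    exact e1.symm.trans (e2.trans e3)
  rw [key]
  refine lintegral_mono_ae ?_
  filter_upwards [ae_condDistrib_eq_of_condExp_eq hm hY h, hg] with ω h1 h2
  rw [h1]
  have h3 : Measurable fun y => F (Φ ω, y) := hF.comp (measurable_const.prodMk measurable_id)
  simp only [f]
  rw [lintegral_const_mul _ h3]
  gcongr

/-- Ville's maximal inequality for a product of nonnegative factors whose conditional means are at most
one, the condition on the means being stated through weights known beforehand. -/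
theorem ville {Ω : Type*} {mΩ : MeasurableSpace Ω} {μ : Measure Ω} [IsProbabilityMeasure μ]
    (𝓕 : Filtration ℕ mΩ) (D : ℕ → Ω → ℝ≥0∞) (hD : ∀ k, Measurable[𝓕 (k + 1)] (D k))
    (hint : ∀ k (w : Ω → ℝ≥0∞), Measurable[𝓕 k] w →
      ∫⁻ ω, w ω * D k ω ∂μ ≤ ∫⁻ ω, w ω ∂μ) (c : ℝ≥0∞) :
    c * μ {ω | ∃ K, c < ∏ k ∈ Finset.range K, D k ω} ≤ 1 := by
  set N : ℕ → Ω → ℝ≥0∞ := fun K ω => ∏ k ∈ Finset.range K, D k ω with hN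
  have hNm : ∀ K, Measurable[𝓕 K] (N K) := by
    intro K
    refine Finset.measurable_prod _ fun k hk => (hD k).mono (𝓕.mono ?_) le_rfl
    have := Finset.mem_range.1 hk
    omega
  have hNm' : ∀ K, Measurable (N K) := fun K => (hNm K).mono (𝓕.le K) le_rfl
  set T : ℕ → Set Ω := fun K => {ω | ∃ j ≤ K, c < N j ω} with hT
  have hTm : ∀ K, MeasurableSet[𝓕 K] (T K) := by
    intro K
    have : T K = ⋃ j ∈ Finset.range (K + 1), {ω | c < N j ω} := by
      ext ω; simp [hT]
    rw [this]
    refine Finset.measurableSet_biUnion _ fun j hj => ?_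
    have hj' : j ≤ K := Nat.lt_succ_iff.1 (Finset.mem_range.1 hj)
    exact measurableSet_lt measurable_const ((hNm j).mono (𝓕.mono hj') le_rfl)
  have hTm' : ∀ K, MeasurableSet (T K) := fun K => 𝓕.le K _ (hTm K)
  have hmono : Monotone T := by
    intro a b hab ω ⟨j, hj, h⟩
    exact ⟨j, hj.trans hab, h⟩
  -- the mass stopped at level `c` plus the mass still running never increases
  have claim : ∀ K, c * μ (T K) + ∫⁻ ω in (T K)ᶜ, N K ω ∂μ ≤ 1 := by
    intro K
    induction K with
    | zero =>
      by_cases hc : c < 1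
      · have : T 0 = Set.univ := by ext ω; simp [hT, hN, hc]
        simp [this, hc.le]
      · have : T 0 = ∅ := by ext ω; simp [hT, hN, not_lt.1 hc]
        simp [this, hN]
    | succ K ih =>
      refine le_trans ?_ ih
      have hsub : T K ⊆ T (K + 1) := hmono (Nat.le_succ K)
      have h1 : μ (T (K + 1)) = μ (T K) + μ (T (K + 1) \ T K) := by
        rw [measure_sdiff hsub (hTm' K).nullMeasurableSet (measure_ne_top _ _),
          add_tsub_cancel_of_le (measure_mono hsub)]
      have h2 : c * μ (T (K + 1) \ T K) ≤ ∫⁻ ω in T (K + 1) \ T K, N (K + 1) ω ∂μ := by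
        rw [← setLIntegral_const]
        refine setLIntegral_mono' ((hTm' _).diff (hTm' _)) fun ω hω => ?_
        obtain ⟨⟨j, hj, hlt⟩, h'⟩ := hω
        rcases Nat.lt_or_ge j (K + 1) with hlt' | hge
        · exact absurd ⟨j, Nat.lt_succ_iff.1 hlt', hlt⟩ h'
        · rw [le_antisymm hj hge] at hlt
          exact hlt.le
      have h3 : (∫⁻ ω in T (K + 1) \ T K, N (K + 1) ω ∂μ) + ∫⁻ ω in (T (K + 1))ᶜ, N (K + 1) ω ∂μ
          = ∫⁻ ω in (T K)ᶜ, N (K + 1) ω ∂μ := by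
        rw [← lintegral_union (hTm' _).compl]
        · congr 2
          ext ω
          simp only [Set.mem_union, Set.mem_sdiff, Set.mem_compl_iff]
          have := @hsub ω
          tauto
        · rw [Set.disjoint_left]; intro ω h h'; exact h' h.1
      have h4 : ∫⁻ ω in (T K)ᶜ, N (K + 1) ω ∂μ ≤ ∫⁻ ω in (T K)ᶜ, N K ω ∂μ := by
        rw [← lintegral_indicator (hTm' K).compl, ← lintegral_indicator (hTm' K).compl]
        refine le_trans (le_of_eq ?_) (hint K _ ((hNm K).indicator (hTm K).compl))
        refine lintegral_congr fun ω => ?_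
        by_cases hω : ω ∈ (T K)ᶜ
        · simp only [Set.indicator_of_mem hω]; simp [hN, Finset.prod_range_succ]
        · simp only [Set.indicator_of_notMem hω]; simp
      rw [h1, mul_add, add_assoc]
      gcongr
      calc _ ≤ _ := add_le_add_left h2 _
        _ = _ := h3
        _ ≤ _ := h4
  have hU : {ω | ∃ K, c < ∏ k ∈ Finset.range K, D k ω} = ⋃ K, T K := by
    ext ω
    simp only [Set.mem_ofPred_eq, Set.mem_iUnion, hT, hN]
    exact ⟨fun ⟨K, h⟩ => ⟨K, K, le_rfl, h⟩, fun ⟨_, j, _, h⟩ => ⟨j, h⟩⟩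
  rw [hU, hmono.measure_iUnion, ENNReal.mul_iSup]
  exact iSup_le fun K => le_self_add.trans (claim K)

/-! ### Rank-one updates, quadratic forms and logarithms -/

section LinearAlgebra

variable {n : Type*} [Fintype n]

theorem dotProduct_mulVec_comm {B : Matrix n n ℝ} (hB : B.IsHermitian) (x y : n → ℝ) :
    x ⬝ᵥ B *ᵥ y = y ⬝ᵥ B *ᵥ x := by
  have hT : Bᵀ = B := by simpa using hB.eq
  rw [Matrix.dotProduct_mulVec, ← Matrix.mulVec_transpose, hT, dotProduct_comm]

/-- The Cauchy–Schwarz inequality for a positive semidefinite form. -/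
theorem abs_dotProduct_mulVec_le {B : Matrix n n ℝ} (hB : B.PosSemidef) (x y : n → ℝ) :
    |x ⬝ᵥ B *ᵥ y| ≤ Real.sqrt (x ⬝ᵥ B *ᵥ x) * Real.sqrt (y ⬝ᵥ B *ᵥ y) := by
  classical
  have h0 : ∀ z : n → ℝ, 0 ≤ z ⬝ᵥ B *ᵥ z := fun z => by simpa using hB.dotProduct_mulVec_nonneg z
  have h := (Matrix.toBilin' B).apply_mul_apply_le_of_forall_zero_le
    (fun z => by simpa [Matrix.toBilin'_apply'] using h0 z) x y
  simp only [Matrix.toBilin'_apply'] at h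
  rw [dotProduct_mulVec_comm hB.isHermitian y x] at h
  rw [← Real.sqrt_mul (h0 x)]
  exact Real.abs_le_sqrt (by rw [sq]; exact h)

variable [DecidableEq n]

/-- If `c I ≤ A` then `A⁻¹ ≤ c⁻¹ I`, in terms of quadratic forms. -/
theorem dotProduct_inv_mulVec_le {A : Matrix n n ℝ} (hA : A.PosDef) {c : ℝ} (hc : 0 < c)
    (h : ∀ y : n → ℝ, c * (y ⬝ᵥ y) ≤ y ⬝ᵥ A *ᵥ y) (x : n → ℝ) :
    x ⬝ᵥ A⁻¹ *ᵥ x ≤ (x ⬝ᵥ x) / c := by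
  set y := A⁻¹ *ᵥ x with hy
  have hAy : A *ᵥ y = x := by
    rw [hy, Matrix.mulVec_mulVec,
      Matrix.mul_nonsing_inv _ ((Matrix.isUnit_iff_isUnit_det _).1 hA.isUnit), Matrix.one_mulVec]
  have h1 := h y
  rw [hAy, dotProduct_comm y x] at h1
  have h2 : 0 ≤ (x - c • y) ⬝ᵥ (x - c • y) := by
    simpa using dotProduct_star_self_nonneg (x - c • y)
  have h3 : (x - c • y) ⬝ᵥ (x - c • y) = x ⬝ᵥ x - 2 * c * (x ⬝ᵥ y) + c * (c * (y ⬝ᵥ y)) := by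
    simp only [sub_dotProduct, dotProduct_sub, smul_dotProduct, dotProduct_smul, smul_eq_mul,
      dotProduct_comm y x]
    ring
  rw [le_div_iff₀ hc]
  nlinarith [mul_le_mul_of_nonneg_left h1 hc.le]

/-- The matrix determinant lemma for a symmetric rank-one update. -/
theorem det_add_vecMulVec {A : Matrix n n ℝ} (hA : A.PosDef) (x : n → ℝ) :
    (A + Matrix.vecMulVec x x).det = A.det * (1 + x ⬝ᵥ A⁻¹ *ᵥ x) := by
  have hu : IsUnit A.det := (Matrix.isUnit_iff_isUnit_det _).1 hA.isUnit
  rw [Matrix.vecMulVec_eq Unit, Matrix.det_add_replicateCol_mul_replicateRow hu]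
  congr 1
  simp [Matrix.det_unique, Matrix.mul_apply, Matrix.replicateRow, Matrix.replicateCol,
    dotProduct, Matrix.mulVec, Finset.mul_sum, Finset.sum_mul, mul_assoc]
  rw [Finset.sum_comm]

omit [DecidableEq n] in
theorem posDef_add_vecMulVec {A : Matrix n n ℝ} (hA : A.PosDef) (x : n → ℝ) :
    (A + Matrix.vecMulVec x x).PosDef := by
  simpa using hA.add_posSemidef (by simpa using Matrix.posSemidef_vecMulVec_self_star x)

/-- The Sherman–Morrison formula for a symmetric rank-one update, in terms of quadratic forms. -/
theorem inv_add_vecMulVec_quadForm {A : Matrix n n ℝ} (hA : A.PosDef) (x z : n → ℝ) :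
    z ⬝ᵥ (A + Matrix.vecMulVec x x)⁻¹ *ᵥ z
      = z ⬝ᵥ A⁻¹ *ᵥ z - (x ⬝ᵥ A⁻¹ *ᵥ z) ^ 2 / (1 + x ⬝ᵥ A⁻¹ *ᵥ x) := by
  have hu : IsUnit A.det := (Matrix.isUnit_iff_isUnit_det _).1 hA.isUnit
  have hu' : IsUnit (A + Matrix.vecMulVec x x).det :=
    (Matrix.isUnit_iff_isUnit_det _).1 (posDef_add_vecMulVec hA x).isUnit
  have hpos : 0 < 1 + x ⬝ᵥ A⁻¹ *ᵥ x := by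
    have := hA.inv.posSemidef.dotProduct_mulVec_nonneg x
    simp only [star_trivial] at this
    linarith
  set t := (x ⬝ᵥ A⁻¹ *ᵥ z) / (1 + x ⬝ᵥ A⁻¹ *ᵥ x) with ht
  have key : (A + Matrix.vecMulVec x x)⁻¹ *ᵥ z = A⁻¹ *ᵥ z - t • A⁻¹ *ᵥ x := by
    have h1 : (A + Matrix.vecMulVec x x) *ᵥ (A⁻¹ *ᵥ z - t • A⁻¹ *ᵥ x) = z := by
      have e1 : ∀ w, A *ᵥ (A⁻¹ *ᵥ w) = w := fun w => by
        rw [Matrix.mulVec_mulVec, Matrix.mul_nonsing_inv _ hu, Matrix.one_mulVec]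
      rw [Matrix.add_mulVec, Matrix.mulVec_sub, Matrix.mulVec_smul, e1, e1,
        Matrix.vecMulVec_mulVec, dotProduct_sub, dotProduct_smul]
      ext i
      simp only [Pi.add_apply, Pi.sub_apply, Pi.smul_apply, smul_eq_mul, MulOpposite.smul_eq_mul_unop,
        MulOpposite.unop_op]
      have : x ⬝ᵥ A⁻¹ *ᵥ z = t * (1 + x ⬝ᵥ A⁻¹ *ᵥ x) := by rw [ht]; field_simp
      rw [this]; ring
    rw [← h1, Matrix.mulVec_mulVec, Matrix.nonsing_inv_mul _ hu', Matrix.one_mulVec, h1]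
  rw [key, dotProduct_sub, dotProduct_smul, dotProduct_mulVec_comm hA.inv.isHermitian z x, ht]
  simp only [smul_eq_mul]
  ring

theorem det_le_pow {A : Matrix n n ℝ} (hA : A.PosDef) {c : ℝ}
    (h : ∀ y : n → ℝ, y ⬝ᵥ A *ᵥ y ≤ c * (y ⬝ᵥ y)) : A.det ≤ c ^ Fintype.card n := by
  have hH := hA.isHermitian
  rw [hH.det_eq_prod_eigenvalues]
  simp only [RCLike.ofReal_real_eq_id, id]
  rw [← Finset.card_univ, ← Finset.prod_const]
  refine Finset.prod_le_prod (fun i _ => (hA.eigenvalues_pos i).le) fun i _ => ?_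
  have h1 := hH.eigenvalues_eq i
  have h2 := h (hH.eigenvectorBasis i).ofLp
  have h3 : (hH.eigenvectorBasis i).ofLp ⬝ᵥ (hH.eigenvectorBasis i).ofLp = 1 := by
    have := hH.eigenvectorBasis.orthonormal.1 i
    have h4 := EuclideanSpace.real_norm_sq_eq (hH.eigenvectorBasis i)
    rw [this] at h4
    simp only [dotProduct, ← sq]
    rw [← h4]; norm_num
  simp only [star_trivial, RCLike.re_to_real] at h1
  rw [h1]
  rw [h3, mul_one] at h2
  exact h2

theorem half_le_log {z : ℝ} (hz : 2 ≤ z) : (1 / 2 : ℝ) ≤ Real.log z := by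
  have := Real.log_le_log (by norm_num) hz
  linarith [Real.log_two_gt_d9]

/-- By concavity, `log (1 + u)` lies above its chord over `[0, h]`. -/
theorem le_mul_log_one_add {h u : ℝ} (hh : 0 < h) (hu0 : 0 ≤ u) (hu : u ≤ h) :
    u ≤ h / Real.log (1 + h) * Real.log (1 + u) := by
  have hlog : 0 < Real.log (1 + h) := Real.log_pos (by linarith)
  have hc := strictConcaveOn_log_Ioi.concaveOn.2 (show (1 : ℝ) ∈ Set.Ioi 0 by simp)
    (show 1 + h ∈ Set.Ioi 0 by simp; linarith)
    (show 0 ≤ 1 - u / h by rw [sub_nonneg, div_le_one hh]; exact hu)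
    (show 0 ≤ u / h by positivity) (by ring)
  have e : (1 - u / h) • (1 : ℝ) + (u / h) • (1 + h) = 1 + u := by
    simp only [smul_eq_mul]; field_simp; ring
  rw [e] at hc
  simp only [Real.log_one, smul_eq_mul, mul_zero, zero_add] at hc
  rw [div_mul_eq_mul_div, le_div_iff₀ hlog]
  calc u * Real.log (1 + h) = h * (u / h * Real.log (1 + h)) := by field_simp
    _ ≤ h * Real.log (1 + u) := by gcongr

theorem log_one_add_mul_le {K h : ℝ} (hK : 2 ≤ K) (hh : 1 ≤ h) :
    Real.log (1 + K * h) ≤ 4 * Real.log K * Real.log (1 + h) := by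
  have a1 := half_le_log hK
  have a2 := half_le_log (show 2 ≤ 1 + h by linarith)
  have a3 : Real.log (1 + K * h) ≤ Real.log K + Real.log (1 + h) := by
    rw [← Real.log_mul (by linarith) (by linarith)]
    exact Real.log_le_log (by positivity) (by nlinarith)
  nlinarith

end LinearAlgebra

/-! ### Normal vectors -/

section Gaussian

/-- The exponential of a quadratic polynomial integrated over a normal law, by completing the square. -/
theorem lintegral_exp_gaussianReal (η m : ℝ) {u : NNReal} :
    ∫⁻ l, ENNReal.ofReal (Real.exp (η * l - l ^ 2 / 2)) ∂(gaussianReal m u)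
      = ENNReal.ofReal (Real.exp ((2 * η * m + η ^ 2 * u - m ^ 2) / (2 * (1 + u))) /
          Real.sqrt (1 + u)) := by
  rcases eq_or_ne u 0 with rfl | hu
  · rw [gaussianReal_zero_var, lintegral_dirac' _ (by fun_prop)]
    congr 1
    simp
    ring
  have hu0 : (0 : ℝ) < u := by positivity
  have hu1 : (0 : ℝ) < 1 + u := by positivity
  rw [gaussianReal_of_var_ne_zero _ hu, lintegral_withDensity_eq_lintegral_mul _
    (measurable_gaussianPDF m u) (by fun_prop)]
  set w : NNReal := u / (1 + u) with hw
  have hw0 : w ≠ 0 := by positivity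
  have hwr : (w : ℝ) = u / (1 + u) := by simp [hw]
  set c := Real.exp ((2 * η * m + η ^ 2 * u - m ^ 2) / (2 * (1 + u))) / Real.sqrt (1 + u) with hc
  have hc0 : 0 ≤ c := by positivity
  have key : ∀ l, (gaussianPDF m u * fun l => ENNReal.ofReal (Real.exp (η * l - l ^ 2 / 2))) l
      = ENNReal.ofReal c * gaussianPDF ((η * u + m) / (1 + u)) w l := by
    intro l
    simp only [Pi.mul_apply, gaussianPDF]
    rw [← ENNReal.ofReal_mul (gaussianPDFReal_nonneg _ _ _), ← ENNReal.ofReal_mul hc0]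
    congr 1
    simp only [gaussianPDFReal]
    rw [hc, hwr]
    have e1 : Real.sqrt (2 * Real.pi * u)
        = Real.sqrt (1 + u) * Real.sqrt (2 * Real.pi * (u / (1 + u))) := by
      rw [← Real.sqrt_mul hu1.le]
      congr 1
      field_simp
    rw [e1, mul_inv, mul_assoc, ← Real.exp_add, div_mul_eq_mul_div, mul_comm (Real.exp _),
      mul_assoc _ (Real.exp _) (Real.exp _), ← Real.exp_add]
    have e2 : -(l - m) ^ 2 / (2 * u) + (η * l - l ^ 2 / 2)
        = -(l - (η * u + m) / (1 + u)) ^ 2 / (2 * (u / (1 + u))) +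
          (2 * η * m + η ^ 2 * u - m ^ 2) / (2 * (1 + u)) := by
      field_simp
      ring
    rw [e2]
    ring
  simp_rw [key]
  rw [lintegral_const_mul _ (measurable_gaussianPDF _ _), lintegral_gaussianPDF_eq_one _ hw0, mul_one]

/-- Method of mixtures: if `f` is subgaussian with variance proxy one, then `exp (l f - l² / 2)` has mean
at most one for each `l`, hence also after averaging `l` over the normal law `N(m, u)`. -/
theorem lintegral_exp_quadratic_le_one {α : Type*} [MeasurableSpace α] {ρ : Measure α} [SFinite ρ]
    {f : α → ℝ} (hf : Measurable f)
    (h : ∀ t, ∫⁻ y, ENNReal.ofReal (Real.exp (t * f y)) ∂ρ ≤ ENNReal.ofReal (Real.exp (t ^ 2 / 2)))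
    (m : ℝ) {u : ℝ} (hu : 0 ≤ u) :
    ∫⁻ y, ENNReal.ofReal (Real.exp ((2 * f y * m + f y ^ 2 * u - m ^ 2) / (2 * (1 + u))) /
          Real.sqrt (1 + u)) ∂ρ ≤ 1 := by
  lift u to NNReal using hu
  simp_rw [← lintegral_exp_gaussianReal]
  rw [lintegral_lintegral_swap (by fun_prop)]
  calc _ ≤ ∫⁻ l, 1 ∂(gaussianReal m u) := by
        refine lintegral_mono fun l => ?_
        have e : ∀ y, ENNReal.ofReal (Real.exp (f y * l - l ^ 2 / 2))
            = ENNReal.ofReal (Real.exp (-(l ^ 2 / 2))) * ENNReal.ofReal (Real.exp (l * f y)) := by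
          intro y
          rw [← ENNReal.ofReal_mul (Real.exp_pos _).le, ← Real.exp_add]
          ring_nf
        simp_rw [e]
        rw [lintegral_const_mul _ (by fun_prop)]
        calc _ ≤ ENNReal.ofReal (Real.exp (-(l ^ 2 / 2))) *
                ENNReal.ofReal (Real.exp (l ^ 2 / 2)) := by gcongr; exact h l
          _ = 1 := by
              rw [← ENNReal.ofReal_mul (Real.exp_pos _).le, ← Real.exp_add]
              simp
    _ = 1 := by simp

variable {n : Type*} [Fintype n] [DecidableEq n]

theorem map_dotProduct_multivariateGaussian {S : Matrix n n ℝ} (hS : S.PosSemidef) (d : n → ℝ) :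
    (multivariateGaussian (0 : EuclideanSpace ℝ n) S).map (fun x => d ⬝ᵥ x.ofLp)
      = gaussianReal 0 (d ⬝ᵥ S *ᵥ d).toNNReal := by
  have h := IsGaussian.map_eq_gaussianReal (μ := multivariateGaussian (0 : EuclideanSpace ℝ n) S)
    (innerSL ℝ (WithLp.toLp 2 d))
  have e : ⇑(innerSL ℝ (WithLp.toLp 2 d)) = fun x : EuclideanSpace ℝ n => d ⬝ᵥ x.ofLp := by
    ext x
    simp [PiLp.inner_apply, dotProduct, mul_comm]
  have hv := covarianceBilin_self (μ := multivariateGaussian (0 : EuclideanSpace ℝ n) S)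
    IsGaussian.memLp_two_id (WithLp.toLp 2 d)
  rw [covarianceBilin_multivariateGaussian hS] at hv
  have hm : (multivariateGaussian (0 : EuclideanSpace ℝ n) S)[innerSL ℝ (WithLp.toLp 2 d)] = 0 := by
    rw [(innerSL ℝ (WithLp.toLp 2 d)).integral_comp_id_comm IsGaussian.integrable_id]
    simp
  rw [hm] at h
  rw [← e, h, hv]
  rfl

/-- The probability that a standard normal variable is at least `2`. -/
noncomputable def optProb : ℝ := (gaussianReal 0 1).real (Set.Ici 2)

theorem optProb_pos : 0 < optProb := by
  rw [optProb, measureReal_def, ENNReal.toReal_pos_iff]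
  refine ⟨?_, measure_lt_top _ _⟩
  rw [pos_iff_ne_zero]
  intro h
  have := gaussianReal_absolutelyContinuous' 0 one_ne_zero h
  simp at this

theorem optProb_le_one : optProb ≤ 1 := measureReal_le_one

theorem le_gaussianReal_Ici (v : ℝ) (hv : 0 ≤ v) :
    ENNReal.ofReal optProb ≤ gaussianReal 0 v.toNNReal (Set.Ici (2 * Real.sqrt v)) := by
  have h := gaussianReal_map_const_mul (μ := 0) (v := 1) (Real.sqrt v)
  have e : (NNReal.mk (Real.sqrt v ^ 2) (sq_nonneg _) * 1 : NNReal) = v.toNNReal := by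
    rw [mul_one]
    ext
    rw [NNReal.coe_mk, Real.sq_sqrt hv, Real.coe_toNNReal _ hv]
  rw [mul_zero, e] at h
  rw [← h, Measure.map_apply (by fun_prop) measurableSet_Ici, optProb, measureReal_def,
    ENNReal.ofReal_toReal (measure_ne_top _ _)]
  refine measure_mono fun x hx => ?_
  simp only [Set.mem_preimage, Set.mem_Ici] at hx ⊢
  rw [mul_comm]
  gcongr

/-- A centered normal vector exceeds twice the standard deviation in a given direction with constant
probability. -/
theorem le_multivariateGaussian_dotProduct {S : Matrix n n ℝ} (hS : S.PosSemidef) (d : n → ℝ) :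
    ENNReal.ofReal optProb ≤ multivariateGaussian (0 : EuclideanSpace ℝ n) S
      {x | 2 * Real.sqrt (d ⬝ᵥ S *ᵥ d) ≤ d ⬝ᵥ x.ofLp} := by
  have h := le_gaussianReal_Ici (d ⬝ᵥ S *ᵥ d) (by simpa using hS.dotProduct_mulVec_nonneg d)
  rw [← map_dotProduct_multivariateGaussian hS d, Measure.map_apply _ measurableSet_Ici] at h
  · exact h
  · unfold dotProduct; fun_prop

theorem gaussianReal_abs_gt_le (t : ℝ) (ht : 0 ≤ t) :
    gaussianReal 0 1 {z | t < |z|} ≤ ENNReal.ofReal (2 * Real.exp (-(t ^ 2 / 2))) := by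
  have hI : (gaussianReal 0 1).real (Set.Ici t) ≤ Real.exp (-(t ^ 2 / 2)) := by
    have h := measure_ge_le_exp_mul_mgf (μ := gaussianReal 0 1) (X := id) t ht
      (integrable_exp_mul_gaussianReal t)
    rw [mgf_id_gaussianReal, ← Real.exp_add] at h
    refine le_trans (le_of_eq ?_) (h.trans (le_of_eq ?_))
    · rfl
    · congr 1; simp; ring
  have hJ : (gaussianReal 0 1).real (Set.Iic (-t)) ≤ Real.exp (-(t ^ 2 / 2)) := by
    have h := measure_le_le_exp_mul_mgf (μ := gaussianReal 0 1) (X := id) (-t) (t := -t) (by linarith)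
      (integrable_exp_mul_gaussianReal _)
    rw [mgf_id_gaussianReal, ← Real.exp_add] at h
    refine le_trans (le_of_eq ?_) (h.trans (le_of_eq ?_))
    · rfl
    · congr 1; simp; ring
  have hsub : {z : ℝ | t < |z|} ⊆ Set.Ici t ∪ Set.Iic (-t) := by
    intro z hz
    rcases lt_abs.1 (show t < |z| from hz) with h | h
    · exact Or.inl h.le
    · exact Or.inr (show z ≤ -t by linarith)
  rw [← ofReal_measureReal (measure_ne_top _ _)]
  refine ENNReal.ofReal_le_ofReal ?_
  calc _ ≤ _ := measureReal_mono hsub (measure_ne_top _ _)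
    _ ≤ _ := measureReal_union_le _ _
    _ ≤ _ := by linarith

omit [DecidableEq n] in
theorem stdGaussian_norm_gt_le (t : ℝ) (ht : 0 ≤ t) :
    stdGaussian (EuclideanSpace ℝ n) {z | Real.sqrt (Fintype.card n) * t < ‖z‖}
      ≤ ENNReal.ofReal (Fintype.card n * (2 * Real.exp (-(t ^ 2 / 2)))) := by
  rw [← map_pi_eq_stdGaussian, Measure.map_apply (by fun_prop)
    (measurableSet_lt measurable_const measurable_norm)]
  have hsub : (WithLp.toLp 2 ⁻¹' {z : EuclideanSpace ℝ n | Real.sqrt (Fintype.card n) * t < ‖z‖})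
      ⊆ ⋃ i : n, Function.eval i ⁻¹' {z : ℝ | t < |z|} := by
    intro z hz
    by_contra hcon
    simp only [Set.mem_iUnion, Set.mem_preimage, Function.eval, Set.mem_ofPred_eq, not_exists,
      not_lt] at hcon hz
    rw [EuclideanSpace.norm_eq, ← Real.sqrt_sq ht, ← Real.sqrt_mul (by positivity)] at hz
    refine absurd hz (not_lt.2 (Real.sqrt_le_sqrt ?_))
    calc ∑ i, ‖z i‖ ^ 2 ≤ ∑ _i : n, t ^ 2 := by
          refine Finset.sum_le_sum fun i _ => ?_
          exact pow_le_pow_left₀ (norm_nonneg _) (hcon i) 2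
      _ = _ := by simp
  refine (measure_mono hsub).trans ((measure_iUnion_fintype_le _ _).trans ?_)
  have : ∀ i : n, Measure.pi (fun _ : n => gaussianReal 0 1) (Function.eval i ⁻¹' {z : ℝ | t < |z|})
      ≤ ENNReal.ofReal (2 * Real.exp (-(t ^ 2 / 2))) := by
    intro i
    rw [(measurePreserving_eval (fun _ : n => gaussianReal 0 1) i).measure_preimage
      (measurableSet_lt measurable_const (by fun_prop)).nullMeasurableSet]
    exact gaussianReal_abs_gt_le t ht
  refine (Finset.sum_le_sum fun i _ => this i).trans (le_of_eq ?_)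
  rw [Finset.sum_const, Finset.card_univ, nsmul_eq_mul, ENNReal.ofReal_mul (by positivity)]
  simp

/-- A tail bound for a normal vector that is uniform over all directions `d i`: each deviation is at most
the norm of the underlying standard normal vector times the standard deviation. -/
theorem multivariateGaussian_exists_gt_le {S : Matrix n n ℝ} (hS : S.PosSemidef) {ι : Type*}
    (d : ι → n → ℝ) (t : ℝ) (ht : 0 ≤ t) :
    multivariateGaussian (0 : EuclideanSpace ℝ n) S
      {x | ∃ i, Real.sqrt (Fintype.card n) * t * Real.sqrt (d i ⬝ᵥ S *ᵥ d i) < |d i ⬝ᵥ x.ofLp|}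
      ≤ ENNReal.ofReal (Fintype.card n * (2 * Real.exp (-(t ^ 2 / 2)))) := by
  open scoped MatrixOrder in
  refine le_trans ?_ (stdGaussian_norm_gt_le (n := n) t ht)
  set B : Set (EuclideanSpace ℝ n) :=
    {x | ∃ i, Real.sqrt (Fintype.card n) * t * Real.sqrt (d i ⬝ᵥ S *ᵥ d i) < |d i ⬝ᵥ x.ofLp|}
    with hB
  have hBm : MeasurableSet B := by
    have : IsOpen B := by
      have : B = ⋃ i, {x | Real.sqrt (Fintype.card n) * t * Real.sqrt (d i ⬝ᵥ S *ᵥ d i)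
          < |d i ⬝ᵥ x.ofLp|} := by ext; simp [hB]
      rw [this]
      refine isOpen_iUnion fun i => isOpen_lt continuous_const ?_
      unfold dotProduct; fun_prop
    exact this.measurableSet
  rw [multivariateGaussian, Measure.map_apply (by fun_prop) hBm]
  refine measure_mono fun z hz => ?_
  obtain ⟨i, hi⟩ := hz
  set R := CFC.sqrt S with hR
  have hRS : R * R = S := CFC.sqrt_mul_sqrt_self _ hS.nonneg
  have hRT : Rᵀ = R := by
    have : R.IsHermitian := (CFC.sqrt_nonneg S).isSelfAdjoint
    simpa using this.eq
  have e1 : d i ⬝ᵥ S *ᵥ d i = (R *ᵥ d i) ⬝ᵥ (R *ᵥ d i) := by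
    rw [← hRS, ← Matrix.mulVec_mulVec, Matrix.dotProduct_mulVec, ← Matrix.mulVec_transpose, hRT]
  have e2 : d i ⬝ᵥ (0 + Matrix.toEuclideanCLM (𝕜 := ℝ) R z).ofLp = (R *ᵥ d i) ⬝ᵥ z.ofLp := by
    rw [zero_add, Matrix.ofLp_toEuclideanCLM, Matrix.dotProduct_mulVec, ← Matrix.mulVec_transpose,
      hRT]
  rw [e2, e1] at hi
  have e3 : (R *ᵥ d i) ⬝ᵥ z.ofLp = inner ℝ z (WithLp.toLp 2 (R *ᵥ d i)) := by
    simp [PiLp.inner_apply, dotProduct]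
  have e4 : Real.sqrt ((R *ᵥ d i) ⬝ᵥ (R *ᵥ d i))
      = ‖(WithLp.toLp 2 (R *ᵥ d i) : EuclideanSpace ℝ n)‖ := by
    rw [EuclideanSpace.norm_eq]; simp [dotProduct, sq]
  rw [e3, e4] at hi
  have h := abs_real_inner_le_norm z (WithLp.toLp 2 (R *ᵥ d i))
  by_contra hcon
  simp only [Set.mem_ofPred_eq, not_lt] at hcon
  have := mul_le_mul_of_nonneg_right hcon
    (norm_nonneg (WithLp.toLp 2 (R *ᵥ d i) : EuclideanSpace ℝ n))
  linarith

/-- An isotropic normal law is invariant under permutations of the coordinates. -/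
theorem multivariateGaussian_smul_one_map_perm (c : ℝ) (hc : 0 ≤ c) (e : n ≃ n) :
    (multivariateGaussian (0 : EuclideanSpace ℝ n) (c • 1)).map
      (LinearIsometryEquiv.piLpCongrLeft 2 ℝ ℝ e) = multivariateGaussian 0 (c • 1) := by
  have hS : (c • (1 : Matrix n n ℝ)).PosSemidef := Matrix.PosSemidef.one.smul hc
  apply Measure.ext_of_charFun
  ext t
  rw [charFun_apply, integral_map (by fun_prop) (by fun_prop)]
  have : ∀ x : EuclideanSpace ℝ n, inner ℝ ((LinearIsometryEquiv.piLpCongrLeft 2 ℝ ℝ e) x) t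
      = inner ℝ x ((LinearIsometryEquiv.piLpCongrLeft 2 ℝ ℝ e).symm t) := fun x => by
    rw [← LinearIsometryEquiv.inner_map_eq_flip]
  simp_rw [this]
  rw [← charFun_apply, charFun_multivariateGaussian hS, charFun_multivariateGaussian hS]
  congr 2
  · simp
  · have h1 : ∀ x : EuclideanSpace ℝ n, x.ofLp ⬝ᵥ (c • (1 : Matrix n n ℝ)) *ᵥ x.ofLp = c * ‖x‖ ^ 2 := by
      intro x
      rw [Matrix.smul_mulVec, Matrix.one_mulVec, dotProduct_smul, EuclideanSpace.real_norm_sq_eq]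
      simp [dotProduct, sq]
    rw [h1, h1, LinearIsometryEquiv.norm_map]

/-- For an isotropic normal vector, by symmetry and because ties have probability zero, each of the chosen
coordinates is the strict maximum with probability at least one over their number. -/
theorem inv_card_le_multivariateGaussian_argmax {c : ℝ} (hc : 0 < c) {α : Type*} [Fintype α]
    (f : α → n) (hf : Function.Injective f) (a₀ : α) :
    (Fintype.card α : ℝ≥0∞)⁻¹ ≤ multivariateGaussian (0 : EuclideanSpace ℝ n) (c • 1)
      {x | ∀ a, a ≠ a₀ → x (f a) < x (f a₀)} := by
  classical
  have hS : (c • (1 : Matrix n n ℝ)).PosSemidef := Matrix.PosSemidef.one.smul hc.le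
  set N := multivariateGaussian (0 : EuclideanSpace ℝ n) (c • 1) with hN
  let G : α → Set (EuclideanSpace ℝ n) := fun b => {x | ∀ a, a ≠ b → x (f a) < x (f b)}
  have hGm : ∀ b, MeasurableSet (G b) := by
    intro b
    have : G b = ⋂ a, ⋂ (_ : a ≠ b), {x | x (f a) < x (f b)} := by ext; simp [G]
    rw [this]
    exact MeasurableSet.iInter fun a => MeasurableSet.iInter fun _ =>
      measurableSet_lt (by fun_prop) (by fun_prop)
  have hsym : ∀ b, N (G b) = N (G a₀) := by
    intro b
    conv_lhs => rw [hN, ← multivariateGaussian_smul_one_map_perm c hc.le (Equiv.swap (f b) (f a₀)),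
      Measure.map_apply (by fun_prop) (hGm b)]
    congr 1
    ext x
    have e : ∀ i, (LinearIsometryEquiv.piLpCongrLeft 2 ℝ ℝ (Equiv.swap (f b) (f a₀)) x) i
        = x (Equiv.swap (f b) (f a₀) i) := by
      intro i; simp [LinearIsometryEquiv.piLpCongrLeft_apply, Equiv.piCongrLeft'_apply]
    have e2 : ∀ a, Equiv.swap (f b) (f a₀) (f a) = f (Equiv.swap b a₀ a) := by
      intro a
      exact hf.swap_apply b a₀ a
    simp only [G, Set.mem_preimage, Set.mem_ofPred_eq, e, e2, Equiv.swap_apply_left]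
    constructor
    · intro h a ha
      have := h (Equiv.swap b a₀ a) (by
        intro h'
        have := congrArg (Equiv.swap b a₀) h'
        rw [Equiv.swap_apply_self, Equiv.swap_apply_left] at this
        exact ha this)
      rwa [Equiv.swap_apply_self] at this
    · intro h a ha
      refine h _ ?_
      intro h'
      have := congrArg (Equiv.swap b a₀) h'
      rw [Equiv.swap_apply_self, Equiv.swap_apply_right] at this
      exact ha this
  -- a difference of two coordinates has a nondegenerate normal law
  have htie : ∀ a b, a ≠ b → N {x | x (f a) = x (f b)} = 0 := by
    intro a b hab
    have hne : f a ≠ f b := fun h => hab (hf h)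
    have h := map_dotProduct_multivariateGaussian hS (Pi.single (f a) 1 - Pi.single (f b) 1)
    have hv : (Pi.single (f a) 1 - Pi.single (f b) 1) ⬝ᵥ (c • (1 : Matrix n n ℝ)) *ᵥ
        (Pi.single (f a) 1 - Pi.single (f b) 1) = 2 * c := by
      rw [Matrix.smul_mulVec, Matrix.one_mulVec, dotProduct_smul]
      simp [hne, hne.symm]
      ring
    rw [hv] at h
    have hz : ((2 * c).toNNReal) ≠ 0 := by simpa using hc
    have := nullSingletonClass_gaussianReal (μ := 0) hz
    have h0 : gaussianReal 0 (2 * c).toNNReal {0} = 0 := measure_singleton 0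
    rw [← h, Measure.map_apply (by unfold dotProduct; fun_prop) (measurableSet_singleton 0)] at h0
    refine le_antisymm (le_trans (measure_mono fun x hx => ?_) h0.le) bot_le
    simp only [Set.mem_ofPred_eq] at hx
    simp [sub_dotProduct, hx]
  have hcover : (Set.univ : Set (EuclideanSpace ℝ n))
      ⊆ (⋃ b, G b) ∪ ⋃ a, ⋃ b, ⋃ (_ : a ≠ b), {x | x (f a) = x (f b)} := by
    intro x _
    have : Nonempty α := ⟨a₀⟩
    obtain ⟨b, hb⟩ := Finite.exists_max fun a => x (f a)
    by_cases h : ∃ a, a ≠ b ∧ x (f a) = x (f b)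
    · obtain ⟨a, hab, he⟩ := h
      right
      simp only [Set.mem_iUnion]
      exact ⟨a, b, hab, he⟩
    · left
      push Not at h
      simp only [Set.mem_iUnion]
      exact ⟨b, fun a ha => lt_of_le_of_ne (hb a) (h a ha)⟩
  have h1 : (1 : ℝ≥0∞) ≤ Fintype.card α * N (G a₀) := by
    calc (1 : ℝ≥0∞) = N Set.univ := by simp [hN]
      _ ≤ N (⋃ b, G b) + N (⋃ a, ⋃ b, ⋃ (_ : a ≠ b), {x | x (f a) = x (f b)}) :=
          (measure_mono hcover).trans (measure_union_le _ _)
      _ = N (⋃ b, G b) := by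
          rw [measure_iUnion_null fun a => measure_iUnion_null fun b => measure_iUnion_null fun h =>
            htie a b h, add_zero]
      _ ≤ ∑ b, N (G b) := measure_iUnion_fintype_le _ _
      _ = _ := by simp [hsym]
  rw [ENNReal.inv_le_iff_le_mul]
  · exact h1
  · simp
  · simp

end Gaussian

/-! ### Paths, occupancies and values -/

/-- The path probabilities of a finite inhomogeneous Markov chain started at `s` sum to one. -/
theorem sum_markov_prod_eq_one {S : Type*} [Fintype S] [DecidableEq S] (n : ℕ)
    (c : Fin n → S → S → ℝ) (hc : ∀ h x, ∑ y, c h x y = 1) (s : S) :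
    ∑ σ : Fin (n + 1) → S, (if σ 0 = s then 1 else 0) *
      ∏ h : Fin n, c h (σ h.castSucc) (σ h.succ) = 1 := by
  induction n with
  | zero =>
    rw [← (Equiv.funUnique (Fin 1) S).symm.sum_comp]
    simp
  | succ n ih =>
    rw [← (Fin.snocEquiv fun _ => S).sum_comp, Fintype.sum_prod_type, Finset.sum_comm]
    refine Eq.trans (Finset.sum_congr rfl fun τ _ => ?_) (ih (fun h => c h.castSucc) fun h => hc _)
    have e0 : ∀ x : S, (Fin.snocEquiv (fun _ : Fin (n + 2) => S)) (x, τ) 0 = τ 0 := by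
      intro x
      exact Fin.snoc_castSucc (α := fun _ => S) x τ 0
    have e1 : ∀ (x : S) (h : Fin (n + 1)),
        (Fin.snocEquiv (fun _ : Fin (n + 2) => S)) (x, τ) h.castSucc = τ h := by
      intro x h
      exact Fin.snoc_castSucc (α := fun _ => S) x τ h
    have e2 : ∀ x : S, (Fin.snocEquiv (fun _ : Fin (n + 2) => S)) (x, τ) (Fin.last (n + 1)) = x := by
      intro x
      exact Fin.snoc_last (α := fun _ => S) x τ
    simp only [Fin.prod_univ_castSucc, e0, e1, Fin.succ_castSucc, Fin.succ_last, e2]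
    rw [← Finset.mul_sum, ← Finset.mul_sum, hc, mul_one]

namespace MDP

variable {S A : Type*} {H : ℕ} (M : MDP S A)

/-- The state-action frequency of the path `σ` under the policy `π`. -/
def pathFreq [DecidableEq S] [DecidableEq A] (π : Policy S A H) (σ : Fin H → S) (x : S × A) : ℝ :=
  ∑ h : Fin H, if (σ h, π h (σ h)) = x then 1 else 0

section

variable [DecidableEq S] [NeZero H]

theorem pathProb_nonneg (π : Policy S A H) (s : S) (σ : Fin H → S) : 0 ≤ M.pathProb π s σ := by
  unfold pathProb
  refine mul_nonneg (by split_ifs <;> simp) (Finset.prod_nonneg fun h _ => ?_)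
  split_ifs <;> simp

theorem sum_pathProb [Fintype S] (π : Policy S A H) (s : S) : ∑ σ, M.pathProb π s σ = 1 := by
  obtain ⟨n, rfl⟩ : ∃ n, H = n + 1 := ⟨H - 1, (Nat.succ_pred_eq_of_pos (NeZero.pos H)).symm⟩
  rw [← sum_markov_prod_eq_one n
    (fun h x y => (M.trans x (π h.castSucc x) y).toReal) (fun h x => ?_) s]
  · refine Finset.sum_congr rfl fun σ _ => ?_
    unfold pathProb
    congr 1
    rw [Fin.prod_univ_castSucc]
    simp only [Fin.val_castSucc, Fin.val_last, lt_irrefl, dite_false, mul_one,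
      add_lt_add_iff_right, Fin.is_lt, dite_true]
    rfl
  · have h1 := (M.trans x (π h.castSucc x)).tsum_coe
    rw [tsum_fintype] at h1
    rw [← ENNReal.toReal_sum fun y _ => PMF.apply_ne_top _ y, h1, ENNReal.toReal_one]

end

theorem meanReward_mem (x : S × A) : M.meanReward x ∈ Set.Icc (0 : ℝ) 1 := by
  have := M.isProbabilityMeasure_rewardLaw x.1 x.2
  have h := M.reward_mem_Icc x.1 x.2
  constructor
  · exact integral_nonneg_of_ae (h.mono fun y hy => hy.1)
  · have hi : Integrable (fun y : ℝ => y) (M.rewardLaw x.1 x.2) :=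
      Integrable.of_mem_Icc 0 1 aemeasurable_id h
    calc M.meanReward x ≤ ∫ _y, (1 : ℝ) ∂(M.rewardLaw x.1 x.2) :=
          integral_mono_ae hi (integrable_const _) (h.mono fun y hy => hy.2)
      _ = 1 := by simp

variable [DecidableEq S] [DecidableEq A]

theorem pathFreq_dotProduct [Fintype S] [Fintype A] (π : Policy S A H) (σ : Fin H → S)
    (r : S × A → ℝ) : pathFreq π σ ⬝ᵥ r = ∑ h, r (σ h, π h (σ h)) := by
  simp only [dotProduct, pathFreq, Finset.sum_mul]
  rw [Finset.sum_comm]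
  simp

theorem pathFreq_sq_le [Fintype S] [Fintype A] (π : Policy S A H) (σ : Fin H → S) :
    pathFreq π σ ⬝ᵥ pathFreq π σ ≤ (H : ℝ) ^ 2 := by
  rw [pathFreq_dotProduct]
  calc ∑ h, pathFreq π σ (σ h, π h (σ h)) ≤ ∑ _h : Fin H, (H : ℝ) := by
        refine Finset.sum_le_sum fun h _ => ?_
        calc pathFreq π σ (σ h, π h (σ h)) ≤ ∑ _h : Fin H, (1 : ℝ) :=
              Finset.sum_le_sum fun h' _ => by split_ifs <;> simp
          _ = H := by simp
    _ = (H : ℝ) ^ 2 := by simp [sq]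

variable [Fintype S] [NeZero H]

theorem avgOccupancy_eq_sum_pathFreq (π : Policy S A H) (s : S) :
    M.avgOccupancy π s = ∑ σ, M.pathProb π s σ • pathFreq π σ := by
  ext x
  simp only [avgOccupancy, occupancy, Finset.sum_apply, Pi.smul_apply, smul_eq_mul, pathFreq,
    Finset.mul_sum]
  rw [Finset.sum_comm]

theorem avgOccupancy_dotProduct [Fintype A] (π : Policy S A H) (s : S) (r : S × A → ℝ) :
    M.avgOccupancy π s ⬝ᵥ r = ∑ σ, M.pathProb π s σ * (pathFreq π σ ⬝ᵥ r) := by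
  rw [avgOccupancy_eq_sum_pathFreq, sum_dotProduct]
  simp

theorem value_eq_dotProduct [Fintype A] (π : Policy S A H) (s : S) :
    M.value π s = M.avgOccupancy π s ⬝ᵥ M.meanReward := by
  rw [avgOccupancy_dotProduct, value]
  simp [pathFreq_dotProduct]

omit [DecidableEq A] in
theorem value_mem (π : Policy S A H) (s : S) : M.value π s ∈ Set.Icc (0 : ℝ) H := by
  constructor
  · refine Finset.sum_nonneg fun σ _ => mul_nonneg (M.pathProb_nonneg _ _ _)
      (Finset.sum_nonneg fun h _ => (M.meanReward_mem _).1)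
  · calc M.value π s ≤ ∑ σ, M.pathProb π s σ * H := by
          refine Finset.sum_le_sum fun σ _ => mul_le_mul_of_nonneg_left ?_ (M.pathProb_nonneg _ _ _)
          calc _ ≤ ∑ _h : Fin H, (1 : ℝ) := Finset.sum_le_sum fun h _ => (M.meanReward_mem _).2
            _ = H := by simp
      _ = H := by rw [← Finset.sum_mul, sum_pathProb, one_mul]

variable [Fintype A]

omit [DecidableEq A] in
theorem value_le_optValue (π : Policy S A H) (s : S) : M.value π s ≤ M.optValue H s :=
  le_ciSup (f := fun π : Policy S A H => M.value π s) (Set.finite_range _).bddAbove π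

omit [DecidableEq A] in
theorem exists_value_eq_optValue [Nonempty A] (s : S) :
    ∃ π : Policy S A H, M.value π s = M.optValue H s :=
  exists_eq_ciSup_of_finite

omit [DecidableEq A] in
theorem gap_mem [Nonempty A] (π : Policy S A H) (s : S) :
    M.optValue H s - M.value π s ∈ Set.Icc (0 : ℝ) H := by
  obtain ⟨π', h'⟩ := M.exists_value_eq_optValue (H := H) s
  have h1 := M.value_le_optValue π s
  have h2 := (M.value_mem π' s).2
  have h3 := (M.value_mem π s).1
  constructor <;> linarith

/-- Along a fixed path the centered score is a sum of independent variables in intervals of length one, so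
by Hoeffding's lemma it is subgaussian with variance proxy at most `H`. -/
theorem lintegral_exp_score_le (π : Policy S A H) (σ : Fin H → S) (t : ℝ) :
    ∫⁻ R : Fin H → ℝ, ENNReal.ofReal (Real.exp (t * ((∑ h, R h - pathFreq π σ ⬝ᵥ M.meanReward) /
      Real.sqrt H))) ∂(Measure.pi fun h => M.rewardLaw (σ h) (π h (σ h)))
      ≤ ENNReal.ofReal (Real.exp (t ^ 2 / 2)) := by
  have hH : (0 : ℝ) < H := by exact_mod_cast NeZero.pos H
  have hp := fun h => M.isProbabilityMeasure_rewardLaw (σ h) (π h (σ h))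
  set ρ := fun h => M.rewardLaw (σ h) (π h (σ h)) with hρ
  have hp' : ∀ h, IsProbabilityMeasure (ρ h) := hp
  set u := t / Real.sqrt H with hu
  set f : Fin H → ℝ → ℝ := fun h y => Real.exp (u * (y - M.meanReward (σ h, π h (σ h)))) with hf
  have hsub : ∀ h, HasSubgaussianMGF (fun y => y - M.meanReward (σ h, π h (σ h)))
      ((‖(1 : ℝ) - 0‖₊ / 2) ^ 2) (ρ h) := fun h =>
    hasSubgaussianMGF_of_mem_Icc (X := fun y => y) aemeasurable_id (M.reward_mem_Icc _ _)
  have hint : ∀ h, Integrable (f h) (ρ h) := fun h => (hsub h).integrable_exp_mul u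
  have hle : ∀ h, ∫ y, f h y ∂(ρ h) ≤ Real.exp (u ^ 2 / 8) := by
    intro h
    refine ((hsub h).mgf_le u).trans (le_of_eq ?_)
    congr 1
    simp
    ring
  have e : ∀ R : Fin H → ℝ, Real.exp (t * ((∑ h, R h - pathFreq π σ ⬝ᵥ M.meanReward) /
      Real.sqrt H)) = ∏ h, f h (R h) := by
    intro R
    rw [hf, ← Real.exp_sum, ← Finset.mul_sum, Finset.sum_sub_distrib, pathFreq_dotProduct, hu]
    ring_nf
  simp_rw [e]
  rw [← ofReal_integral_eq_lintegral_ofReal (Integrable.fintype_prod hint)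
    (Filter.Eventually.of_forall fun R => Finset.prod_nonneg fun h _ => (Real.exp_pos _).le),
    integral_fintype_prod_eq_prod]
  refine ENNReal.ofReal_le_ofReal ?_
  calc ∏ h, ∫ y, f h y ∂(ρ h) ≤ ∏ _h : Fin H, Real.exp (u ^ 2 / 8) :=
        Finset.prod_le_prod (fun h _ => integral_nonneg fun y => (Real.exp_pos _).le) fun h _ => hle h
    _ = Real.exp (t ^ 2 / 8) := by
        rw [Finset.prod_const, Finset.card_univ, Fintype.card_fin, ← Real.exp_nat_mul, hu, div_pow,
          Real.sq_sqrt hH.le]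
        congr 1
        field_simp
    _ ≤ _ := Real.exp_le_exp.2 (by nlinarith [sq_nonneg t])

/-- Jensen's inequality for the seminorm of a positive semidefinite form, averaged over paths. -/
theorem sqrt_quadForm_avgOccupancy_le {B : Matrix (S × A) (S × A) ℝ} (hB : B.PosSemidef)
    (π : Policy S A H) (s : S) :
    Real.sqrt (M.avgOccupancy π s ⬝ᵥ B *ᵥ M.avgOccupancy π s)
      ≤ ∑ σ, M.pathProb π s σ * Real.sqrt (pathFreq π σ ⬝ᵥ B *ᵥ pathFreq π σ) := by
  set d := M.avgOccupancy π s with hd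
  set q := Real.sqrt (d ⬝ᵥ B *ᵥ d) with hq
  have hnn : 0 ≤ ∑ σ, M.pathProb π s σ * Real.sqrt (pathFreq π σ ⬝ᵥ B *ᵥ pathFreq π σ) :=
    Finset.sum_nonneg fun σ _ => mul_nonneg (M.pathProb_nonneg _ _ _) (Real.sqrt_nonneg _)
  rcases (Real.sqrt_nonneg (d ⬝ᵥ B *ᵥ d)).eq_or_lt with h0 | hpos
  · rw [hq, ← h0]; exact hnn
  have h1 : q * q = d ⬝ᵥ B *ᵥ d :=
    Real.mul_self_sqrt (by simpa using hB.dotProduct_mulVec_nonneg d)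
  have h2 : d ⬝ᵥ B *ᵥ d
      ≤ (∑ σ, M.pathProb π s σ * Real.sqrt (pathFreq π σ ⬝ᵥ B *ᵥ pathFreq π σ)) * q := by
    conv_lhs => rw [hd, avgOccupancy_dotProduct]
    rw [Finset.sum_mul]
    refine Finset.sum_le_sum fun σ _ => ?_
    rw [mul_assoc]
    exact mul_le_mul_of_nonneg_left ((le_abs_self _).trans (abs_dotProduct_mulVec_le hB _ _))
      (M.pathProb_nonneg _ _ _)
  rw [← h1] at h2
  exact le_of_mul_le_mul_right h2 hpos

end MDP

/-! ### Measurability and conditional laws of a run -/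

section Measurability

/-- A choice among countably many measurable functions through a measurable index is measurable. The
index set carries no sigma-algebra, as is the case for states and policies. -/
theorem measurable_of_finite_index {Ω ι β : Type*} {m : MeasurableSpace Ω} [MeasurableSpace β]
    [Countable ι] {i : Ω → ι} (hi : ∀ j, MeasurableSet {ω | i ω = j}) {f : ι → Ω → β}
    (hf : ∀ j, Measurable (f j)) : Measurable fun ω => f (i ω) ω := by
  intro B hB
  have : (fun ω => f (i ω) ω) ⁻¹' B = ⋃ j, {ω | i ω = j} ∩ (f j ⁻¹' B) := by
    ext ω; simp
  rw [this]
  exact MeasurableSet.iUnion fun j => (hi j).inter (hf j hB)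

variable {n : Type*} [Fintype n]

theorem measurable_bilin {α : Type*} {m : MeasurableSpace α} {d e : α → n → ℝ}
    {B : α → Matrix n n ℝ} (hd : Measurable d) (he : Measurable e)
    (hB : ∀ i j, Measurable fun a => B a i j) : Measurable fun a => d a ⬝ᵥ B a *ᵥ e a := by
  unfold Matrix.mulVec dotProduct
  refine Finset.measurable_sum _ fun i _ => (hd.eval).mul
    (Finset.measurable_sum _ fun j _ => (hB i j).mul he.eval)

theorem measurable_dotProduct {α : Type*} {m : MeasurableSpace α} {d e : α → n → ℝ}
    (hd : Measurable d) (he : Measurable e) : Measurable fun a => d a ⬝ᵥ e a := by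
  unfold dotProduct
  exact Finset.measurable_sum _ fun i _ => hd.eval.mul he.eval

variable [DecidableEq n]

theorem measurable_det {α : Type*} {m : MeasurableSpace α}
    {B : α → Matrix n n ℝ} (hB : ∀ i j, Measurable fun a => B a i j) :
    Measurable fun a => (B a).det := by
  simp only [Matrix.det_apply]
  exact Finset.measurable_sum _ fun σ _ =>
    (Finset.measurable_prod _ fun i _ => hB _ _).const_smul _

theorem measurable_inv_apply {α : Type*} {m : MeasurableSpace α}
    {B : α → Matrix n n ℝ} (hB : ∀ i j, Measurable fun a => B a i j) (i j : n) :
    Measurable fun a => (B a)⁻¹ i j := by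
  simp only [Matrix.inv_def, Ring.inverse_eq_inv', Matrix.smul_apply, smul_eq_mul,
    Matrix.adjugate_apply]
  refine (measurable_det hB).inv.mul (measurable_det fun i' j' => ?_)
  simp only [Matrix.updateRow_apply]
  split_ifs
  · exact measurable_const
  · exact hB _ _

end Measurability

section

variable {S A : Type*} {H : ℕ} {Ω : Type*} [Fintype S] [Fintype A]
    [DecidableEq S] [DecidableEq A]

namespace Run

variable (X : Run S A H Ω)

omit [Fintype S] [Fintype A] in
theorem freq_eq_pathFreq (k : ℕ) (ω : Ω) :
    X.freq k ω = MDP.pathFreq (X.policy k ω) fun h => X.state k h ω := rfl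

theorem freq_sq_le (k : ℕ) (ω : Ω) : X.freq k ω ⬝ᵥ X.freq k ω ≤ (H : ℝ) ^ 2 := by
  rw [freq_eq_pathFreq]
  exact MDP.pathFreq_sq_le _ _

omit [Fintype S] [Fintype A] in
theorem gram_zero (ω : Ω) : X.gram 0 ω = (H : ℝ) • 1 := by simp [gram]

omit [Fintype S] [Fintype A] in
theorem gram_succ (k : ℕ) (ω : Ω) :
    X.gram (k + 1) ω = X.gram k ω + Matrix.vecMulVec (X.freq (k + 1) ω) (X.freq (k + 1) ω) := by
  simp only [gram]
  rw [Finset.sum_Icc_succ_top (by omega), add_assoc]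

theorem gram_posDef [NeZero H] (k : ℕ) (ω : Ω) : (X.gram k ω).PosDef := by
  induction k with
  | zero =>
    rw [gram_zero]
    exact Matrix.PosDef.one.smul (by exact_mod_cast NeZero.pos H)
  | succ k ih => rw [gram_succ]; exact posDef_add_vecMulVec ih _

theorem le_gram_quadForm (k : ℕ) (ω : Ω) (y : S × A → ℝ) :
    H * (y ⬝ᵥ y) ≤ y ⬝ᵥ X.gram k ω *ᵥ y := by
  induction k with
  | zero => rw [gram_zero, Matrix.smul_mulVec, Matrix.one_mulVec, dotProduct_smul, smul_eq_mul]
  | succ k ih =>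
    rw [gram_succ, Matrix.add_mulVec, dotProduct_add, Matrix.vecMulVec_mulVec]
    refine ih.trans (le_add_of_nonneg_right ?_)
    have : y ⬝ᵥ MulOpposite.op (X.freq (k + 1) ω ⬝ᵥ y) • X.freq (k + 1) ω
        = (X.freq (k + 1) ω ⬝ᵥ y) ^ 2 := by
      rw [op_smul_eq_smul, dotProduct_smul, smul_eq_mul, dotProduct_comm y, sq]
    rw [this]; positivity

theorem gram_quadForm_le (k : ℕ) (ω : Ω) (y : S × A → ℝ) :
    y ⬝ᵥ X.gram k ω *ᵥ y ≤ (H + k * (H : ℝ) ^ 2) * (y ⬝ᵥ y) := by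
  induction k with
  | zero =>
    rw [gram_zero, Matrix.smul_mulVec, Matrix.one_mulVec, dotProduct_smul, smul_eq_mul]
    simp
  | succ k ih =>
    rw [gram_succ, Matrix.add_mulVec, dotProduct_add, Matrix.vecMulVec_mulVec]
    have : y ⬝ᵥ MulOpposite.op (X.freq (k + 1) ω ⬝ᵥ y) • X.freq (k + 1) ω
        = (X.freq (k + 1) ω ⬝ᵥ y) ^ 2 := by
      rw [op_smul_eq_smul, dotProduct_smul, smul_eq_mul, dotProduct_comm y, sq]
    have hcs : (X.freq (k + 1) ω ⬝ᵥ y) ^ 2 ≤ (H : ℝ) ^ 2 * (y ⬝ᵥ y) := by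
      have h1 := Finset.sum_mul_sq_le_sq_mul_sq Finset.univ (X.freq (k + 1) ω) y
      have h2 := X.freq_sq_le (k + 1) ω
      have h3 : 0 ≤ y ⬝ᵥ y := by simpa using dotProduct_star_self_nonneg y
      simp only [dotProduct, ← sq] at h1 h2 h3 ⊢
      exact h1.trans (mul_le_mul_of_nonneg_right h2 h3)
    rw [this]
    push_cast
    linarith

theorem inv_gram_quadForm_nonneg [NeZero H] (k : ℕ) (ω : Ω) (y : S × A → ℝ) :
    0 ≤ y ⬝ᵥ (X.gram k ω)⁻¹ *ᵥ y := by
  simpa using (X.gram_posDef k ω).inv.posSemidef.dotProduct_mulVec_nonneg y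

theorem inv_gram_quadForm_le [NeZero H] (k : ℕ) (ω : Ω) (y : S × A → ℝ) :
    y ⬝ᵥ (X.gram k ω)⁻¹ *ᵥ y ≤ (y ⬝ᵥ y) / H :=
  dotProduct_inv_mulVec_le (X.gram_posDef k ω) (by exact_mod_cast NeZero.pos H)
    (X.le_gram_quadForm k ω) y

/-- The norm `‖d‖ = √(dᵀ A_k⁻¹ d)`. -/
noncomputable def ellNorm (k : ℕ) (ω : Ω) (d : S × A → ℝ) : ℝ :=
  Real.sqrt (d ⬝ᵥ (X.gram k ω)⁻¹ *ᵥ d)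

end Run

variable [NeZero H] {mΩ : MeasurableSpace Ω} {M : MDP S A} {δ : ℝ} {μ : Measure Ω}
  {𝓕 : Filtration ℕ mΩ} {X : Run S A H Ω}

namespace IsThompsonRun

variable (hX : IsThompsonRun M δ μ 𝓕 X)

/-- The information available in episode `k + 1` once the noise has been drawn. -/
abbrev noiseSigma (𝓕 : Filtration ℕ mΩ) (X : Run S A H Ω) (k : ℕ) : MeasurableSpace Ω :=
  𝓕 k ⊔ MeasurableSpace.comap (X.noise (k + 1)) inferInstance

omit [DecidableEq S] [DecidableEq A] [NeZero H] [Fintype S] [Fintype A] in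
theorem le_noiseSigma (k : ℕ) : 𝓕 k ≤ noiseSigma 𝓕 X k := le_sup_left

include hX

theorem noiseSigma_le (k : ℕ) : noiseSigma 𝓕 X k ≤ 𝓕 (k + 1) :=
  sup_le (𝓕.mono (Nat.le_succ k)) (hX.measurable_noise k).comap_le

theorem measurableSet_policy (k : ℕ) (π : Policy S A H) :
    MeasurableSet[𝓕 (k + 1)] {ω | X.policy (k + 1) ω = π} :=
  hX.noiseSigma_le k _ (hX.measurable_policy k π)

theorem measurableSet_path (k : ℕ) (σ : Fin H → S) :
    MeasurableSet[𝓕 (k + 1)] {ω | (fun h => X.state (k + 1) h ω) = σ} := by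
  have : {ω | (fun h => X.state (k + 1) h ω) = σ} = ⋂ h, {ω | X.state (k + 1) h ω = σ h} := by
    ext ω; simp [funext_iff]
  rw [this]
  exact MeasurableSet.iInter fun h => hX.measurable_state k h _

theorem measurable_freq (k : ℕ) : Measurable[𝓕 (k + 1)] (X.freq (k + 1)) := by
  refine @measurable_of_finite_index Ω (Policy S A H × (Fin H → S)) (S × A → ℝ) (𝓕 (k + 1)) _ _
    (fun ω => (X.policy (k + 1) ω, fun h => X.state (k + 1) h ω)) (fun j => ?_)
    (fun j _ => MDP.pathFreq j.1 j.2) (fun j => measurable_const)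
  have : {ω | (X.policy (k + 1) ω, fun h => X.state (k + 1) h ω) = j}
      = {ω | X.policy (k + 1) ω = j.1} ∩ {ω | (fun h => X.state (k + 1) h ω) = j.2} := by
    ext ω; simp [Prod.ext_iff]
  rw [this]
  exact MeasurableSet.inter (hX.measurableSet_policy k _) (hX.measurableSet_path k _)

theorem measurable_score (k : ℕ) : Measurable[𝓕 (k + 1)] (X.score (k + 1)) := by
  unfold Run.score
  exact Finset.measurable_sum _ fun h _ => hX.measurable_reward k h

theorem measurable_freq' {k l : ℕ} (hl : l ∈ Finset.Icc 1 k) : Measurable[𝓕 k] (X.freq l) := by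
  obtain ⟨h1, h2⟩ := Finset.mem_Icc.1 hl
  obtain ⟨j, rfl⟩ : ∃ j, l = j + 1 := ⟨l - 1, by omega⟩
  exact (hX.measurable_freq j).mono (𝓕.mono h2) le_rfl

theorem measurable_score' {k l : ℕ} (hl : l ∈ Finset.Icc 1 k) : Measurable[𝓕 k] (X.score l) := by
  obtain ⟨h1, h2⟩ := Finset.mem_Icc.1 hl
  obtain ⟨j, rfl⟩ : ∃ j, l = j + 1 := ⟨l - 1, by omega⟩
  exact (hX.measurable_score j).mono (𝓕.mono h2) le_rfl

theorem measurable_gram_apply (k : ℕ) (i j : S × A) : Measurable[𝓕 k] fun ω => X.gram k ω i j := by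
  simp only [Run.gram, Matrix.add_apply, Matrix.sum_apply, Matrix.vecMulVec_apply]
  refine Measurable.add measurable_const (Finset.measurable_sum _ fun l hl => ?_)
  exact ((measurable_pi_apply _).comp (hX.measurable_freq' hl)).mul
    ((measurable_pi_apply _).comp (hX.measurable_freq' hl))

theorem measurable_inv_gram_apply (k : ℕ) (i j : S × A) :
    Measurable[𝓕 k] fun ω => (X.gram k ω)⁻¹ i j :=
  measurable_inv_apply (hX.measurable_gram_apply k) i j

theorem measurable_lsEstimator (k : ℕ) : Measurable[𝓕 k] (X.lsEstimator k) := by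
  refine (@measurable_pi_iff _ _ _ (𝓕 k) _ _).2 fun i => ?_
  simp only [Run.lsEstimator, Matrix.mulVec, dotProduct, Run.response, Finset.sum_apply,
    Pi.smul_apply, smul_eq_mul]
  refine Finset.measurable_sum _ fun j _ => (hX.measurable_inv_gram_apply k i j).mul
    (Finset.measurable_sum _ fun l hl => ?_)
  exact (hX.measurable_score' hl).mul ((measurable_pi_apply _).comp (hX.measurable_freq' hl))

theorem measurable_ellNorm (k : ℕ) {m : MeasurableSpace Ω} (hm : 𝓕 k ≤ m) {d : Ω → S × A → ℝ}
    (hd : Measurable[m] d) :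
    Measurable[m] fun ω => X.ellNorm k ω (d ω) :=
  (measurable_bilin hd hd fun i j => (hX.measurable_inv_gram_apply k i j).mono hm le_rfl).sqrt

theorem measurable_init_index {β : Type*} [MeasurableSpace β] (k : ℕ) (f : S → β) :
    Measurable[𝓕 k] fun ω => f (X.state (k + 1) 0 ω) :=
  @measurable_of_finite_index Ω S β (𝓕 k) _ _ (X.state (k + 1) 0) (hX.measurable_init k)
    (fun s _ => f s) fun _ => measurable_const

theorem measurable_avgOccupancy (k : ℕ) : Measurable[noiseSigma 𝓕 X k] fun ω =>
    M.avgOccupancy (X.policy (k + 1) ω) (X.state (k + 1) 0 ω) := by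
  refine @measurable_of_finite_index Ω (Policy S A H) (S × A → ℝ) (noiseSigma 𝓕 X k) _ _
    (X.policy (k + 1)) (hX.measurable_policy k)
    (fun π ω => M.avgOccupancy π (X.state (k + 1) 0 ω)) (fun π => ?_)
  exact (hX.measurable_init_index k fun s => M.avgOccupancy π s).mono (le_noiseSigma k) le_rfl

variable [IsProbabilityMeasure μ]

/-- The conditional normal law of the noise of episode `k + 1`, as an inequality between integrals. -/
theorem lintegral_noise_le {T : Type*} [MeasurableSpace T] (k : ℕ)
    {Φ : Ω → T} (hΦ : Measurable[𝓕 k] Φ) {F : T × EuclideanSpace ℝ (S × A) → ℝ≥0∞}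
    (hF : Measurable F) {g : Ω → ℝ≥0∞}
    (hg : ∀ ω, ∫⁻ y, F (Φ ω, y) ∂(multivariateGaussian (0 : EuclideanSpace ℝ (S × A))
        ((noiseScale S A H δ (k + 1)) ^ 2 • (X.gram k ω)⁻¹)) ≤ g ω)
    {w : Ω → ℝ≥0∞} (hw : Measurable[𝓕 k] w) :
    ∫⁻ ω, w ω * F (Φ ω, X.noise (k + 1) ω) ∂μ ≤ ∫⁻ ω, w ω * g ω ∂μ :=
  lintegral_le_of_condLaw (𝓕.le k) ((hX.measurable_noise k).mono (𝓕.le _) le_rfl)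
    (hX.noise_law k) hΦ hF (Filter.Eventually.of_forall hg) hw

/-- The conditional law of the frequency and the score of episode `k + 1`, once the noise and hence the
policy are known, as an inequality between integrals. -/
theorem lintegral_episode_le {T : Type*} [MeasurableSpace T] (k : ℕ)
    {Φ : Ω → T} (hΦ : Measurable[noiseSigma 𝓕 X k] Φ) {F : T × ((S × A → ℝ) × ℝ) → ℝ≥0∞}
    (hF : Measurable F) {g : Ω → ℝ≥0∞}
    (hg : ∀ ω, ∑ σ, ENNReal.ofReal (M.pathProb (X.policy (k + 1) ω) (X.state (k + 1) 0 ω) σ) *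
      ∫⁻ R, F (Φ ω, (MDP.pathFreq (X.policy (k + 1) ω) σ, ∑ h, R h))
        ∂(Measure.pi fun h => M.rewardLaw (σ h) (X.policy (k + 1) ω h (σ h))) ≤ g ω)
    {w : Ω → ℝ≥0∞} (hw : Measurable[noiseSigma 𝓕 X k] w) :
    ∫⁻ ω, w ω * F (Φ ω, (X.freq (k + 1) ω, X.score (k + 1) ω)) ∂μ ≤ ∫⁻ ω, w ω * g ω ∂μ := by
  have hm : noiseSigma 𝓕 X k ≤ mΩ := (hX.noiseSigma_le k).trans (𝓕.le _)
  have hrl := M.isProbabilityMeasure_rewardLaw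
  let _ : MeasurableSpace S := ⊤
  let _ : MeasurableSpace A := ⊤
  have : Nonempty Ω := nonempty_of_isProbabilityMeasure μ
  have : Nonempty S := this.map fun ω => X.state 0 0 ω
  let Y : Ω → (Fin H → S) × (Fin H → ℝ) :=
    fun ω => (fun h => X.state (k + 1) h ω, fun h => X.reward (k + 1) h ω)
  have hYst : Measurable fun ω => (fun h => X.state (k + 1) h ω : Fin H → S) :=
    measurable_of_finite_index (f := fun σ _ => σ)
      (fun σ => 𝓕.le _ _ (hX.measurableSet_path k σ)) fun σ => measurable_const
  have hYre : Measurable fun ω => (fun h => X.reward (k + 1) h ω : Fin H → ℝ) :=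
    measurable_pi_iff.2 fun h => (hX.measurable_reward k h).mono (𝓕.le _) le_rfl
  have hY : Measurable Y := hYst.prodMk hYre
  let ρ : Ω → (Fin H → S) → Measure (Fin H → ℝ) := fun ω σ =>
    Measure.pi fun h => M.rewardLaw (σ h) (X.policy (k + 1) ω h (σ h))
  let p : Ω → (Fin H → S) → ℝ := fun ω σ =>
    M.pathProb (X.policy (k + 1) ω) (X.state (k + 1) 0 ω) σ
  have hp : ∀ ω σ, 0 ≤ p ω σ := fun ω σ => M.pathProb_nonneg _ _ _
  let ν : Ω → Measure ((Fin H → S) × (Fin H → ℝ)) := fun ω =>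
    ∑ σ, ENNReal.ofReal (p ω σ) • (ρ ω σ).map (Prod.mk σ)
  have hνapp : ∀ ω B, MeasurableSet B →
      ν ω B = ∑ σ, ENNReal.ofReal (p ω σ) * ρ ω σ (Prod.mk σ ⁻¹' B) := by
    intro ω B hB
    simp only [ν, Measure.coe_finsetSum, Finset.sum_apply, Measure.smul_apply, smul_eq_mul]
    refine Finset.sum_congr rfl fun σ _ => ?_
    rw [Measure.map_apply measurable_prodMk_left hB]
  have hνp : ∀ ω, IsProbabilityMeasure (ν ω) := fun ω => ⟨by
    rw [hνapp ω _ MeasurableSet.univ]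
    simp only [Set.preimage_univ, measure_univ, mul_one]
    rw [← ENNReal.ofReal_sum_of_nonneg fun σ _ => hp ω σ, M.sum_pathProb, ENNReal.ofReal_one]⟩
  have hlaw : ∀ B, MeasurableSet B →
      μ⟦Y ⁻¹' B | noiseSigma 𝓕 X k⟧ =ᵐ[μ] fun ω => (ν ω).real B := by
    intro B hB
    let Z : (Fin H → S) → Set Ω := fun σ =>
      {ω | (∀ h, X.state (k + 1) h ω = σ h) ∧ (fun h => X.reward (k + 1) h ω) ∈ Prod.mk σ ⁻¹' B}
    have hZm : ∀ σ, MeasurableSet (Z σ) := by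
      intro σ
      have : Z σ = {ω | (fun h => X.state (k + 1) h ω) = σ} ∩
          (fun ω => (fun h => X.reward (k + 1) h ω : Fin H → ℝ)) ⁻¹' (Prod.mk σ ⁻¹' B) := by
        ext ω; simp [Z, funext_iff]
      rw [this]
      exact (𝓕.le _ _ (hX.measurableSet_path k σ)).inter (hYre (measurable_prodMk_left hB))
    have hind : (Y ⁻¹' B).indicator (fun _ => (1 : ℝ)) = ∑ σ, (Z σ).indicator fun _ => (1 : ℝ) := by
      ext ω
      rw [Finset.sum_apply, Finset.sum_eq_single (fun h => X.state (k + 1) h ω)]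
      · by_cases h : Y ω ∈ B
        · rw [Set.indicator_of_mem (show ω ∈ Y ⁻¹' B from h),
            Set.indicator_of_mem (show ω ∈ Z _ from ⟨fun _ => rfl, h⟩)]
        · rw [Set.indicator_of_notMem (show ω ∉ Y ⁻¹' B from h),
            Set.indicator_of_notMem (show ω ∉ Z _ from fun h' => h h'.2)]
      · intro σ _ hσ
        refine Set.indicator_of_notMem (fun h => hσ ?_) _
        exact (funext h.1).symm
      · simp
    rw [hind]
    have h1 := condExp_finsetSum (μ := μ) (s := Finset.univ)
      (f := fun σ => (Z σ).indicator fun _ => (1 : ℝ))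
      (fun σ _ => (integrable_const (1 : ℝ)).indicator (hZm σ)) (noiseSigma 𝓕 X k)
    have h2 : ∀ᵐ ω ∂μ, ∀ σ, (μ⟦Z σ | noiseSigma 𝓕 X k⟧) ω =
        p ω σ * (ρ ω σ).real (Prod.mk σ ⁻¹' B) :=
      ae_all_iff.2 fun σ => hX.episode_law k σ _ (measurable_prodMk_left hB)
    filter_upwards [h1, h2] with ω h1 h2
    rw [h1, Finset.sum_apply, measureReal_def, hνapp ω B hB, ENNReal.toReal_sum]
    · refine Finset.sum_congr rfl fun σ _ => ?_
      rw [h2 σ, ENNReal.toReal_mul, ENNReal.toReal_ofReal (hp ω σ), measureReal_def]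
    · exact fun σ _ => ENNReal.mul_ne_top ENNReal.ofReal_ne_top (measure_ne_top _ _)
  let F' : (T × Policy S A H) × ((Fin H → S) × (Fin H → ℝ)) → ℝ≥0∞ := fun q =>
    F (q.1.1, (MDP.pathFreq q.1.2 q.2.1, ∑ h, q.2.2 h))
  have hF' : Measurable F' := by
    refine measurable_of_finite_index
      (i := fun q : (T × Policy S A H) × ((Fin H → S) × (Fin H → ℝ)) => (q.1.2, q.2.1)) (fun j => ?_)
      (f := fun (j : Policy S A H × (Fin H → S))
        (q : (T × Policy S A H) × ((Fin H → S) × (Fin H → ℝ))) =>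
        F (q.1.1, (MDP.pathFreq j.1 j.2, ∑ h, q.2.2 h))) (fun j => ?_)
    · have : Measurable fun q : (T × Policy S A H) × ((Fin H → S) × (Fin H → ℝ)) =>
          (q.1.2, q.2.1) := by fun_prop
      exact this (measurableSet_singleton j)
    · exact hF.comp (by fun_prop)
  have hΦ' : Measurable[noiseSigma 𝓕 X k] fun ω => (Φ ω, X.policy (k + 1) ω) :=
    hΦ.prodMk (measurable_of_finite_index (f := fun π _ => π) (hX.measurable_policy k)
      fun π => measurable_const)
  refine lintegral_le_of_condLaw hm hY hlaw hΦ' hF' (Filter.Eventually.of_forall fun ω => ?_) hw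
  refine le_trans (le_of_eq ?_) (hg ω)
  have hFs : Measurable fun y => F' ((Φ ω, X.policy (k + 1) ω), y) :=
    hF'.comp measurable_prodMk_left
  simp only [ν]
  rw [lintegral_finsetSum_measure]
  refine Finset.sum_congr rfl fun σ _ => ?_
  rw [lintegral_smul_measure, lintegral_map hFs measurable_prodMk_left]
  rfl

end IsThompsonRun

end

/-! ### The self-normalized bound and the elliptical potential -/

theorem exp_neg_le_one_sub_half {b : ℝ} (h0 : 0 ≤ b) (h1 : b ≤ 1) : Real.exp (-b) ≤ 1 - b / 2 := by
  rw [Real.exp_neg]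
  have h2 : 1 + b ≤ Real.exp b := by linarith [Real.add_one_le_exp b]
  calc (Real.exp b)⁻¹ ≤ (1 + b)⁻¹ := inv_anti₀ (by linarith) h2
    _ ≤ 1 - b / 2 := by
        rw [inv_le_iff_one_le_mul₀ (by linarith)]
        nlinarith

/-- Logarithmic form of Ville's inequality. -/
theorem ville_exp {Ω : Type*} {mΩ : MeasurableSpace Ω} {μ : Measure Ω} [IsProbabilityMeasure μ]
    (𝓕 : Filtration ℕ mΩ) (x : ℕ → Ω → ℝ) (hx : ∀ k, Measurable[𝓕 (k + 1)] (x k))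
    (hint : ∀ k (w : Ω → ℝ≥0∞), Measurable[𝓕 k] w →
      ∫⁻ ω, w ω * ENNReal.ofReal (Real.exp (x k ω)) ∂μ ≤ ∫⁻ ω, w ω ∂μ) {ε : ℝ} (hε : 0 < ε) :
    μ {ω | ∃ K, Real.log (1 / ε) < ∑ k ∈ Finset.range K, x k ω} ≤ ENNReal.ofReal ε := by
  have h := ville (μ := μ) 𝓕 (fun k ω => ENNReal.ofReal (Real.exp (x k ω)))
    (fun k => ENNReal.measurable_ofReal.comp (Real.measurable_exp.comp (hx k)))
    hint (ENNReal.ofReal (1 / ε))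
  have e : {ω | ∃ K, ENNReal.ofReal (1 / ε) < ∏ k ∈ Finset.range K, ENNReal.ofReal (Real.exp (x k ω))}
      = {ω | ∃ K, Real.log (1 / ε) < ∑ k ∈ Finset.range K, x k ω} := by
    ext ω
    simp only [Set.mem_ofPred_eq]
    refine exists_congr fun K => ?_
    rw [← ENNReal.ofReal_prod_of_nonneg fun k _ => (Real.exp_pos _).le, ← Real.exp_sum,
      ENNReal.ofReal_lt_ofReal_iff (Real.exp_pos _), Real.log_lt_iff_lt_exp (by positivity)]
  rw [e] at h
  have hc : ENNReal.ofReal ε * ENNReal.ofReal (1 / ε) = 1 := by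
    rw [← ENNReal.ofReal_mul hε.le, mul_one_div_cancel hε.ne', ENNReal.ofReal_one]
  calc _ = ENNReal.ofReal ε * (ENNReal.ofReal (1 / ε) *
        μ {ω | ∃ K, Real.log (1 / ε) < ∑ k ∈ Finset.range K, x k ω}) := by
          rw [← mul_assoc, hc, one_mul]
    _ ≤ ENNReal.ofReal ε * 1 := by gcongr
    _ = _ := mul_one _

section

variable {S A : Type*} {H : ℕ} {Ω : Type*} [Fintype S] [Fintype A]
    [DecidableEq S] [DecidableEq A]

namespace Run

variable (X : Run S A H Ω)

/-- The normalized reward noise `(V̂_k - d̂_kᵀ r) / √H` of an episode. -/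
noncomputable def rewardNoise (M : MDP S A) (k : ℕ) (ω : Ω) : ℝ :=
  (X.score k ω - X.freq k ω ⬝ᵥ M.meanReward) / Real.sqrt H

/-- The sum `∑_{l ≤ k} η_l d̂_l` of the normalized reward noises weighted by the frequencies. -/
noncomputable def noiseSum (M : MDP S A) (k : ℕ) (ω : Ω) : S × A → ℝ :=
  ∑ l ∈ Finset.Icc 1 k, X.rewardNoise M l ω • X.freq l ω

/-- The elliptical potential `∑_{k < K} log (1 + d̂_{k+1}ᵀ A_k⁻¹ d̂_{k+1})`. -/
noncomputable def potential (K : ℕ) (ω : Ω) : ℝ :=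
  ∑ k ∈ Finset.range K,
    Real.log (1 + X.freq (k + 1) ω ⬝ᵥ (X.gram k ω)⁻¹ *ᵥ X.freq (k + 1) ω)

theorem ellNorm_nonneg (k : ℕ) (ω : Ω) (d : S × A → ℝ) : 0 ≤ X.ellNorm k ω d := Real.sqrt_nonneg _

variable [NeZero H]

theorem ellNorm_sq (k : ℕ) (ω : Ω) (d : S × A → ℝ) :
    X.ellNorm k ω d ^ 2 = d ⬝ᵥ (X.gram k ω)⁻¹ *ᵥ d :=
  Real.sq_sqrt (X.inv_gram_quadForm_nonneg k ω d)

/-- The elliptical potential is the logarithm of the ratio of the determinants of `A_K` and `A_0`. -/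
theorem potential_eq (K : ℕ) (ω : Ω) :
    X.potential K ω = Real.log (X.gram K ω).det -
      Fintype.card (S × A) * Real.log H := by
  have hH : (0 : ℝ) < H := by exact_mod_cast NeZero.pos H
  induction K with
  | zero =>
    rw [gram_zero, Matrix.det_smul, Matrix.det_one, mul_one, Real.log_pow]
    simp [potential]
  | succ K ih =>
    have hpos : (0 : ℝ) < 1 + X.freq (K + 1) ω ⬝ᵥ (X.gram K ω)⁻¹ *ᵥ X.freq (K + 1) ω := by
      linarith [X.inv_gram_quadForm_nonneg K ω (X.freq (K + 1) ω)]
    rw [gram_succ, det_add_vecMulVec (X.gram_posDef K ω),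
      Real.log_mul (X.gram_posDef K ω).det_pos.ne' hpos.ne']
    rw [potential, Finset.sum_range_succ]
    change X.potential K ω + _ = _
    rw [ih]
    ring

theorem potential_le (K : ℕ) (ω : Ω) :
    X.potential K ω ≤ Fintype.card (S × A) * Real.log (1 + K * H) := by
  have hH : (0 : ℝ) < H := by exact_mod_cast NeZero.pos H
  rw [potential_eq]
  have h1 : (X.gram K ω).det ≤ (H + K * (H : ℝ) ^ 2) ^ Fintype.card (S × A) :=
    det_le_pow (X.gram_posDef K ω) (X.gram_quadForm_le K ω)
  have h2 := Real.log_le_log (X.gram_posDef K ω).det_pos h1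
  have h3 : (H + K * (H : ℝ) ^ 2) = H * (1 + K * H) := by ring
  rw [Real.log_pow, h3, Real.log_mul hH.ne' (by positivity)] at h2
  linarith

theorem freq_quadForm_le (k : ℕ) (ω : Ω) :
    X.freq (k + 1) ω ⬝ᵥ (X.gram k ω)⁻¹ *ᵥ X.freq (k + 1) ω ≤ H := by
  have hH : (0 : ℝ) < H := by exact_mod_cast NeZero.pos H
  refine (X.inv_gram_quadForm_le k ω _).trans ?_
  rw [div_le_iff₀ hH, ← sq]
  exact X.freq_sq_le _ _

/-- The elliptical potential lemma. The logarithm of `H` does not enter, because the terms are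
at most `H` and `u ≤ H / log (1 + H) * log (1 + u)` for `u ≤ H`. -/
theorem sum_ellNorm_sq_le {K : ℕ} (hK : 2 ≤ K) (ω : Ω) :
    ∑ k ∈ Finset.range K, X.ellNorm k ω (X.freq (k + 1) ω) ^ 2
      ≤ 4 * H * Fintype.card (S × A) * Real.log K := by
  have hH : (0 : ℝ) < H := by exact_mod_cast NeZero.pos H
  have hH1 : (1 : ℝ) ≤ H := by exact_mod_cast NeZero.pos H
  have hlog : 0 < Real.log (1 + H) := Real.log_pos (by linarith)
  calc ∑ k ∈ Finset.range K, X.ellNorm k ω (X.freq (k + 1) ω) ^ 2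
      ≤ ∑ k ∈ Finset.range K, H / Real.log (1 + H) *
          Real.log (1 + X.freq (k + 1) ω ⬝ᵥ (X.gram k ω)⁻¹ *ᵥ X.freq (k + 1) ω) := by
        refine Finset.sum_le_sum fun k _ => ?_
        rw [ellNorm_sq]
        exact le_mul_log_one_add hH (X.inv_gram_quadForm_nonneg _ _ _) (X.freq_quadForm_le k ω)
    _ = H / Real.log (1 + H) * X.potential K ω := by rw [← Finset.mul_sum]; rfl
    _ ≤ H / Real.log (1 + H) * (Fintype.card (S × A) * Real.log (1 + K * H)) := by
        gcongr; exact X.potential_le K ω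
    _ ≤ H / Real.log (1 + H) * (Fintype.card (S × A) * (4 * Real.log K * Real.log (1 + H))) := by
        gcongr
        exact log_one_add_mul_le (by exact_mod_cast hK) hH1
    _ = _ := by field_simp

omit [NeZero H] in
theorem noiseSum_succ (M : MDP S A) (k : ℕ) (ω : Ω) : X.noiseSum M (k + 1) ω =
    X.noiseSum M k ω + X.rewardNoise M (k + 1) ω • X.freq (k + 1) ω := by
  simp only [noiseSum]
  rw [Finset.sum_Icc_succ_top (by omega)]

/-- The logarithm of the likelihood ratio of episode `k + 1` for the normal mixture. -/
noncomputable def mixtureTerm (M : MDP S A) (k : ℕ) (ω : Ω) : ℝ :=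
  (2 * X.rewardNoise M (k + 1) ω * (X.freq (k + 1) ω ⬝ᵥ (X.gram k ω)⁻¹ *ᵥ X.noiseSum M k ω)
    + X.rewardNoise M (k + 1) ω ^ 2 * (X.freq (k + 1) ω ⬝ᵥ (X.gram k ω)⁻¹ *ᵥ X.freq (k + 1) ω)
    - (X.freq (k + 1) ω ⬝ᵥ (X.gram k ω)⁻¹ *ᵥ X.noiseSum M k ω) ^ 2) /
    (2 * (1 + X.freq (k + 1) ω ⬝ᵥ (X.gram k ω)⁻¹ *ᵥ X.freq (k + 1) ω))
  - Real.log (1 + X.freq (k + 1) ω ⬝ᵥ (X.gram k ω)⁻¹ *ᵥ X.freq (k + 1) ω) / 2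

/-- The Sherman–Morrison formula makes the logarithms of the likelihood ratios telescope. -/
theorem sum_mixtureTerm (M : MDP S A) (K : ℕ) (ω : Ω) :
    ∑ k ∈ Finset.range K, X.mixtureTerm M k ω =
      (X.ellNorm K ω (X.noiseSum M K ω) ^ 2 - X.potential K ω) / 2 := by
  simp only [ellNorm_sq]
  induction K with
  | zero => simp [potential, noiseSum]
  | succ K ih =>
    have hpot : X.potential (K + 1) ω = X.potential K ω +
        Real.log (1 + X.freq (K + 1) ω ⬝ᵥ (X.gram K ω)⁻¹ *ᵥ X.freq (K + 1) ω) :=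
      Finset.sum_range_succ _ _
    rw [Finset.sum_range_succ, ih, hpot, gram_succ, inv_add_vecMulVec_quadForm (X.gram_posDef K ω),
      noiseSum_succ, mixtureTerm]
    have hpos : (0 : ℝ) < 1 + X.freq (K + 1) ω ⬝ᵥ (X.gram K ω)⁻¹ *ᵥ X.freq (K + 1) ω := by
      linarith [X.inv_gram_quadForm_nonneg K ω (X.freq (K + 1) ω)]
    have hsymm := dotProduct_mulVec_comm (X.gram_posDef K ω).inv.isHermitian
      (X.noiseSum M K ω) (X.freq (K + 1) ω)
    simp only [Matrix.mulVec_add, Matrix.mulVec_smul, dotProduct_add, add_dotProduct,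
      dotProduct_smul, smul_dotProduct, smul_eq_mul, hsymm]
    generalize X.freq (K + 1) ω ⬝ᵥ (X.gram K ω)⁻¹ *ᵥ X.freq (K + 1) ω = u at *
    generalize X.freq (K + 1) ω ⬝ᵥ (X.gram K ω)⁻¹ *ᵥ X.noiseSum M K ω = m at *
    field_simp
    ring

end Run

namespace IsThompsonRun

variable [NeZero H] {mΩ : MeasurableSpace Ω} {M : MDP S A} {δ : ℝ} {μ : Measure Ω}
  {𝓕 : Filtration ℕ mΩ} {X : Run S A H Ω} (hX : IsThompsonRun M δ μ 𝓕 X)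

include hX

theorem measurable_rewardNoise (k : ℕ) : Measurable[𝓕 (k + 1)] (X.rewardNoise M (k + 1)) := by
  unfold Run.rewardNoise
  exact ((hX.measurable_score k).sub
    (measurable_dotProduct (hX.measurable_freq k) measurable_const)).div_const _

theorem measurable_noiseSum (k : ℕ) : Measurable[𝓕 k] (X.noiseSum M k) := by
  refine (@measurable_pi_iff _ _ _ (𝓕 k) _ _).2 fun i => ?_
  simp only [Run.noiseSum, Finset.sum_apply, Pi.smul_apply, smul_eq_mul]
  refine Finset.measurable_sum _ fun l hl => ?_
  refine Measurable.mul ?_ ((measurable_pi_apply _).comp (hX.measurable_freq' hl))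
  obtain ⟨h1, h2⟩ := Finset.mem_Icc.1 hl
  obtain ⟨j, rfl⟩ : ∃ j, l = j + 1 := ⟨l - 1, by omega⟩
  exact (hX.measurable_rewardNoise j).mono (𝓕.mono h2) le_rfl

variable [IsProbabilityMeasure μ]

/-- The self-normalized bound for the reward noise, for all `K` at once. -/
theorem measure_noiseSum_gt_le {ε : ℝ} (hε : 0 < ε) :
    μ {ω | ∃ K, Real.log (1 / ε) <
      (X.ellNorm K ω (X.noiseSum M K ω) ^ 2 - X.potential K ω) / 2} ≤ ENNReal.ofReal ε := by
  simp only [← Run.sum_mixtureTerm]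
  refine ville_exp 𝓕 _ (fun k => ?_) (fun k w hw => ?_) hε
  · have hB := fun i j => (hX.measurable_inv_gram_apply k i j).mono (𝓕.mono (Nat.le_succ k)) le_rfl
    have hf := hX.measurable_freq k
    have hS := (hX.measurable_noiseSum k).mono (𝓕.mono (Nat.le_succ k)) le_rfl
    have hη := hX.measurable_rewardNoise k
    have hu := measurable_bilin hf hf hB
    have hm := measurable_bilin hf hS hB
    unfold Run.mixtureTerm
    exact ((((hη.const_mul 2).mul hm).add ((hη.pow_const 2).mul hu)).sub (hm.pow_const 2)).div
      ((hu.const_add 1).const_mul 2) |>.sub ((Real.measurable_log.comp (hu.const_add 1)).div_const 2)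
  · let F : ((S × A → S × A → ℝ) × (S × A → ℝ)) × ((S × A → ℝ) × ℝ) → ℝ≥0∞ := fun q =>
      ENNReal.ofReal (Real.exp
        ((2 * ((q.2.2 - q.2.1 ⬝ᵥ M.meanReward) / Real.sqrt H) *
            (q.2.1 ⬝ᵥ Matrix.of q.1.1 *ᵥ q.1.2)
          + ((q.2.2 - q.2.1 ⬝ᵥ M.meanReward) / Real.sqrt H) ^ 2 *
            (q.2.1 ⬝ᵥ Matrix.of q.1.1 *ᵥ q.2.1)
          - (q.2.1 ⬝ᵥ Matrix.of q.1.1 *ᵥ q.1.2) ^ 2) /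
          (2 * (1 + q.2.1 ⬝ᵥ Matrix.of q.1.1 *ᵥ q.2.1))) /
        Real.sqrt (1 + q.2.1 ⬝ᵥ Matrix.of q.1.1 *ᵥ q.2.1))
    have hF : Measurable F := by
      have hB : ∀ i j, Measurable fun q : ((S × A → S × A → ℝ) × (S × A → ℝ)) × ((S × A → ℝ) × ℝ) =>
          Matrix.of q.1.1 i j := by
        intro i j; simp only [Matrix.of_apply]; fun_prop
      have hu := measurable_bilin
        (d := fun q : ((S × A → S × A → ℝ) × (S × A → ℝ)) × ((S × A → ℝ) × ℝ) => q.2.1)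
        (e := fun q => q.2.1) (by fun_prop) (by fun_prop) hB
      have hm := measurable_bilin
        (d := fun q : ((S × A → S × A → ℝ) × (S × A → ℝ)) × ((S × A → ℝ) × ℝ) => q.2.1)
        (e := fun q => q.1.2) (by fun_prop) (by fun_prop) hB
      have hr := measurable_dotProduct
        (d := fun q : ((S × A → S × A → ℝ) × (S × A → ℝ)) × ((S × A → ℝ) × ℝ) => q.2.1)
        (e := fun q => M.meanReward) (by fun_prop) (by fun_prop)
      fun_prop
    have hΦ : Measurable[𝓕 k] fun ω => ((fun i j => (X.gram k ω)⁻¹ i j, X.noiseSum M k ω) :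
        (S × A → S × A → ℝ) × (S × A → ℝ)) := by
      refine Measurable.prodMk ?_ (hX.measurable_noiseSum k)
      refine (@measurable_pi_iff _ _ _ (𝓕 k) _ _).2 fun i => ?_
      exact (@measurable_pi_iff _ _ _ (𝓕 k) _ _).2 fun j => hX.measurable_inv_gram_apply k i j
    have h := hX.lintegral_episode_le k (hΦ.mono (le_noiseSigma k) le_rfl) hF (g := fun _ => 1)
      (fun ω => ?_) (hw.mono (le_noiseSigma k) le_rfl)
    · simp only [mul_one] at h
      refine le_trans (le_of_eq (lintegral_congr fun ω => ?_)) h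
      congr 1
      have hpos : (0 : ℝ) < 1 + X.freq (k + 1) ω ⬝ᵥ (X.gram k ω)⁻¹ *ᵥ X.freq (k + 1) ω := by
        linarith [X.inv_gram_quadForm_nonneg k ω (X.freq (k + 1) ω)]
      simp only [F, Run.mixtureTerm, Run.rewardNoise]
      rw [Real.exp_sub, ← Real.log_sqrt hpos.le, Real.exp_log (Real.sqrt_pos.2 hpos)]
      rfl
    · calc _ ≤ ∑ σ, ENNReal.ofReal (M.pathProb (X.policy (k + 1) ω) (X.state (k + 1) 0 ω) σ) * 1 := by
            refine Finset.sum_le_sum fun σ _ => mul_le_mul' le_rfl ?_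
            have hrl := M.isProbabilityMeasure_rewardLaw
            have key := lintegral_exp_quadratic_le_one
              (ρ := Measure.pi fun h => M.rewardLaw (σ h) (X.policy (k + 1) ω h (σ h)))
              (f := fun R : Fin H → ℝ => (∑ h, R h - MDP.pathFreq (X.policy (k + 1) ω) σ ⬝ᵥ M.meanReward) /
                Real.sqrt H) (by fun_prop)
              (fun t => M.lintegral_exp_score_le (X.policy (k + 1) ω) σ t)
              (MDP.pathFreq (X.policy (k + 1) ω) σ ⬝ᵥ (X.gram k ω)⁻¹ *ᵥ X.noiseSum M k ω)
              (X.inv_gram_quadForm_nonneg k ω (MDP.pathFreq (X.policy (k + 1) ω) σ))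
            exact key
        _ = 1 := by
            simp only [mul_one]
            rw [← ENNReal.ofReal_sum_of_nonneg fun σ _ => M.pathProb_nonneg _ _ _, M.sum_pathProb,
              ENNReal.ofReal_one]

/-- The norms of the occupancies, which are conditional means, are controlled by those of the empirical
frequencies. Comparing with half the mean turns the deviation into a multiplicative one, whose price is
a logarithm and not a square root of `K`. The normalization by `√H` puts the norms into `[0, 1]`. -/
theorem measure_sum_ellNorm_gt_le {ε : ℝ} (hε : 0 < ε) :
    μ {ω | ∃ K, Real.log (1 / ε) < ∑ k ∈ Finset.range K,
      (X.ellNorm k ω (M.avgOccupancy (X.policy (k + 1) ω) (X.state (k + 1) 0 ω)) / Real.sqrt H / 2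
        - X.ellNorm k ω (X.freq (k + 1) ω) / Real.sqrt H)} ≤ ENNReal.ofReal ε := by
  have hH : (0 : ℝ) < H := by exact_mod_cast NeZero.pos H
  have hma : ∀ k, Measurable[noiseSigma 𝓕 X k] fun ω =>
      X.ellNorm k ω (M.avgOccupancy (X.policy (k + 1) ω) (X.state (k + 1) 0 ω)) / Real.sqrt H := fun k =>
    (hX.measurable_ellNorm k (le_noiseSigma k) (hX.measurable_avgOccupancy k)).div_const _
  refine ville_exp 𝓕 _ (fun k => ?_) (fun k w hw => ?_) hε
  · exact (((hma k).mono (hX.noiseSigma_le k) le_rfl).div_const 2).sub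
      ((hX.measurable_ellNorm k (𝓕.mono (Nat.le_succ k)) (hX.measurable_freq k)).div_const _)
  · let F : (ℝ × (S × A → S × A → ℝ)) × ((S × A → ℝ) × ℝ) → ℝ≥0∞ := fun q =>
      ENNReal.ofReal (Real.exp (q.1.1 / 2 -
        Real.sqrt (q.2.1 ⬝ᵥ Matrix.of q.1.2 *ᵥ q.2.1) / Real.sqrt H))
    have hF : Measurable F := by
      have hB : ∀ i j, Measurable fun q : (ℝ × (S × A → S × A → ℝ)) × ((S × A → ℝ) × ℝ) =>
          Matrix.of q.1.2 i j := by
        intro i j; simp only [Matrix.of_apply]; fun_prop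
      have hu := measurable_bilin (d := fun q : (ℝ × (S × A → S × A → ℝ)) × ((S × A → ℝ) × ℝ) =>
        q.2.1) (e := fun q => q.2.1) (by fun_prop) (by fun_prop) hB
      fun_prop
    have hΦ : Measurable[noiseSigma 𝓕 X k] fun ω =>
        ((X.ellNorm k ω (M.avgOccupancy (X.policy (k + 1) ω) (X.state (k + 1) 0 ω)) / Real.sqrt H,
          fun i j => (X.gram k ω)⁻¹ i j) : ℝ × (S × A → S × A → ℝ)) := by
      refine Measurable.prodMk (hma k) ?_
      refine (@measurable_pi_iff _ _ _ (noiseSigma 𝓕 X k) _ _).2 fun i => ?_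
      exact (@measurable_pi_iff _ _ _ (noiseSigma 𝓕 X k) _ _).2 fun j =>
        (hX.measurable_inv_gram_apply k i j).mono (le_noiseSigma k) le_rfl
    have h := hX.lintegral_episode_le k hΦ hF (g := fun _ => 1)
      (fun ω => ?_) (hw.mono (le_noiseSigma k) le_rfl)
    · simp only [mul_one] at h
      exact h
    · have hrl := M.isProbabilityMeasure_rewardLaw
      set π := X.policy (k + 1) ω with hπ
      set s := X.state (k + 1) 0 ω with hs
      set a := X.ellNorm k ω (M.avgOccupancy π s) / Real.sqrt H with ha
      set b : (Fin H → S) → ℝ := fun σ => X.ellNorm k ω (MDP.pathFreq π σ) / Real.sqrt H with hb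
      have hJ : a ≤ ∑ σ, M.pathProb π s σ * b σ := by
        have := M.sqrt_quadForm_avgOccupancy_le (X.gram_posDef k ω).inv.posSemidef π s
        simp only [ha, hb, ← mul_div_assoc]
        rw [← Finset.sum_div]
        exact div_le_div_of_nonneg_right this (Real.sqrt_nonneg _)
      have hb1 : ∀ σ, b σ ≤ 1 := by
        intro σ
        refine div_le_one_of_le₀ (Real.sqrt_le_sqrt ?_) (Real.sqrt_nonneg _)
        refine (X.inv_gram_quadForm_le k ω _).trans ?_
        rw [div_le_iff₀ hH, ← sq]
        exact MDP.pathFreq_sq_le _ _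
      have hb0 : ∀ σ, 0 ≤ b σ := fun σ => div_nonneg (Real.sqrt_nonneg _) (Real.sqrt_nonneg _)
      calc _ = ∑ σ, ENNReal.ofReal (M.pathProb π s σ * Real.exp (a / 2 - b σ)) := by
            refine Finset.sum_congr rfl fun σ _ => ?_
            rw [ENNReal.ofReal_mul (M.pathProb_nonneg _ _ _)]
            congr 1
            simp only [F]
            rw [lintegral_const, measure_univ, mul_one]
            rfl
        _ = ENNReal.ofReal (∑ σ, M.pathProb π s σ * Real.exp (a / 2 - b σ)) := by
            rw [← ENNReal.ofReal_sum_of_nonneg fun σ _ =>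
              mul_nonneg (M.pathProb_nonneg _ _ _) (Real.exp_pos _).le]
        _ ≤ 1 := by
            rw [ENNReal.ofReal_le_one]
            calc ∑ σ, M.pathProb π s σ * Real.exp (a / 2 - b σ)
                ≤ ∑ σ, M.pathProb π s σ * (Real.exp (a / 2) * (1 - b σ / 2)) := by
                  refine Finset.sum_le_sum fun σ _ =>
                    mul_le_mul_of_nonneg_left ?_ (M.pathProb_nonneg _ _ _)
                  rw [sub_eq_add_neg, Real.exp_add]
                  exact mul_le_mul_of_nonneg_left (exp_neg_le_one_sub_half (hb0 σ) (hb1 σ))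
                    (Real.exp_pos _).le
              _ = Real.exp (a / 2) * (∑ σ, M.pathProb π s σ - (∑ σ, M.pathProb π s σ * b σ) / 2) := by
                  rw [Finset.sum_div, ← Finset.sum_sub_distrib, Finset.mul_sum]
                  exact Finset.sum_congr rfl fun σ _ => by ring
              _ ≤ Real.exp (a / 2) * (1 - a / 2) := by
                  rw [M.sum_pathProb]
                  gcongr
              _ ≤ Real.exp (a / 2) * Real.exp (-(a / 2)) := by
                  gcongr
                  linarith [Real.add_one_le_exp (-(a / 2))]
              _ = 1 := by rw [← Real.exp_add]; simp

end IsThompsonRun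

end

/-! ### Width and optimism of the noise -/

/-- The factor of `√n` in the uniform bound for the noise of episode `k + 1`. -/
noncomputable def tailLevel (n : ℕ) (ε : ℝ) (k : ℕ) : ℝ :=
  Real.sqrt (2 * Real.log (2 * n * ((k + 1) * (k + 2)) / ε))

section

variable {S A : Type*} {H : ℕ} {Ω : Type*} [Fintype S] [Fintype A]
    [DecidableEq S] [DecidableEq A]

omit [DecidableEq S] [DecidableEq A] in
theorem noiseScale_nonneg (δ : ℝ) (k : ℕ) : 0 ≤ noiseScale S A H δ k := Real.sqrt_nonneg _

namespace Run

variable (X : Run S A H Ω) [NeZero H]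

theorem posSemidef_noiseCov (δ : ℝ) (k : ℕ) (ω : Ω) :
    ((noiseScale S A H δ (k + 1)) ^ 2 • (X.gram k ω)⁻¹).PosSemidef :=
  (X.gram_posDef k ω).inv.posSemidef.smul (sq_nonneg _)

omit [NeZero H] in
theorem sqrt_noiseCov_quadForm (δ : ℝ) (k : ℕ) (ω : Ω) (d : S × A → ℝ) :
    Real.sqrt (d ⬝ᵥ ((noiseScale S A H δ (k + 1)) ^ 2 • (X.gram k ω)⁻¹) *ᵥ d)
      = noiseScale S A H δ (k + 1) * X.ellNorm k ω d := by
  rw [Matrix.smul_mulVec, dotProduct_smul, smul_eq_mul, Real.sqrt_mul (sq_nonneg _),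
    Real.sqrt_sq (noiseScale_nonneg δ _), ellNorm]

end Run

namespace IsThompsonRun

variable [NeZero H] {mΩ : MeasurableSpace Ω} {M : MDP S A} {δ : ℝ} {μ : Measure Ω}
  {𝓕 : Filtration ℕ mΩ} {X : Run S A H Ω} (hX : IsThompsonRun M δ μ 𝓕 X)

include hX

variable [IsProbabilityMeasure μ]

/-- Optimism with constant probability: whatever direction `dstar` is evaluated, the noise exceeds twice
its scale there with conditional probability at least `optProb`. For predictable weights `Y` in `[0, 1]`
the weights of the optimistic episodes therefore add up to a fixed fraction of the total, up to an
additive logarithm that does not depend on the number of episodes. -/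
theorem measure_optimism_le {ε : ℝ} (hε : 0 < ε) (dstar : S → S × A → ℝ) (Y : ℕ → Ω → ℝ)
    (hY : ∀ k, Measurable[𝓕 k] (Y k)) (hY01 : ∀ k ω, Y k ω ∈ Set.Icc (0 : ℝ) 1) :
    μ {ω | ∃ K, Real.log (1 / ε) < ∑ k ∈ Finset.range K,
      (optProb / 2 * Y k ω - if 2 * (noiseScale S A H δ (k + 1) *
          X.ellNorm k ω (dstar (X.state (k + 1) 0 ω)))
        ≤ dstar (X.state (k + 1) 0 ω) ⬝ᵥ (X.noise (k + 1) ω).ofLp then Y k ω else 0)}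
      ≤ ENNReal.ofReal ε := by
  have hd : ∀ k, Measurable[𝓕 k] fun ω => dstar (X.state (k + 1) 0 ω) := fun k =>
    hX.measurable_init_index k dstar
  have hthr : ∀ k, Measurable[𝓕 k] fun ω => 2 * (noiseScale S A H δ (k + 1) *
      X.ellNorm k ω (dstar (X.state (k + 1) 0 ω))) := fun k =>
    ((hX.measurable_ellNorm k le_rfl (hd k)).const_mul _).const_mul _
  let F : (ℝ × (S × A → ℝ) × ℝ) × EuclideanSpace ℝ (S × A) → ℝ := fun q =>
      optProb / 2 * q.1.1 - if q.1.2.2 ≤ q.1.2.1 ⬝ᵥ q.2.ofLp then q.1.1 else 0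
  have hF : Measurable F := by
    have hr := measurable_dotProduct (d := fun q : (ℝ × (S × A → ℝ) × ℝ) × EuclideanSpace ℝ (S × A) =>
        q.1.2.1) (e := fun q => q.2.ofLp) (by fun_prop) (by fun_prop)
    exact Measurable.sub (by fun_prop)
      (Measurable.ite (measurableSet_le (by fun_prop) hr) (by fun_prop) (by fun_prop))
  have hΦ : ∀ k, Measurable[𝓕 k] fun ω => ((Y k ω, dstar (X.state (k + 1) 0 ω),
      2 * (noiseScale S A H δ (k + 1) * X.ellNorm k ω (dstar (X.state (k + 1) 0 ω)))) :
        ℝ × (S × A → ℝ) × ℝ) := fun k => (hY k).prodMk ((hd k).prodMk (hthr k))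
  refine ville_exp 𝓕 _ (fun k => ?_) (fun k w hw => ?_) hε
  · exact hF.comp (((hΦ k).mono (𝓕.mono (Nat.le_succ k)) le_rfl).prodMk (hX.measurable_noise k))
  · have h := hX.lintegral_noise_le k (hΦ k) (F := fun q => ENNReal.ofReal (Real.exp (F q)))
      (by fun_prop) (g := fun _ => 1) (fun ω => ?_) hw
    · simp only [mul_one] at h
      exact h
    · set N := multivariateGaussian (0 : EuclideanSpace ℝ (S × A))
        ((noiseScale S A H δ (k + 1)) ^ 2 • (X.gram k ω)⁻¹) with hN
      set d := dstar (X.state (k + 1) 0 ω) with hd'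
      set y := Y k ω with hy
      obtain ⟨hy0, hy1⟩ := hY01 k ω
      have hopt := le_multivariateGaussian_dotProduct (X.posSemidef_noiseCov δ k ω) d
      rw [X.sqrt_noiseCov_quadForm, ← hN] at hopt
      set O : Set (EuclideanSpace ℝ (S × A)) :=
        {x | 2 * (noiseScale S A H δ (k + 1) * X.ellNorm k ω d) ≤ d ⬝ᵥ x.ofLp} with hO
      have hOm : MeasurableSet O := measurableSet_le measurable_const
        (measurable_dotProduct measurable_const (by fun_prop))
      have hP : optProb ≤ N.real O := by
        rw [measureReal_def]
        exact (ENNReal.ofReal_le_iff_le_toReal (measure_ne_top _ _)).1 hopt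
      have hP1 : N.real O ≤ 1 := measureReal_le_one
      have e : ∀ x, Real.exp (F ((y, d, 2 * (noiseScale S A H δ (k + 1) * X.ellNorm k ω d)), x))
          = Real.exp (optProb / 2 * y) - O.indicator
            (fun _ => Real.exp (optProb / 2 * y) * (1 - Real.exp (-y))) x := by
        intro x
        by_cases hx : x ∈ O
        · rw [Set.indicator_of_mem hx]
          have : F ((y, d, 2 * (noiseScale S A H δ (k + 1) * X.ellNorm k ω d)), x)
              = optProb / 2 * y - y := by
            have hx' : 2 * (noiseScale S A H δ (k + 1) * X.ellNorm k ω d) ≤ d ⬝ᵥ x.ofLp := hx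
            simp only [F]; rw [if_pos hx']
          rw [this, sub_eq_add_neg, Real.exp_add]
          ring
        · rw [Set.indicator_of_notMem hx]
          have : F ((y, d, 2 * (noiseScale S A H δ (k + 1) * X.ellNorm k ω d)), x)
              = optProb / 2 * y := by
            have hx' : ¬ 2 * (noiseScale S A H δ (k + 1) * X.ellNorm k ω d) ≤ d ⬝ᵥ x.ofLp := hx
            simp only [F]; rw [if_neg hx', sub_zero]
          rw [this, sub_zero]
      have hi : Integrable (O.indicator
          (fun _ => Real.exp (optProb / 2 * y) * (1 - Real.exp (-y)))) N :=
        (integrable_const _).indicator hOm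
      have hint : ∫ x, Real.exp (F ((y, d, 2 * (noiseScale S A H δ (k + 1) * X.ellNorm k ω d)), x)) ∂N
          = Real.exp (optProb / 2 * y) * (1 - N.real O * (1 - Real.exp (-y))) := by
        simp_rw [e]
        rw [integral_sub (integrable_const _) hi, integral_indicator_const _ hOm]
        simp
        ring
      change ∫⁻ x, ENNReal.ofReal (Real.exp (F ((y, d, 2 * (noiseScale S A H δ (k + 1) *
        X.ellNorm k ω d)), x))) ∂N ≤ 1
      rw [← ofReal_integral_eq_lintegral_ofReal _
        (Filter.Eventually.of_forall fun x => (Real.exp_pos _).le), hint, ENNReal.ofReal_le_one]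
      · have h1 := exp_neg_le_one_sub_half hy0 hy1
        have h2 : 1 - N.real O * (1 - Real.exp (-y)) ≤ 1 - optProb / 2 * y := by
          have h3 : optProb * (y / 2) ≤ N.real O * (1 - Real.exp (-y)) :=
            mul_le_mul hP (by linarith) (by positivity) (by linarith [optProb_pos])
          linarith
        have h4 : 1 - optProb / 2 * y ≤ Real.exp (-(optProb / 2 * y)) := by
          linarith [Real.add_one_le_exp (-(optProb / 2 * y))]
        calc _ ≤ Real.exp (optProb / 2 * y) * Real.exp (-(optProb / 2 * y)) := by
              gcongr; exact h2.trans h4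
          _ = 1 := by rw [← Real.exp_add]; simp
      · simp_rw [e]
        exact (integrable_const _).sub hi

/-- The noise of one episode in the directions of all occupancies simultaneously. -/
theorem measure_noise_gt_le {t : ℝ} (ht : 0 ≤ t) (k : ℕ) :
    μ {ω | ∃ p : Policy S A H × S, Real.sqrt (Fintype.card (S × A)) * t *
      (noiseScale S A H δ (k + 1) * X.ellNorm k ω (M.avgOccupancy p.1 p.2))
        < |M.avgOccupancy p.1 p.2 ⬝ᵥ (X.noise (k + 1) ω).ofLp|}
      ≤ ENNReal.ofReal (Fintype.card (S × A) * (2 * Real.exp (-(t ^ 2 / 2)))) := by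
  let Z : Set ((Policy S A H × S → ℝ) × EuclideanSpace ℝ (S × A)) :=
    {q | ∃ p : Policy S A H × S, Real.sqrt (Fintype.card (S × A)) * t * q.1 p
        < |M.avgOccupancy p.1 p.2 ⬝ᵥ q.2.ofLp|}
  have hZ : MeasurableSet Z := by
    have : Z = ⋃ p : Policy S A H × S, {q : (Policy S A H × S → ℝ) × EuclideanSpace ℝ (S × A) |
        Real.sqrt (Fintype.card (S × A)) * t * q.1 p
        < |M.avgOccupancy p.1 p.2 ⬝ᵥ q.2.ofLp|} := by ext; simp [Z]
    rw [this]
    refine MeasurableSet.iUnion fun p => measurableSet_lt (by fun_prop) ?_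
    exact (measurable_dotProduct (d := fun q : (Policy S A H × S → ℝ) × EuclideanSpace ℝ (S × A) =>
      M.avgOccupancy p.1 p.2) (e := fun q => q.2.ofLp) (by fun_prop) (by fun_prop)).abs
  have hΦ : Measurable[𝓕 k] fun ω => (fun p => noiseScale S A H δ (k + 1) *
      X.ellNorm k ω (M.avgOccupancy p.1 p.2) : Policy S A H × S → ℝ) :=
    (@measurable_pi_iff _ _ _ (𝓕 k) _ _).2 fun p =>
      (hX.measurable_ellNorm k le_rfl measurable_const).const_mul _
  have h := hX.lintegral_noise_le k hΦ (F := Z.indicator 1) (measurable_one.indicator hZ)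
    (g := fun _ => ENNReal.ofReal (Fintype.card (S × A) * (2 * Real.exp (-(t ^ 2 / 2)))))
    (fun ω => ?_) (w := fun _ => 1) measurable_const
  · simp only [one_mul, lintegral_const, measure_univ, mul_one] at h
    refine le_trans (le_of_eq ?_) h
    rw [← lintegral_indicator_one]
    · rfl
    · exact ((hΦ.mono (𝓕.le k) le_rfl).prodMk
        ((hX.measurable_noise k).mono (𝓕.le _) le_rfl)) hZ
  · have hg := multivariateGaussian_exists_gt_le (X.posSemidef_noiseCov δ k ω)
      (fun p : Policy S A H × S => M.avgOccupancy p.1 p.2) t ht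
    simp only [X.sqrt_noiseCov_quadForm] at hg
    refine le_trans (le_of_eq ?_) hg
    rw [← lintegral_indicator_one]
    · rfl
    · exact (measurable_prodMk_left (x := (fun p => noiseScale S A H δ (k + 1) *
        X.ellNorm k ω (M.avgOccupancy p.1 p.2) : Policy S A H × S → ℝ))) hZ

theorem measure_exists_noise_gt_le {ε : ℝ} (hε : 0 < ε) (hε1 : ε ≤ 1) [Nonempty (S × A)] :
    μ {ω | ∃ k, ∃ p : Policy S A H × S,
      Real.sqrt (Fintype.card (S × A)) * tailLevel (Fintype.card (S × A)) ε k *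
      (noiseScale S A H δ (k + 1) * X.ellNorm k ω (M.avgOccupancy p.1 p.2))
        < |M.avgOccupancy p.1 p.2 ⬝ᵥ (X.noise (k + 1) ω).ofLp|} ≤ ENNReal.ofReal ε := by
  have hn : (1 : ℝ) ≤ Fintype.card (S × A) := by exact_mod_cast Fintype.card_pos
  set n : ℝ := (Fintype.card (S × A) : ℝ) with hn'
  have hset : {ω | ∃ k, ∃ p : Policy S A H × S,
      Real.sqrt n * tailLevel (Fintype.card (S × A)) ε k *
      (noiseScale S A H δ (k + 1) * X.ellNorm k ω (M.avgOccupancy p.1 p.2))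
        < |M.avgOccupancy p.1 p.2 ⬝ᵥ (X.noise (k + 1) ω).ofLp|}
      = ⋃ k, {ω | ∃ p : Policy S A H × S,
      Real.sqrt n * tailLevel (Fintype.card (S × A)) ε k *
      (noiseScale S A H δ (k + 1) * X.ellNorm k ω (M.avgOccupancy p.1 p.2))
        < |M.avgOccupancy p.1 p.2 ⬝ᵥ (X.noise (k + 1) ω).ofLp|} := by ext; simp
  rw [hset]
  -- the levels are chosen so that the failure probabilities form a telescoping series of sum `ε`
  have hk : ∀ k : ℕ, (n * (2 * Real.exp (-(tailLevel (Fintype.card (S × A)) ε k ^ 2 / 2))))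
      = ε * (1 / ((k : ℝ) + 1) - 1 / ((k : ℝ) + 1 + 1)) := by
    intro k
    have harg : 1 ≤ 2 * n * (((k : ℝ) + 1) * (k + 2)) / ε := by
      rw [le_div_iff₀ hε]
      have hk0 : (0 : ℝ) ≤ k := Nat.cast_nonneg k
      have : (1 : ℝ) ≤ ((k : ℝ) + 1) * (k + 2) := by nlinarith
      nlinarith
    rw [tailLevel, Real.sq_sqrt (by have := Real.log_nonneg harg; positivity)]
    rw [← hn', mul_div_cancel_left₀ _ (by norm_num : (2 : ℝ) ≠ 0), Real.exp_neg,
      Real.exp_log (by linarith)]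
    have : (0 : ℝ) < n := by linarith
    field_simp
    ring
  refine (measure_iUnion_le _).trans ?_
  calc _ ≤ ∑' k : ℕ, ENNReal.ofReal (ε * (1 / ((k : ℝ) + 1) - 1 / ((k : ℝ) + 1 + 1))) := by
        refine ENNReal.tsum_le_tsum fun k => ?_
        rw [← hk k]
        exact hX.measure_noise_gt_le (Real.sqrt_nonneg _) k
    _ ≤ ENNReal.ofReal ε := by
        have hnn : ∀ k : ℕ, 0 ≤ ε * (1 / ((k : ℝ) + 1) - 1 / ((k : ℝ) + 1 + 1)) := fun k => by
          rw [← hk k]; positivity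
        refine ENNReal.tsum_le_of_sum_range_le fun K => ?_
        rw [← ENNReal.ofReal_sum_of_nonneg fun k _ => hnn k]
        refine ENNReal.ofReal_le_ofReal ?_
        rw [← Finset.mul_sum]
        have h := Finset.sum_range_sub' (fun k : ℕ => 1 / ((k : ℝ) + 1)) K
        push_cast at h
        rw [h]
        have : 0 ≤ 1 / ((K : ℝ) + 1) := by positivity
        simp only [zero_add, div_one] at this ⊢
        nlinarith

/-- Before any data the noise is isotropic, so in the first episode it is largest at any prescribed action
with probability at least one over the number of actions. -/
theorem measure_first_noise_not_argmax_le (hv : 0 < noiseScale S A H δ 1) (astar : S → A) :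
    μ {ω | ¬ ∀ a, a ≠ astar (X.state 1 0 ω) → X.noise 1 ω (X.state 1 0 ω, a)
      < X.noise 1 ω (X.state 1 0 ω, astar (X.state 1 0 ω))}
      ≤ 1 - (Fintype.card A : ℝ≥0∞)⁻¹ := by
  have hH : (0 : ℝ) < H := by exact_mod_cast NeZero.pos H
  let _ : MeasurableSpace S := ⊤
  let Z : Set (S × EuclideanSpace ℝ (S × A)) :=
    {q | ¬ ∀ a, a ≠ astar q.1 → q.2 (q.1, a) < q.2 (q.1, astar q.1)}
  have hG : ∀ s, MeasurableSet {x : EuclideanSpace ℝ (S × A) |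
      ∀ a, a ≠ astar s → x (s, a) < x (s, astar s)} := by
    intro s
    have : {x : EuclideanSpace ℝ (S × A) | ∀ a, a ≠ astar s → x (s, a) < x (s, astar s)}
        = ⋂ a, ⋂ (_ : a ≠ astar s), {x | x (s, a) < x (s, astar s)} := by ext; simp
    rw [this]
    exact MeasurableSet.iInter fun a => MeasurableSet.iInter fun _ =>
      measurableSet_lt (by fun_prop) (by fun_prop)
  have hZ : MeasurableSet Z := by
    have : Z = ⋃ s, {s} ×ˢ {x : EuclideanSpace ℝ (S × A) |
        ∀ a, a ≠ astar s → x (s, a) < x (s, astar s)}ᶜ := by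
      ext q
      simp [Z]
    rw [this]
    exact MeasurableSet.iUnion fun s => (measurableSet_singleton s).prod (hG s).compl
  have hΦ : Measurable[𝓕 0] fun ω => X.state 1 0 ω := hX.measurable_init_index 0 fun s => s
  have h := hX.lintegral_noise_le 0 hΦ (F := Z.indicator 1) (measurable_one.indicator hZ)
    (g := fun _ => 1 - (Fintype.card A : ℝ≥0∞)⁻¹) (fun ω => ?_) (w := fun _ => 1) measurable_const
  · simp only [one_mul, lintegral_const, measure_univ, mul_one] at h
    refine le_trans (le_of_eq ?_) h
    rw [← lintegral_indicator_one]
    · rfl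
    · exact ((hΦ.mono (𝓕.le 0) le_rfl).prodMk
        ((hX.measurable_noise 0).mono (𝓕.le _) le_rfl)) hZ
  · set s := X.state 1 0 ω
    have hcov : (noiseScale S A H δ (0 + 1)) ^ 2 • (X.gram 0 ω)⁻¹
        = ((noiseScale S A H δ 1) ^ 2 * (H : ℝ)⁻¹) • (1 : Matrix (S × A) (S × A) ℝ) := by
      have hinv : ((H : ℝ) • (1 : Matrix (S × A) (S × A) ℝ))⁻¹ = (H : ℝ)⁻¹ • 1 :=
        Matrix.inv_eq_left_inv (by simp [smul_smul, hH.ne'])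
      rw [Run.gram_zero, hinv, mul_smul]
    rw [hcov]
    set N := multivariateGaussian (0 : EuclideanSpace ℝ (S × A))
      (((noiseScale S A H δ 1) ^ 2 * (H : ℝ)⁻¹) • (1 : Matrix (S × A) (S × A) ℝ))
    have hg := inv_card_le_multivariateGaussian_argmax (n := S × A)
      (c := (noiseScale S A H δ 1) ^ 2 * (H : ℝ)⁻¹) (by positivity) (fun a : A => (s, a))
      (fun a b hab => (Prod.mk.inj hab).2) (astar s)
    calc _ = N {x | ∀ a, a ≠ astar s → x (s, a) < x (s, astar s)}ᶜ := by
          rw [← lintegral_indicator_one (hG s).compl]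
          rfl
      _ = 1 - N {x | ∀ a, a ≠ astar s → x (s, a) < x (s, astar s)} := prob_compl_eq_one_sub (hG s)
      _ ≤ _ := tsub_le_tsub_left hg _

end IsThompsonRun

end

/-! ### The confidence bound and the regret of one episode -/

section

variable {S A : Type*} {H : ℕ} {Ω : Type*} [Fintype S] [Fintype A]
    [DecidableEq S] [DecidableEq A]

namespace Run

variable (X : Run S A H Ω)

theorem gram_mulVec (k : ℕ) (ω : Ω) (r : S × A → ℝ) :
    X.gram k ω *ᵥ r = (H : ℝ) • r + ∑ l ∈ Finset.Icc 1 k, (X.freq l ω ⬝ᵥ r) • X.freq l ω := by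
  induction k with
  | zero => rw [gram_zero, Matrix.smul_mulVec, Matrix.one_mulVec]; simp
  | succ k ih =>
    rw [gram_succ, Matrix.add_mulVec, ih, Matrix.vecMulVec_mulVec, op_smul_eq_smul,
      Finset.sum_Icc_succ_top (by omega), add_assoc]

variable [NeZero H]

/-- The normal equation: the error of the estimator consists of the noise and of the bias due to the
regularization. -/
theorem response_sub_gram_mulVec (M : MDP S A) (k : ℕ) (ω : Ω) :
    X.response k ω - X.gram k ω *ᵥ M.meanReward
      = Real.sqrt H • X.noiseSum M k ω - (H : ℝ) • M.meanReward := by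
  have hH : (0 : ℝ) < H := by exact_mod_cast NeZero.pos H
  have hs : Real.sqrt H ≠ 0 := (Real.sqrt_pos.2 hH).ne'
  rw [gram_mulVec, response, noiseSum, Finset.smul_sum]
  have : ∀ l, X.score l ω • X.freq l ω = Real.sqrt H • X.rewardNoise M l ω • X.freq l ω
      + (X.freq l ω ⬝ᵥ M.meanReward) • X.freq l ω := by
    intro l
    rw [smul_smul, ← add_smul, rewardNoise, mul_div_cancel₀ _ hs]
    congr 1
    ring
  rw [Finset.sum_congr rfl fun l _ => this l, Finset.sum_add_distrib]
  abel

theorem abs_dotProduct_inv_gram_le (k : ℕ) (ω : Ω) (x y : S × A → ℝ) :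
    |x ⬝ᵥ (X.gram k ω)⁻¹ *ᵥ y| ≤ X.ellNorm k ω x * X.ellNorm k ω y :=
  abs_dotProduct_mulVec_le (X.gram_posDef k ω).inv.posSemidef x y

theorem ellNorm_meanReward_le (M : MDP S A) (k : ℕ) (ω : Ω) :
    H * X.ellNorm k ω M.meanReward ≤ Real.sqrt (H * Fintype.card (S × A)) := by
  have hH : (0 : ℝ) < H := by exact_mod_cast NeZero.pos H
  refine Real.le_sqrt_of_sq_le ?_
  rw [mul_pow, ellNorm_sq]
  have h1 := X.inv_gram_quadForm_le k ω M.meanReward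
  have h2 : M.meanReward ⬝ᵥ M.meanReward ≤ Fintype.card (S × A) := by
    calc M.meanReward ⬝ᵥ M.meanReward ≤ ∑ _x : S × A, (1 : ℝ) := by
          refine Finset.sum_le_sum fun x _ => ?_
          have := M.meanReward_mem x
          nlinarith [this.1, this.2]
      _ = _ := by rw [Finset.sum_const, Finset.card_univ, nsmul_eq_mul, mul_one]
  calc (H : ℝ) ^ 2 * (M.meanReward ⬝ᵥ (X.gram k ω)⁻¹ *ᵥ M.meanReward)
      ≤ (H : ℝ) ^ 2 * (Fintype.card (S × A) / H) := by
        gcongr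
        exact h1.trans (by gcongr)
    _ = _ := by field_simp

theorem abs_dotProduct_lsEstimator_sub_le (M : MDP S A) (k : ℕ) (ω : Ω) (d : S × A → ℝ) :
    |d ⬝ᵥ X.lsEstimator k ω - d ⬝ᵥ M.meanReward| ≤
      (Real.sqrt H * X.ellNorm k ω (X.noiseSum M k ω) + Real.sqrt (H * Fintype.card (S × A))) *
        X.ellNorm k ω d := by
  have hu : IsUnit (X.gram k ω).det :=
    (Matrix.isUnit_iff_isUnit_det _).1 (X.gram_posDef k ω).isUnit
  have e1 : M.meanReward = (X.gram k ω)⁻¹ *ᵥ (X.gram k ω *ᵥ M.meanReward) := by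
    rw [Matrix.mulVec_mulVec, Matrix.nonsing_inv_mul _ hu, Matrix.one_mulVec]
  have e2 : d ⬝ᵥ X.lsEstimator k ω - d ⬝ᵥ M.meanReward
      = Real.sqrt H * (d ⬝ᵥ (X.gram k ω)⁻¹ *ᵥ X.noiseSum M k ω)
        - H * (d ⬝ᵥ (X.gram k ω)⁻¹ *ᵥ M.meanReward) := by
    conv_lhs => rw [e1, lsEstimator]
    rw [← dotProduct_sub, ← Matrix.mulVec_sub, response_sub_gram_mulVec]
    simp only [Matrix.mulVec_sub, Matrix.mulVec_smul, dotProduct_sub, dotProduct_smul, smul_eq_mul]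
  rw [e2]
  have h1 := X.abs_dotProduct_inv_gram_le k ω d (X.noiseSum M k ω)
  have h2 := X.abs_dotProduct_inv_gram_le k ω d M.meanReward
  have h3 := X.ellNorm_meanReward_le M k ω
  have hd := X.ellNorm_nonneg k ω d
  calc _ ≤ |Real.sqrt H * (d ⬝ᵥ (X.gram k ω)⁻¹ *ᵥ X.noiseSum M k ω)|
        + |H * (d ⬝ᵥ (X.gram k ω)⁻¹ *ᵥ M.meanReward)| := abs_sub _ _
    _ ≤ Real.sqrt H * (X.ellNorm k ω d * X.ellNorm k ω (X.noiseSum M k ω))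
        + H * (X.ellNorm k ω d * X.ellNorm k ω M.meanReward) := by
      rw [abs_mul, abs_mul, abs_of_nonneg (Real.sqrt_nonneg _),
        abs_of_nonneg (Nat.cast_nonneg H : (0 : ℝ) ≤ H)]
      gcongr
    _ ≤ _ := by nlinarith

/-- The least-squares confidence bound: the radius is at most twice the noise scale. -/
theorem abs_dotProduct_lsEstimator_sub_le_noiseScale [Nonempty (S × A)] (M : MDP S A) {δ : ℝ}
    (hδ : 0 < δ) (hδ1 : δ < 1) (k : ℕ) (ω : Ω)
    (h : (X.ellNorm k ω (X.noiseSum M k ω) ^ 2 - X.potential k ω) / 2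
      ≤ Real.log (1 / (δ / (16 * Fintype.card (S × A))))) (d : S × A → ℝ) :
    |d ⬝ᵥ X.lsEstimator k ω - d ⬝ᵥ M.meanReward| ≤
      2 * (noiseScale S A H δ (k + 1) * X.ellNorm k ω d) := by
  have hH1 : (1 : ℝ) ≤ H := by exact_mod_cast NeZero.pos H
  have hn : (1 : ℝ) ≤ Fintype.card (S × A) := by exact_mod_cast Fintype.card_pos
  refine (X.abs_dotProduct_lsEstimator_sub_le M k ω d).trans ?_
  rw [← mul_assoc]
  refine mul_le_mul_of_nonneg_right ?_ (X.ellNorm_nonneg k ω d)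
  have hpot := X.potential_le k ω
  have hcard : (9 * (Fintype.card S : ℝ) * Fintype.card A * H) = 9 * Fintype.card (S × A) * H := by
    rw [Fintype.card_prod]; push_cast; ring
  rw [noiseScale, hcard]
  set n : ℝ := (Fintype.card (S × A) : ℝ) with hn'
  set L := Real.log (((k + 1 : ℕ) : ℝ) * (H : ℝ) ^ 2 / (δ / 10)) with hL
  have hk0 : (0 : ℝ) ≤ k := Nat.cast_nonneg k
  have hHH : (H : ℝ) ≤ (H : ℝ) ^ 2 := by nlinarith
  have hkH : (1 : ℝ) ≤ ((k + 1 : ℕ) : ℝ) * (H : ℝ) ^ 2 := by push_cast; nlinarith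
  have hδ10 : (10 : ℝ) ≤ 10 / δ := by rw [le_div_iff₀ hδ]; nlinarith
  have hLe : ((k + 1 : ℕ) : ℝ) * (H : ℝ) ^ 2 / (δ / 10)
      = ((k + 1 : ℕ) : ℝ) * (H : ℝ) ^ 2 * (10 / δ) := by field_simp
  have hL0 : Real.log (10 / δ) ≤ L := by
    rw [hL, hLe]
    exact Real.log_le_log (by positivity) (by nlinarith)
  have hL1 : 1 ≤ L := by
    refine le_trans ?_ hL0
    rw [Real.le_log_iff_exp_le (by positivity)]
    linarith [Real.exp_one_lt_d9]
  have hL2 : Real.log (1 + k * H) ≤ L := by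
    rw [hL, hLe]
    refine Real.log_le_log (by positivity) ?_
    have : 1 + (k : ℝ) * H ≤ ((k + 1 : ℕ) : ℝ) * (H : ℝ) ^ 2 := by push_cast; nlinarith
    nlinarith
  have hnL1 : L ≤ n * L := le_mul_of_one_le_left (by linarith) hn
  have hnL2 : n ≤ n * L := le_mul_of_one_le_right (by linarith) hL1
  have hL3 : Real.log (1 / (δ / (16 * n))) ≤ 3 * n * L := by
    have e : 1 / (δ / (16 * n)) = (10 / δ) * (8 / 5 * n) := by field_simp; ring
    rw [e, Real.log_mul (by positivity) (by positivity)]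
    have := Real.log_le_sub_one_of_pos (show (0 : ℝ) < 8 / 5 * n by positivity)
    linarith
  have hS : X.ellNorm k ω (X.noiseSum M k ω) ^ 2 ≤ 7 * n * L := by
    have := mul_le_mul_of_nonneg_left hL2 (show 0 ≤ n by linarith)
    linarith
  have e2 : (2 : ℝ) * Real.sqrt (9 * n * H * L) = Real.sqrt (36 * n * H * L) := by
    rw [show (36 : ℝ) * n * H * L = 2 ^ 2 * (9 * n * H * L) by ring,
      Real.sqrt_mul (show (0 : ℝ) ≤ 2 ^ 2 by norm_num), Real.sqrt_sq (by norm_num)]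
  rw [e2]
  refine Real.le_sqrt_of_sq_le ?_
  have hsq1 : Real.sqrt H ^ 2 = H := Real.sq_sqrt (by linarith)
  have hsq2 : Real.sqrt (H * n) ^ 2 = H * n := Real.sq_sqrt (by positivity)
  calc _ ≤ 2 * ((Real.sqrt H * X.ellNorm k ω (X.noiseSum M k ω)) ^ 2 + Real.sqrt (H * n) ^ 2) := by
        nlinarith [sq_nonneg (Real.sqrt H * X.ellNorm k ω (X.noiseSum M k ω) - Real.sqrt (H * n))]
    _ = 2 * H * (X.ellNorm k ω (X.noiseSum M k ω) ^ 2 + n) := by rw [mul_pow, hsq1, hsq2]; ring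
    _ ≤ 2 * H * (7 * n * L + n * L) := by gcongr
    _ ≤ _ := by linarith [show 0 ≤ n * H * L by positivity]

/-- The regret that remains in episode `k + 1` if all policies are evaluated pessimistically, at
width `g`: the optimal value minus the largest lower confidence bound. -/
noncomputable def pessimisticGap (M : MDP S A) (δ : ℝ) (g : ℕ → ℝ) (k : ℕ) (ω : Ω) : ℝ :=
  M.optValue H (X.state (k + 1) 0 ω) - ⨆ π : Policy S A H,
    (M.avgOccupancy π (X.state (k + 1) 0 ω) ⬝ᵥ X.lsEstimator k ω -
      g k * (noiseScale S A H δ (k + 1) *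
        X.ellNorm k ω (M.avgOccupancy π (X.state (k + 1) 0 ω))))

/-- The pessimistic gap clipped to `[0, H]` and divided by `H`. -/
noncomputable def clippedGap (M : MDP S A) (δ : ℝ) (g : ℕ → ℝ) (k : ℕ) (ω : Ω) : ℝ :=
  max 0 (min (H : ℝ) (X.pessimisticGap M δ g k ω)) / H

theorem clippedGap_mem (M : MDP S A) (δ : ℝ) (g : ℕ → ℝ) (k : ℕ) (ω : Ω) :
    X.clippedGap M δ g k ω ∈ Set.Icc (0 : ℝ) 1 := by
  have hH : (0 : ℝ) < H := by exact_mod_cast NeZero.pos H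
  refine ⟨div_nonneg (le_max_left _ _) hH.le, ?_⟩
  rw [clippedGap, div_le_one hH]
  exact max_le hH.le (min_le_left _ _)

omit [Fintype A] [DecidableEq A] in
theorem regret_eq (M : MDP S A) (K : ℕ) (ω : Ω) : X.regret M K ω = ∑ k ∈ Finset.range K,
    (M.optValue H (X.state (k + 1) 0 ω) - M.value (X.policy (k + 1) ω) (X.state (k + 1) 0 ω)) := by
  induction K with
  | zero => simp [regret]
  | succ K ih =>
    rw [Finset.sum_range_succ, ← ih, regret, Finset.sum_Icc_succ_top (by omega)]
    rfl

omit [DecidableEq A] in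
theorem regret_le [Nonempty A] (M : MDP S A) (K : ℕ) (ω : Ω) : X.regret M K ω ≤ K * H := by
  rw [regret_eq]
  calc _ ≤ ∑ _k ∈ Finset.range K, (H : ℝ) := Finset.sum_le_sum fun k _ => (M.gap_mem _ _).2
    _ = _ := by simp

end Run

namespace IsThompsonRun

variable [NeZero H] {mΩ : MeasurableSpace Ω} {M : MDP S A} {δ : ℝ} {μ : Measure Ω}
  {𝓕 : Filtration ℕ mΩ} {X : Run S A H Ω} (hX : IsThompsonRun M δ μ 𝓕 X)

include hX

theorem measurable_clippedGap (g : ℕ → ℝ) (k : ℕ) :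
    Measurable[𝓕 k] (X.clippedGap M δ g k) := by
  have h : Measurable[𝓕 k] (X.pessimisticGap M δ g k) := by
    refine @measurable_of_finite_index Ω S ℝ (𝓕 k) _ _ (X.state (k + 1) 0) (hX.measurable_init k)
      (fun s ω => M.optValue H s - ⨆ π : Policy S A H,
        (M.avgOccupancy π s ⬝ᵥ X.lsEstimator k ω -
          g k * (noiseScale S A H δ (k + 1) * X.ellNorm k ω (M.avgOccupancy π s)))) fun s => ?_
    refine Measurable.const_sub (Measurable.iSup fun π => ?_) _
    exact (measurable_dotProduct measurable_const (hX.measurable_lsEstimator k)).sub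
      (((hX.measurable_ellNorm k le_rfl measurable_const).const_mul _).const_mul _)
  unfold Run.clippedGap
  exact (measurable_const.max (measurable_const.min h)).div_const _

/-- The regret of one episode, on the event that the noise has width `g` and the least-squares
estimator is within twice the noise scale: it exceeds the clipped gap by at most a multiple of the
norm of the occupancy, and the clipped gap itself is of that order if the optimal policy looks
optimistic. -/
theorem gap_le {g : ℕ → ℝ} {k : ℕ} {ω : Ω} [Nonempty A] (hg0 : 0 ≤ g k)
    (hnoise : ∀ π : Policy S A H, |M.avgOccupancy π (X.state (k + 1) 0 ω) ⬝ᵥ (X.noise (k + 1) ω).ofLp|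
      ≤ g k * (noiseScale S A H δ (k + 1) *
        X.ellNorm k ω (M.avgOccupancy π (X.state (k + 1) 0 ω))))
    (hls : ∀ d, |d ⬝ᵥ X.lsEstimator k ω - d ⬝ᵥ M.meanReward| ≤
      2 * (noiseScale S A H δ (k + 1) * X.ellNorm k ω d))
    {πs : Policy S A H} (hπs : M.value πs (X.state (k + 1) 0 ω) = M.optValue H (X.state (k + 1) 0 ω)) :
    M.optValue H (X.state (k + 1) 0 ω) - M.value (X.policy (k + 1) ω) (X.state (k + 1) 0 ω)
      ≤ H * X.clippedGap M δ g k ω + (2 + g k) * (noiseScale S A H δ (k + 1) *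
        X.ellNorm k ω (M.avgOccupancy (X.policy (k + 1) ω) (X.state (k + 1) 0 ω))) ∧
    (2 * (noiseScale S A H δ (k + 1) *
        X.ellNorm k ω (M.avgOccupancy πs (X.state (k + 1) 0 ω)))
        ≤ M.avgOccupancy πs (X.state (k + 1) 0 ω) ⬝ᵥ (X.noise (k + 1) ω).ofLp →
      H * X.clippedGap M δ g k ω ≤ 2 * g k * (noiseScale S A H δ (k + 1) *
        X.ellNorm k ω (M.avgOccupancy (X.policy (k + 1) ω) (X.state (k + 1) 0 ω)))) := by
  have hH : (0 : ℝ) < H := by exact_mod_cast NeZero.pos H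
  have hargmax := hX.policy_argmax k ω
  have hgap := M.gap_mem (X.policy (k + 1) ω) (X.state (k + 1) 0 ω)
  have hsr : ∀ d : S × A → ℝ, d ⬝ᵥ X.sampledReward k ω
      = d ⬝ᵥ X.lsEstimator k ω + d ⬝ᵥ (X.noise (k + 1) ω).ofLp := by
    intro d
    rw [← dotProduct_add]; rfl
  simp only [hsr] at hargmax
  have hHc : H * X.clippedGap M δ g k ω = max 0 (min (H : ℝ) (X.pessimisticGap M δ g k ω)) := by
    rw [Run.clippedGap, mul_div_cancel₀ _ hH.ne']
  rw [hHc]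
  rw [M.value_eq_dotProduct] at hgap hπs ⊢
  set s := X.state (k + 1) 0 ω with hs
  set d := M.avgOccupancy (X.policy (k + 1) ω) s with hd
  have hbdd : BddAbove (Set.range fun π : Policy S A H =>
      (M.avgOccupancy π s ⬝ᵥ X.lsEstimator k ω -
      g k * (noiseScale S A H δ (k + 1) * X.ellNorm k ω (M.avgOccupancy π s)))) :=
    (Set.finite_range _).bddAbove
  have hv0 : 0 ≤ noiseScale S A H δ (k + 1) * X.ellNorm k ω d :=
    mul_nonneg (noiseScale_nonneg _ _) (X.ellNorm_nonneg _ _ _)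
  have hlsd := abs_le.1 (hls d)
  have hnd := abs_le.1 (hnoise (X.policy (k + 1) ω))
  have hw0 := mul_nonneg hg0 hv0
  constructor
  · have h1 : M.optValue H s - d ⬝ᵥ M.meanReward ≤ X.pessimisticGap M δ g k ω
        + (2 + g k) * (noiseScale S A H δ (k + 1) * X.ellNorm k ω d) := by
      have : (⨆ π : Policy S A H, (M.avgOccupancy π s ⬝ᵥ X.lsEstimator k ω -
          g k * (noiseScale S A H δ (k + 1) * X.ellNorm k ω (M.avgOccupancy π s))))
          ≤ d ⬝ᵥ M.meanReward + (2 + g k) * (noiseScale S A H δ (k + 1) * X.ellNorm k ω d) := by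
        refine ciSup_le fun π => ?_
        have h2 := hargmax π
        have h3 := abs_le.1 (hnoise π)
        linarith [hlsd.2, hnd.2, h3.1]
      rw [Run.pessimisticGap]
      linarith
    rcases le_total (X.pessimisticGap M δ g k ω) H with h2 | h2
    · rw [min_eq_right h2]
      linarith [le_max_right 0 (X.pessimisticGap M δ g k ω)]
    · rw [min_eq_left h2, max_eq_right hH.le]
      nlinarith [hgap.2]
  · intro hopt
    refine max_le (by nlinarith) ((min_le_right _ _).trans ?_)
    have h1 := le_ciSup hbdd (X.policy (k + 1) ω)
    have h2 := abs_le.1 (hls (M.avgOccupancy πs s))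
    have h3 := hargmax πs
    rw [Run.pessimisticGap, ← hs, ← hπs]
    linarith [h2.1, hnd.2]

end IsThompsonRun

end

/-! ### The good event -/

theorem sqrt_le_mul_sqrt_mul_log {K : ℝ} (hK : 2 ≤ K) :
    Real.sqrt K ≤ 71 / 50 * Real.sqrt (K * Real.log K) := by
  have h1 := half_le_log hK
  rw [← Real.sqrt_sq (show (0 : ℝ) ≤ 71 / 50 by norm_num), ← Real.sqrt_mul (by norm_num)]
  exact Real.sqrt_le_sqrt (by nlinarith)

theorem one_le_sqrt_mul_log {K : ℝ} (hK : 2 ≤ K) : 1 ≤ Real.sqrt (K * Real.log K) := by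
  have h1 := half_le_log hK
  rw [Real.one_le_sqrt]
  nlinarith

theorem log_le_natCast_mul {x y : ℝ} (hx : 0 < x) (m : ℕ) (h : x ≤ y ^ m) :
    Real.log x ≤ m * Real.log y := by
  rw [← Real.log_pow]
  exact Real.log_le_log hx h

theorem tailLevel_mono {n : ℕ} (hn : 1 ≤ n) {ε : ℝ} (hε : 0 < ε) {j k : ℕ} (hjk : j ≤ k) :
    tailLevel n ε j ≤ tailLevel n ε k := by
  have hn' : (1 : ℝ) ≤ n := by exact_mod_cast hn
  have h : (j : ℝ) ≤ k := by exact_mod_cast hjk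
  unfold tailLevel
  gcongr

theorem noiseScale_mono {S A : Type*} [Fintype S] [Fintype A] {H : ℕ} [NeZero H] {δ : ℝ}
    (hδ : 0 < δ) {j k : ℕ} (hjk : j + 1 ≤ k) :
    noiseScale S A H δ (j + 1) ≤ noiseScale S A H δ k := by
  have hH : (0 : ℝ) < H := by exact_mod_cast NeZero.pos H
  have h : ((j + 1 : ℕ) : ℝ) ≤ k := by exact_mod_cast hjk
  have h0 : (0 : ℝ) < ((j + 1 : ℕ) : ℝ) := by positivity
  unfold noiseScale
  gcongr

section

variable {S A : Type*} {H : ℕ} {Ω : Type*} [Fintype S] [Fintype A]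
    [DecidableEq S] [DecidableEq A] [NeZero H]

/-- The width of the noise of episode `k + 1` in units of the noise scale. -/
noncomputable def noiseWidth (n : ℕ) (ε : ℝ) (k : ℕ) : ℝ := Real.sqrt n * tailLevel n ε k

theorem noiseWidth_nonneg (n : ℕ) (ε : ℝ) (k : ℕ) : 0 ≤ noiseWidth n ε k :=
  mul_nonneg (Real.sqrt_nonneg _) (Real.sqrt_nonneg _)

/-- The event on which the regret bound holds: the noise has the expected width, the optimal policies
look optimistic often enough, the empirical frequencies follow the occupancies, and the reward noise
is self-normalized. -/
structure GoodEvent (X : Run S A H Ω) (M : MDP S A) (δ ε : ℝ) (πs : S → Policy S A H) (ω : Ω) :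
    Prop where
  noise : ∀ (k : ℕ) (π : Policy S A H) (s : S),
    |M.avgOccupancy π s ⬝ᵥ (X.noise (k + 1) ω).ofLp| ≤ noiseWidth (Fintype.card (S × A)) ε k *
      (noiseScale S A H δ (k + 1) * X.ellNorm k ω (M.avgOccupancy π s))
  optimism : ∀ K, ∑ k ∈ Finset.range K,
      (optProb / 2 * X.clippedGap M δ (noiseWidth (Fintype.card (S × A)) ε) k ω -
        if 2 * (noiseScale S A H δ (k + 1) *
          X.ellNorm k ω (M.avgOccupancy (πs (X.state (k + 1) 0 ω)) (X.state (k + 1) 0 ω)))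
        ≤ M.avgOccupancy (πs (X.state (k + 1) 0 ω)) (X.state (k + 1) 0 ω) ⬝ᵥ
          (X.noise (k + 1) ω).ofLp
        then X.clippedGap M δ (noiseWidth (Fintype.card (S × A)) ε) k ω else 0) ≤ Real.log (1 / ε)
  occupancy : ∀ K, ∑ k ∈ Finset.range K,
      (X.ellNorm k ω (M.avgOccupancy (X.policy (k + 1) ω) (X.state (k + 1) 0 ω)) / Real.sqrt H / 2
        - X.ellNorm k ω (X.freq (k + 1) ω) / Real.sqrt H) ≤ Real.log (1 / ε)
  rewardNoise : ∀ K, (X.ellNorm K ω (X.noiseSum M K ω) ^ 2 - X.potential K ω) / 2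
    ≤ Real.log (1 / ε)

/-- The four parts of the good event fail with probability at most `ε` each. -/
theorem IsThompsonRun.measure_not_goodEvent_le {mΩ : MeasurableSpace Ω} {M : MDP S A} {δ : ℝ}
    {μ : Measure Ω} [IsProbabilityMeasure μ] {𝓕 : Filtration ℕ mΩ} {X : Run S A H Ω}
    (hX : IsThompsonRun M δ μ 𝓕 X) [Nonempty (S × A)] {ε : ℝ} (hε : 0 < ε) (hε1 : ε ≤ 1)
    (πs : S → Policy S A H) :
    μ {ω | ¬ GoodEvent X M δ ε πs ω} ≤ ENNReal.ofReal (4 * ε) := by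
  have h1 := hX.measure_exists_noise_gt_le hε hε1
  have h2 := hX.measure_optimism_le hε (fun s => M.avgOccupancy (πs s) s)
    (X.clippedGap M δ (noiseWidth (Fintype.card (S × A)) ε))
    (hX.measurable_clippedGap _) (fun k ω => X.clippedGap_mem M δ _ k ω)
  have h3 := hX.measure_sum_ellNorm_gt_le hε
  have h4 := hX.measure_noiseSum_gt_le hε
  calc _ ≤ ENNReal.ofReal ε + ENNReal.ofReal ε + ENNReal.ofReal ε + ENNReal.ofReal ε := by
        refine (measure_mono fun ω hω => ?_).trans ((measure_union_le _ _).trans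
          (add_le_add ((measure_union_le _ _).trans
          (add_le_add ((measure_union_le _ _).trans (add_le_add h1 h2)) h3)) h4))
        by_contra hcon
        refine hω ?_
        simp only [Set.mem_union, not_or] at hcon
        obtain ⟨⟨⟨c1, c2⟩, c3⟩, c4⟩ := hcon
        exact ⟨fun k π s => not_lt.1 fun h => c1 ⟨k, (π, s), h⟩,
          fun K => not_lt.1 fun h => c2 ⟨K, h⟩, fun K => not_lt.1 fun h => c3 ⟨K, h⟩,
          fun K => not_lt.1 fun h => c4 ⟨K, h⟩⟩
    _ = ENNReal.ofReal (4 * ε) := by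
        rw [← ENNReal.ofReal_add hε.le hε.le, ← ENNReal.ofReal_add (by positivity) hε.le,
          ← ENNReal.ofReal_add (by positivity) hε.le]
        congr 1; ring

/-- On the good event the regret is controlled by the sum `W` of the norms of the occupancies. -/
theorem IsThompsonRun.regret_le_of_goodEvent {mΩ : MeasurableSpace Ω} {M : MDP S A} {δ : ℝ}
    {μ : Measure Ω} {𝓕 : Filtration ℕ mΩ} {X : Run S A H Ω}
    (hX : IsThompsonRun M δ μ 𝓕 X) [Nonempty (S × A)] [Nonempty A] (hδ : 0 < δ) (hδ1 : δ < 1)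
    {πs : S → Policy S A H} (hπs : ∀ s, M.value (πs s) s = M.optValue H s) {ω : Ω}
    (hω : GoodEvent X M δ (δ / (16 * Fintype.card (S × A))) πs ω) (K : ℕ) {W lam G v : ℝ}
    (hW : W = ∑ k ∈ Finset.range K,
      X.ellNorm k ω (M.avgOccupancy (X.policy (k + 1) ω) (X.state (k + 1) 0 ω)))
    (hlam : lam = Real.log (1 / (δ / (16 * Fintype.card (S × A)))))
    (hG : G = noiseWidth (Fintype.card (S × A)) (δ / (16 * Fintype.card (S × A))) K)
    (hv : v = noiseScale S A H δ K) :
    X.regret M K ω ≤ 2 / optProb * (2 * G * v * W + H * lam) + (2 + G) * v * W := by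
  have hH : (0 : ℝ) < H := by exact_mod_cast NeZero.pos H
  have hp := optProb_pos
  have hncard : 1 ≤ Fintype.card (S × A) := Fintype.card_pos
  have hn : (1 : ℝ) ≤ Fintype.card (S × A) := by exact_mod_cast hncard
  set ε := δ / (16 * Fintype.card (S × A)) with hε'
  have hε : 0 < ε := by positivity
  set g := noiseWidth (Fintype.card (S × A)) ε with hg
  set Y : ℕ → ℝ := fun k => X.clippedGap M δ g k ω with hY
  set D : ℕ → ℝ := fun k =>
    X.ellNorm k ω (M.avgOccupancy (X.policy (k + 1) ω) (X.state (k + 1) 0 ω)) with hD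
  have hD0 : ∀ k, 0 ≤ D k := fun k => X.ellNorm_nonneg _ _ _
  have hstep := fun k => hX.gap_le (g := g) (k := k) (ω := ω) (noiseWidth_nonneg _ _ _)
    (fun π => hω.noise k π _)
    (X.abs_dotProduct_lsEstimator_sub_le_noiseScale M hδ hδ1 k ω (hω.rewardNoise k))
    (hπs (X.state (k + 1) 0 ω))
  have hgG : ∀ k, k < K → g k ≤ G := fun k hk => by
    rw [hG, hg]
    exact mul_le_mul_of_nonneg_left (tailLevel_mono hncard hε hk.le) (Real.sqrt_nonneg _)
  have hvv : ∀ k, k < K → noiseScale S A H δ (k + 1) ≤ v := fun k hk => by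
    rw [hv]; exact noiseScale_mono hδ hk
  have hG0 : 0 ≤ G := by rw [hG]; exact noiseWidth_nonneg _ _ _
  have hv0 : 0 ≤ v := by rw [hv]; exact noiseScale_nonneg _ _
  have hg0 : ∀ k, 0 ≤ g k := fun k => noiseWidth_nonneg _ _ _
  have hs0 : ∀ k, 0 ≤ noiseScale S A H δ k := fun k => noiseScale_nonneg _ _
  have hYW : H * ∑ k ∈ Finset.range K, Y k ≤ 2 / optProb * (2 * G * v * W + H * lam) := by
    have h1 := hω.optimism K
    rw [Finset.sum_sub_distrib, ← Finset.mul_sum, ← hlam] at h1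
    have h2 : H * (∑ k ∈ Finset.range K, if 2 * (noiseScale S A H δ (k + 1) *
          X.ellNorm k ω (M.avgOccupancy (πs (X.state (k + 1) 0 ω)) (X.state (k + 1) 0 ω)))
        ≤ M.avgOccupancy (πs (X.state (k + 1) 0 ω)) (X.state (k + 1) 0 ω) ⬝ᵥ
          (X.noise (k + 1) ω).ofLp then X.clippedGap M δ g k ω else 0) ≤ 2 * G * v * W := by
      rw [Finset.mul_sum, hW, Finset.mul_sum]
      refine Finset.sum_le_sum fun k hk => ?_
      have hk' := Finset.mem_range.1 hk
      split_ifs with hopt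
      · refine ((hstep k).2 hopt).trans ?_
        have := mul_le_mul (hgG k hk') (hvv k hk') (hs0 _) hG0
        have h3 := mul_le_mul_of_nonneg_right this (hD0 k)
        simp only [hD] at h3
        linarith
      · rw [mul_zero]
        have := hD0 k
        positivity
    have h3 := mul_le_mul_of_nonneg_left h1 hH.le
    rw [div_mul_eq_mul_div, le_div_iff₀ hp]
    nlinarith
  rw [X.regret_eq]
  calc _ ≤ ∑ k ∈ Finset.range K, (H * Y k + (2 + G) * v * D k) := by
        refine Finset.sum_le_sum fun k hk => (hstep k).1.trans ?_
        have hk' := Finset.mem_range.1 hk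
        have := mul_le_mul (add_le_add_right (hgG k hk') 2) (hvv k hk') (hs0 _) (by linarith)
        have h3 := mul_le_mul_of_nonneg_right this (hD0 k)
        simp only [hD, hY] at h3 ⊢
        linarith
    _ = H * ∑ k ∈ Finset.range K, Y k + (2 + G) * v * W := by
        rw [Finset.sum_add_distrib, ← Finset.mul_sum, ← Finset.mul_sum, hW]
    _ ≤ _ := by linarith

/-- On the good event the norms of the occupancies sum to at most the elliptical potential, up to a
lower-order term. -/
theorem GoodEvent.sum_ellNorm_le {X : Run S A H Ω} {M : MDP S A} {δ ε : ℝ}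
    {πs : S → Policy S A H} {ω : Ω} (hω : GoodEvent X M δ ε πs ω) {K : ℕ} (hK : 2 ≤ K) :
    ∑ k ∈ Finset.range K,
      X.ellNorm k ω (M.avgOccupancy (X.policy (k + 1) ω) (X.state (k + 1) 0 ω)) ≤
    4 * (Real.sqrt H * Real.sqrt (Fintype.card (S × A)) * Real.sqrt (K * Real.log K))
      + 2 * Real.sqrt H * Real.log (1 / ε) := by
  have hH : (0 : ℝ) < H := by exact_mod_cast NeZero.pos H
  have hs : 0 < Real.sqrt H := Real.sqrt_pos.2 hH
  have hK' : (2 : ℝ) ≤ K := by exact_mod_cast hK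
  have hlogK : 0 ≤ Real.log K := Real.log_nonneg (by linarith)
  have h1 := hω.occupancy K
  rw [Finset.sum_sub_distrib, ← Finset.sum_div, ← Finset.sum_div, ← Finset.sum_div] at h1
  have h2 : ∑ k ∈ Finset.range K, X.ellNorm k ω (X.freq (k + 1) ω)
      ≤ 2 * (Real.sqrt H * Real.sqrt (Fintype.card (S × A)) * Real.sqrt (K * Real.log K)) := by
    have h3 := X.sum_ellNorm_sq_le hK ω
    have h4 := sq_sum_le_card_mul_sum_sq (s := Finset.range K)
      (f := fun k => X.ellNorm k ω (X.freq (k + 1) ω))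
    rw [Finset.card_range] at h4
    refine le_of_sq_le_sq (a := ∑ k ∈ Finset.range K, X.ellNorm k ω (X.freq (k + 1) ω)) ?_
      (by positivity)
    refine h4.trans ?_
    rw [mul_pow, mul_pow, mul_pow, Real.sq_sqrt hH.le, Real.sq_sqrt (Nat.cast_nonneg _),
      Real.sq_sqrt (by positivity)]
    calc _ ≤ (K : ℝ) * (4 * H * Fintype.card (S × A) * Real.log K) := by gcongr
      _ = _ := by ring
  rw [div_div, mul_comm (Real.sqrt H) 2, ← div_div, ← sub_div, div_le_iff₀ hs] at h1
  linarith

end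

/-! ### The regret bound -/

/-- The absolute constant of the regret bound. -/
noncomputable def regretConst : ℝ := 6000 / optProb

theorem le_regretConst : 6000 ≤ regretConst := by
  have hp := optProb_pos
  rw [regretConst, le_div_iff₀ hp]
  linarith [optProb_le_one]

/-- The regimes in which the trivial bound `K h` for the regret suffices: few episodes compared with the
square of the dimension, or a logarithm of `1 / δ` that exceeds `√K`. -/
theorem mul_le_of_lt_sq_or_sqrt_lt {n h K l : ℝ} (hn : 1 ≤ n) (hh : 1 ≤ h) (hK : 2 ≤ K)
    (hl : 1 / 2 ≤ l) (hcase : K < n ^ 2 ∨ Real.sqrt K < l) :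
    K * h ≤ 6 * (n * Real.sqrt n * h * Real.sqrt (K * Real.log K) * l) := by
  have hq := sqrt_le_mul_sqrt_mul_log hK
  have hq1 := one_le_sqrt_mul_log hK
  set q := Real.sqrt (K * Real.log K)
  set s := Real.sqrt K
  have hs0 : 0 ≤ s := Real.sqrt_nonneg _
  have hKs : K = s * s := (Real.mul_self_sqrt (by linarith)).symm
  have hsn : 1 ≤ Real.sqrt n := Real.one_le_sqrt.2 hn
  have hmain : K ≤ 6 * (n * q * l) := by
    rcases hcase with h | h
    · have h1 : s ≤ n := Real.sqrt_le_iff.2 ⟨by linarith, h.le⟩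
      calc K = s * s := hKs
        _ ≤ n * (2 * q) := by gcongr; linarith
        _ ≤ n * (2 * q) * (3 * l) := le_mul_of_one_le_right (by positivity) (by linarith)
        _ = _ := by ring
    · calc K = s * s := hKs
        _ ≤ (2 * q) * l := by gcongr; linarith
        _ ≤ 6 * n * (q * l) := by nlinarith [show 0 ≤ q * l by positivity]
        _ = _ := by ring
  calc K * h ≤ 6 * (n * q * l) * h := by gcongr
    _ ≤ 6 * (n * q * l) * h * Real.sqrt n := le_mul_of_one_le_right (by positivity) hsn
    _ = _ := by ring

/-- For `n² ≤ K`, all logarithms in the confidence widths are at most multiples of `log (K h / δ)`. -/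
theorem width_le {n h K δ : ℝ} (hn : 1 ≤ n) (hh : 1 ≤ h) (hK : 2 ≤ K)
    (hδ : 0 < δ) (hδ1 : δ < 1) (hnK : n ^ 2 ≤ K) :
    Real.sqrt (9 * n * h * Real.log (K * h ^ 2 / (δ / 10))) ≤
      8 * (Real.sqrt n * Real.sqrt h * Real.sqrt (Real.log (K * h / δ))) ∧
    Real.sqrt (2 * Real.log (2 * n * ((K + 1) * (K + 2)) / (δ / (16 * n)))) ≤
      5 * Real.sqrt (Real.log (K * h / δ)) ∧
    Real.log (1 / (δ / (16 * n))) ≤ 5 * Real.log (K * h / δ) := by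
  set z := K * h / δ with hz
  have hKhz : K * h ≤ z := le_div_self (by positivity) hδ hδ1.le
  have hKz : K ≤ z := (le_mul_of_one_le_right (by linarith) hh).trans hKhz
  have hhz : h ≤ z := (le_mul_of_one_le_left (by linarith) (by linarith)).trans hKhz
  have hz2 : 2 ≤ z := hK.trans hKz
  have hKδz : K / δ ≤ z := by
    rw [hz]
    gcongr
    exact le_mul_of_one_le_right (by linarith) hh
  have hl0 : 0 < Real.log z := Real.log_pos (by linarith)
  have hnK1 : n ≤ K := by nlinarith
  have hz4 : (16 : ℝ) ≤ z ^ 4 := by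
    calc (16 : ℝ) = 2 ^ 4 := by norm_num
      _ ≤ z ^ 4 := by gcongr
  have hz7 : (128 : ℝ) ≤ z ^ 7 := by
    calc (128 : ℝ) = 2 ^ 7 := by norm_num
      _ ≤ z ^ 7 := by gcongr
  refine ⟨?_, ?_, ?_⟩
  · have h6 : Real.log (K * h ^ 2 / (δ / 10)) ≤ (6 : ℕ) * Real.log z := by
      refine log_le_natCast_mul (by positivity) 6 ?_
      calc K * h ^ 2 / (δ / 10) = 10 * (z * h) := by rw [hz]; field_simp
        _ ≤ z ^ 4 * (z * z) := by gcongr; linarith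
        _ = z ^ 6 := by ring
    push_cast at h6
    refine Real.sqrt_le_iff.2 ⟨by positivity, ?_⟩
    rw [mul_pow, mul_pow, mul_pow, Real.sq_sqrt (by linarith), Real.sq_sqrt (by linarith),
      Real.sq_sqrt hl0.le]
    calc 9 * n * h * Real.log (K * h ^ 2 / (δ / 10)) ≤ 9 * n * h * (6 * Real.log z) := by gcongr
      _ ≤ _ := by linarith [show 0 ≤ n * h * Real.log z by positivity]
  · have h10 : Real.log (2 * n * ((K + 1) * (K + 2)) / (δ / (16 * n))) ≤
        (10 : ℕ) * Real.log z := by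
      refine log_le_natCast_mul (by positivity) 10 ?_
      calc 2 * n * ((K + 1) * (K + 2)) / (δ / (16 * n))
          = 32 * n ^ 2 * ((K + 1) * (K + 2)) / δ := by field_simp; ring
        _ ≤ 32 * K * ((2 * K) * (2 * K)) / δ := by gcongr <;> linarith
        _ = 128 * (K * K * (K / δ)) := by ring
        _ ≤ z ^ 7 * (z * z * z) := by gcongr
        _ = z ^ 10 := by ring
    push_cast at h10
    refine Real.sqrt_le_iff.2 ⟨by positivity, ?_⟩
    rw [mul_pow, Real.sq_sqrt hl0.le]
    linarith
  · refine log_le_natCast_mul (by positivity) 5 ?_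
    calc 1 / (δ / (16 * n)) = 16 * (n / δ) := by field_simp
      _ ≤ 16 * (K / δ) := by gcongr
      _ ≤ z ^ 4 * z := by gcongr
      _ = z ^ 5 := by ring

/-- With `v`, `t`, `lam` and `W` bounded in terms of `n`, `h`, `q` and `l`, every term of the regret bound
is a multiple of `n^{3/2} h q l`. -/
theorem regret_terms_le {n h q l p W v t lam : ℝ} (hn : 1 ≤ n) (hh : 1 ≤ h) (hq1 : 1 ≤ q)
    (hl : 1 / 2 ≤ l) (hlq : l ≤ 2 * q) (hp : 0 < p) (hp1 : p ≤ 1) (hv0 : 0 ≤ v) (ht0 : 0 ≤ t)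
    (hW0 : 0 ≤ W) (hv : v ≤ 8 * (Real.sqrt n * Real.sqrt h * Real.sqrt l))
    (ht : t ≤ 5 * Real.sqrt l) (hlam : lam ≤ 5 * l)
    (hW : W ≤ 4 * (Real.sqrt h * Real.sqrt n * q) + 2 * Real.sqrt h * lam) :
    2 / p * (2 * (Real.sqrt n * t) * v * W + h * lam) + (2 + Real.sqrt n * t) * v * W ≤
      6000 / p * (n * Real.sqrt n * h * q * l) := by
  have hl0 : 0 < l := by linarith
  have ha1 : 1 ≤ Real.sqrt n := Real.one_le_sqrt.2 hn
  have haa : Real.sqrt n * Real.sqrt n = n := Real.mul_self_sqrt (by linarith)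
  have hbb : Real.sqrt h * Real.sqrt h = h := Real.mul_self_sqrt (by linarith)
  have hcc : Real.sqrt l * Real.sqrt l = l := Real.mul_self_sqrt hl0.le
  have hb0 : 0 ≤ Real.sqrt h := Real.sqrt_nonneg h
  have hc0 : 0 < Real.sqrt l := Real.sqrt_pos.2 hl0
  generalize Real.sqrt n = a at *
  generalize Real.sqrt h = b at *
  generalize Real.sqrt l = c at *
  have hc2 : c ≤ 2 * l := by nlinarith
  -- all widths are compared with `n √h l`, all norms with `√h √n q`
  have hGv : a * t * v ≤ 40 * (n * b * l) := by
    calc a * t * v ≤ a * (5 * c) * (8 * (a * b * c)) := by gcongr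
      _ = 40 * (n * b * l) := by rw [← haa, ← hcc]; ring
  have hGv2 : (2 + a * t) * v ≤ 72 * (n * b * l) := by
    have : 2 * v ≤ 32 * (n * b * l) := by
      calc 2 * v ≤ 2 * (8 * (a * b * c)) := by gcongr
        _ ≤ 2 * (8 * (a * b * (2 * l))) := by gcongr
        _ ≤ 2 * (8 * (a * b * (2 * l))) * a := le_mul_of_one_le_right (by positivity) ha1
        _ = _ := by rw [← haa]; ring
    linarith
  have hW24 : W ≤ 24 * (b * a * q) := by
    have h1 : lam ≤ 10 * (a * q) := by
      calc lam ≤ 5 * l := hlam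
        _ ≤ 5 * (2 * q) := by gcongr
        _ ≤ 5 * (2 * q) * a := le_mul_of_one_le_right (by positivity) ha1
        _ = _ := by ring
    calc W ≤ 4 * (b * a * q) + 2 * b * lam := hW
      _ ≤ 4 * (b * a * q) + 2 * b * (10 * (a * q)) := by gcongr
      _ = _ := by ring
  have hQ : (n * b * l) * (b * a * q) = n * a * h * q * l := by rw [← hbb]; ring
  have hGvW : a * t * v * W ≤ 960 * (n * a * h * q * l) := by
    calc a * t * v * W ≤ 40 * (n * b * l) * (24 * (b * a * q)) := by gcongr
      _ = 960 * (n * a * h * q * l) := by rw [← hQ]; ring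
  have hGvW2 : (2 + a * t) * v * W ≤ 1728 * (n * a * h * q * l) := by
    calc (2 + a * t) * v * W ≤ 72 * (n * b * l) * (24 * (b * a * q)) := by gcongr
      _ = 1728 * (n * a * h * q * l) := by rw [← hQ]; ring
  have hHlam : h * lam ≤ 5 * (n * a * h * q * l) := by
    have hna : 1 ≤ n * a * q := one_le_mul_of_one_le_of_one_le
      (one_le_mul_of_one_le_of_one_le hn ha1) hq1
    calc h * lam ≤ h * (5 * l) := by gcongr
      _ ≤ h * (5 * l) * (n * a * q) := le_mul_of_one_le_right (by positivity) hna
      _ = _ := by ring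
  have hQ0 : 0 ≤ n * a * h * q * l := by positivity
  generalize n * a * h * q * l = Q at *
  have hQp : Q ≤ Q / p := le_div_self hQ0 hp hp1
  calc _ ≤ 2 / p * (2 * (960 * Q) + 5 * Q) + 1728 * Q := by
        have : 2 * (a * t) * v * W + h * lam ≤ 2 * (960 * Q) + 5 * Q := by linarith
        gcongr
    _ = 3850 * (Q / p) + 1728 * Q := by ring
    _ ≤ 6000 * (Q / p) := by linarith
    _ = 6000 / p * Q := by ring

section

variable {S A : Type*} {H : ℕ} {Ω : Type*} [Fintype S] [Fintype A]
    [DecidableEq S] [DecidableEq A]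

/-- The regret bound for at least two episodes, on the good event. -/
theorem IsThompsonRun.regret_le_of_two_le [NeZero H] {mΩ : MeasurableSpace Ω} {M : MDP S A} {δ : ℝ}
    {μ : Measure Ω} {𝓕 : Filtration ℕ mΩ} {X : Run S A H Ω}
    (hX : IsThompsonRun M δ μ 𝓕 X) [Nonempty (S × A)] [Nonempty A] (hδ : 0 < δ) (hδ1 : δ < 1)
    {πs : S → Policy S A H} (hπs : ∀ s, M.value (πs s) s = M.optValue H s) {ω : Ω}
    (hω : GoodEvent X M δ (δ / (16 * Fintype.card (S × A))) πs ω) {K : ℕ} (hK : 2 ≤ K) :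
    X.regret M K ω ≤ regretConst * (Fintype.card (S × A) * Real.sqrt (Fintype.card (S × A)) * H *
      Real.sqrt (K * Real.log K) * Real.log (K * H / δ)) := by
  have hH : (1 : ℝ) ≤ H := by exact_mod_cast NeZero.pos H
  have hn : (1 : ℝ) ≤ Fintype.card (S × A) := by exact_mod_cast Fintype.card_pos
  have hK' : (2 : ℝ) ≤ K := by exact_mod_cast hK
  have hz2 : (2 : ℝ) ≤ K * H / δ := by rw [le_div_iff₀ hδ]; nlinarith
  have hl := half_le_log hz2
  by_cases hcase : (K : ℝ) < (Fintype.card (S × A) : ℝ) ^ 2 ∨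
      Real.sqrt K < Real.log (K * H / δ)
  · calc _ ≤ (K : ℝ) * H := X.regret_le M K ω
      _ ≤ _ := mul_le_of_lt_sq_or_sqrt_lt hn hH hK' hl hcase
      _ ≤ _ := by
        refine mul_le_mul_of_nonneg_right ?_ (by positivity)
        linarith [le_regretConst]
  · push Not at hcase
    refine (hX.regret_le_of_goodEvent hδ hδ1 hπs hω K rfl rfl rfl rfl).trans ?_
    have hcard : (9 * (Fintype.card S : ℝ) * Fintype.card A * H)
        = 9 * Fintype.card (S × A) * H := by
      rw [Fintype.card_prod]; push_cast; ring
    obtain ⟨h1, h2, h3⟩ := width_le hn hH hK' hδ hδ1 hcase.1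
    have hsK := sqrt_le_mul_sqrt_mul_log hK'
    have hq1 := one_le_sqrt_mul_log hK'
    refine regret_terms_le hn hH hq1 hl (by linarith [hcase.2]) optProb_pos optProb_le_one
      (noiseScale_nonneg _ _) (Real.sqrt_nonneg _)
      (Finset.sum_nonneg fun k _ => X.ellNorm_nonneg _ _ _) ?_ h2 h3 (hω.sum_ellNorm_le hK)
    rwa [noiseScale, hcard]

theorem MDP.avgOccupancy_dotProduct_of_horizon_one (M : MDP S A) (π : Policy S A 1) (s : S)
    (f : S × A → ℝ) : M.avgOccupancy π s ⬝ᵥ f = f (s, π 0 s) := by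
  rw [M.avgOccupancy_dotProduct, Finset.sum_eq_single fun _ => s]
  · simp [MDP.pathProb, pathFreq_dotProduct]
  · intro σ _ hσ
    have : σ 0 ≠ s := fun h => hσ (funext fun i => by rw [Subsingleton.elim i 0, h])
    simp [MDP.pathProb, this]
  · simp

/-- With horizon one and no data, the policy of the first episode is optimal if the noise is largest
at an optimal action. -/
theorem IsThompsonRun.regret_one_le_zero {mΩ : MeasurableSpace Ω} {M : MDP S A} {δ : ℝ}
    {μ : Measure Ω} {𝓕 : Filtration ℕ mΩ} {X : Run S A 1 Ω}
    (hX : IsThompsonRun M δ μ 𝓕 X)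
    {πs : S → Policy S A 1} (hπs : ∀ s, M.value (πs s) s = M.optValue 1 s) {ω : Ω}
    (hω : ∀ a, a ≠ πs (X.state 1 0 ω) 0 (X.state 1 0 ω) → X.noise 1 ω (X.state 1 0 ω, a)
      < X.noise 1 ω (X.state 1 0 ω, πs (X.state 1 0 ω) 0 (X.state 1 0 ω))) :
    X.regret M 1 ω ≤ 0 := by
  have h1 := hX.policy_argmax 0 ω (πs (X.state 1 0 ω))
  simp only [zero_add, M.avgOccupancy_dotProduct_of_horizon_one, Run.sampledReward,
    Run.lsEstimator, Run.response] at h1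
  simp only [Finset.Icc_eq_empty (show ¬ (1 ≤ 0) by norm_num), Finset.sum_empty,
    Matrix.mulVec_zero, Pi.zero_apply, zero_add] at h1
  have h2 : X.policy 1 ω 0 (X.state 1 0 ω) = πs (X.state 1 0 ω) 0 (X.state 1 0 ω) := by
    by_contra hne
    exact absurd (hω _ hne) (not_lt.2 h1)
  rw [X.regret_eq, Finset.sum_range_one, ← hπs, M.value_eq_dotProduct, M.value_eq_dotProduct]
  simp only [zero_add, M.avgOccupancy_dotProduct_of_horizon_one]
  rw [h2, sub_self]

theorem one_sub_le_measureReal {mΩ : MeasurableSpace Ω} {μ : Measure Ω} [IsProbabilityMeasure μ]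
    {s : Set Ω} {b : ℝ} (hb : 0 ≤ b) (h : μ sᶜ ≤ ENNReal.ofReal b) : 1 - b ≤ μ.real s := by
  have h1 : (1 : ℝ≥0∞) ≤ μ s + μ sᶜ := by
    rw [← measure_univ (μ := μ), ← Set.union_compl_self s]
    exact measure_union_le _ _
  have h2 := ENNReal.toReal_mono (by finiteness) (h1.trans (add_le_add_right h (μ s)))
  rw [ENNReal.toReal_add (by finiteness) (by finiteness), ENNReal.toReal_ofReal hb] at h2
  simp only [ENNReal.toReal_one] at h2
  rw [measureReal_def]
  linarith

/-- The probability of the regret bound, in the product form of the dimension factor. -/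
theorem IsThompsonRun.lt_measureReal_regret_le [NeZero H] {mΩ : MeasurableSpace Ω} {M : MDP S A}
    {δ : ℝ} {μ : Measure Ω} [IsProbabilityMeasure μ] {𝓕 : Filtration ℕ mΩ} {X : Run S A H Ω}
    (hX : IsThompsonRun M δ μ 𝓕 X) (hδ : 0 < δ) (hδ1 : δ < 1) :
    1 - δ < μ.real {ω | ∀ K : ℕ, 0 < K → X.regret M K ω ≤
      regretConst * (Fintype.card (S × A) * Real.sqrt (Fintype.card (S × A)) * H *
        Real.sqrt (K * Real.log K) * Real.log (K * H / δ)) +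
      regretConst * (Fintype.card (S × A) * H *
        Real.sqrt (Real.log (K * (H : ℝ) ^ 2 / δ)))} := by
  obtain ⟨ω₀⟩ := nonempty_of_isProbabilityMeasure μ
  have hS : Nonempty S := ⟨X.state 1 0 ω₀⟩
  have hA : Nonempty A := ⟨X.policy 1 ω₀ 0 (X.state 1 0 ω₀)⟩
  have hH : (1 : ℝ) ≤ H := by exact_mod_cast NeZero.pos H
  have hn : (1 : ℝ) ≤ Fintype.card (S × A) := by exact_mod_cast Fintype.card_pos
  have hC := le_regretConst
  choose πs hπs using fun s => M.exists_value_eq_optValue (H := H) s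
  set n : ℝ := (Fintype.card (S × A) : ℝ) with hndef
  set ε := δ / (16 * n) with hε
  have hε0 : 0 < ε := by positivity
  have hεδ : 4 * ε = δ / (4 * n) := by rw [hε]; field_simp; ring
  have hδn : δ / (4 * n) < δ := by rw [div_lt_iff₀ (by positivity)]; nlinarith
  have hgood := hX.measure_not_goodEvent_le hε0 (by linarith) πs
  rw [hεδ] at hgood
  -- for `K = 1` the first term of the bound vanishes, as `log 1 = 0`, and only the second is available
  have hbound : ∀ ω, GoodEvent X M δ ε πs ω →
      X.regret M 1 ω ≤ regretConst * (n * H * Real.sqrt (Real.log ((H : ℝ) ^ 2 / δ))) →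
      ∀ K : ℕ, 0 < K → X.regret M K ω ≤
        regretConst * (n * Real.sqrt n * H *
          Real.sqrt (K * Real.log K) * Real.log (K * H / δ)) +
        regretConst * (n * H * Real.sqrt (Real.log (K * (H : ℝ) ^ 2 / δ))) := by
    intro ω hω h1 K hK
    rcases Nat.lt_or_ge K 2 with hK2 | hK2
    · obtain rfl : K = 1 := by omega
      simpa using h1
    · refine (hX.regret_le_of_two_le hδ hδ1 hπs hω hK2).trans (le_add_of_nonneg_right ?_)
      positivity
  have hfirst : ∀ ω, X.regret M 1 ω ≤ H := fun ω => by
    simpa using X.regret_le M 1 ω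
  by_cases hcase : (H : ℝ) ≤ regretConst * (n * H * Real.sqrt (Real.log ((H : ℝ) ^ 2 / δ)))
  · refine lt_of_lt_of_le ?_ (one_sub_le_measureReal (b := δ / (4 * n)) (by positivity) ?_)
    · linarith
    · refine (measure_mono fun ω hω => ?_).trans hgood
      exact fun hg => hω (hbound ω hg ((hfirst ω).trans hcase))
  · push Not at hcase
    -- The second term of the bound is smaller than the trivial bound `H` only if `H = 1` and `1 - δ` is
    -- of order `n⁻²`. It is then enough that the first policy is optimal with probability about `n⁻¹`.
    have hsmall : n * Real.sqrt (Real.log ((H : ℝ) ^ 2 / δ)) < 1 / 6000 := by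
      have h1 : regretConst * (n * Real.sqrt (Real.log ((H : ℝ) ^ 2 / δ))) * H < 1 * H := by
        linarith
      have h2 := lt_of_mul_lt_mul_right h1 (by linarith)
      have h3 : 0 ≤ n * Real.sqrt (Real.log ((H : ℝ) ^ 2 / δ)) := by positivity
      nlinarith
    have hH1 : H = 1 := by
      by_contra hne
      have hH2 : (2 : ℝ) ≤ H := by
        have := NeZero.pos H
        exact_mod_cast (by omega : 2 ≤ H)
      have h1 : (2 : ℝ) ≤ (H : ℝ) ^ 2 / δ := by rw [le_div_iff₀ hδ]; nlinarith
      have h2 := half_le_log h1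
      have h3 : (1 / 2 : ℝ) ≤ Real.sqrt (Real.log ((H : ℝ) ^ 2 / δ)) :=
        Real.le_sqrt_of_sq_le (by linarith)
      nlinarith
    subst hH1
    simp only [Nat.cast_one, one_pow] at hsmall
    have hlog : 1 - δ ≤ Real.log (1 / δ) := by
      rw [one_div, Real.log_inv]
      linarith [Real.log_le_sub_one_of_pos hδ]
    have hsq : n * n * (1 - δ) < 1 / 2 := by
      have h0 := Real.sqrt_nonneg (Real.log (1 / δ))
      have h1 := Real.mul_self_sqrt (show 0 ≤ Real.log (1 / δ) by linarith)
      have h2 : (n * Real.sqrt (Real.log (1 / δ))) * (n * Real.sqrt (Real.log (1 / δ)))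
          = n * n * Real.log (1 / δ) := by
        rw [← h1]
        ring_nf
        rw [Real.sqrt_sq (Real.sqrt_nonneg _)]
      have h3 : (n * Real.sqrt (Real.log (1 / δ))) * (n * Real.sqrt (Real.log (1 / δ)))
          ≤ 1 / 6000 * 1 := by gcongr; linarith
      have h4 : n * n * (1 - δ) ≤ n * n * Real.log (1 / δ) := by gcongr
      linarith
    have hv : 0 < noiseScale S A 1 δ 1 := by
      have hlog10 : 0 < Real.log (1 / (δ / 10)) := by
        refine Real.log_pos ?_
        rw [lt_div_iff₀ (by positivity)]
        linarith
      have hS' : (0 : ℝ) < Fintype.card S := by exact_mod_cast Fintype.card_pos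
      have hA' : (0 : ℝ) < Fintype.card A := by exact_mod_cast Fintype.card_pos
      unfold noiseScale
      simp only [Nat.cast_one, one_pow, mul_one]
      positivity
    have hfa := hX.measure_first_noise_not_argmax_le hv fun s => πs s 0 s
    have hA1 : (1 : ℝ) ≤ Fintype.card A := by exact_mod_cast Fintype.card_pos
    have hAn : (Fintype.card A : ℝ) ≤ n := by
      have hS1 : (1 : ℝ) ≤ Fintype.card S := by exact_mod_cast Fintype.card_pos
      rw [hndef, Fintype.card_prod]
      push_cast
      nlinarith
    have hinv1 : (Fintype.card A : ℝ)⁻¹ ≤ 1 := inv_le_one_of_one_le₀ hA1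
    have hof : (1 : ℝ≥0∞) - (Fintype.card A : ℝ≥0∞)⁻¹
        = ENNReal.ofReal (1 - (Fintype.card A : ℝ)⁻¹) := by
      rw [ENNReal.ofReal_sub _ (by positivity), ENNReal.ofReal_one,
        ENNReal.ofReal_inv_of_pos (by linarith), ENNReal.ofReal_natCast]
    rw [hof] at hfa
    refine lt_of_lt_of_le ?_ (one_sub_le_measureReal
      (b := δ / (4 * n) + (1 - (Fintype.card A : ℝ)⁻¹)) ?_ ?_)
    · have h1 : n⁻¹ ≤ (Fintype.card A : ℝ)⁻¹ := by gcongr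
      have h2 : δ / (4 * n) ≤ 1 / 4 * n⁻¹ := by
        rw [div_le_iff₀ (by positivity)]
        field_simp
        linarith
      have h3 : 1 - δ < 1 / 2 * n⁻¹ := by
        rw [← div_eq_mul_inv, lt_div_iff₀ (by linarith)]
        nlinarith
      have h4 : 0 < n⁻¹ := by positivity
      linarith
    · have : 0 ≤ δ / (4 * n) := by positivity
      linarith
    · rw [ENNReal.ofReal_add (by positivity) (by linarith)]
      refine (measure_mono fun ω hω => ?_).trans
        ((measure_union_le _ _).trans (add_le_add hgood hfa))
      by_contra hcon
      simp only [Set.mem_union, Set.mem_ofPred_eq, not_or, not_not] at hcon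
      refine hω (hbound ω hcon.1 ((hX.regret_one_le_zero hπs hcon.2).trans ?_))
      have : 0 < regretConst := by linarith
      positivity

end

end TrajFeedback

theorem mainTheorem2 :
    ∃ C : ℝ, 0 < C ∧
      ∀ (S A : Type*) [Fintype S] [Fintype A] [DecidableEq S] [DecidableEq A]
        (H : ℕ) [NeZero H] (M : TrajFeedback.MDP S A) (δ : ℝ), 0 < δ → δ < 1 →
      ∀ (Ω : Type*) (mΩ : MeasurableSpace Ω) (μ : MeasureTheory.Measure Ω)
        [MeasureTheory.IsProbabilityMeasure μ] (𝓕 : MeasureTheory.Filtration ℕ mΩ)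
        (X : TrajFeedback.Run S A H Ω), TrajFeedback.IsThompsonRun M δ μ 𝓕 X →
      1 - δ < μ.real {ω | ∀ K : ℕ, 0 < K →
        X.regret M K ω ≤
          C * (((Fintype.card S * Fintype.card A : ℝ) ^ (3 / 2 : ℝ)) * H *
            Real.sqrt (K * Real.log K) * Real.log (K * H / δ)) +
          C * (Fintype.card S * Fintype.card A * H *
            Real.sqrt (Real.log (K * (H : ℝ) ^ 2 / δ)))} := by
  refine ⟨TrajFeedback.regretConst, by linarith [TrajFeedback.le_regretConst], ?_⟩
  intro S A _ _ _ _ H _ M δ hδ hδ1 Ω mΩ μ _ 𝓕 X hX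
  have h := hX.lt_measureReal_regret_le hδ hδ1
  have hcard : (Fintype.card (S × A) : ℝ) = Fintype.card S * Fintype.card A := by
    rw [Fintype.card_prod]; push_cast; rfl
  have hpow : ((Fintype.card S * Fintype.card A : ℝ) ^ (3 / 2 : ℝ)) =
      Fintype.card S * Fintype.card A * Real.sqrt (Fintype.card S * Fintype.card A) := by
    rw [show (3 / 2 : ℝ) = 1 + 1 / 2 by norm_num,
      Real.rpow_add_of_nonneg (by positivity) (by norm_num) (by norm_num), Real.rpow_one,
      Real.sqrt_eq_rpow]
  rw [hcard] at h
  rw [hpow]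
  exact h
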